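/- Let $f\in C^1[0,\infty)$ with $f>0$ on $[0,\infty)$, and put $$g=\log f,\qquad H=\frac{g\,g''}{(g')^2},\qquad F(s)=\int_s^\infty\frac{dt}{f(t)} .$$ Assume: (G1) $g(s)>0$ and $\int_s^\infty \frac{du}{g(u)}<\infty$ for all large $s$, and $\lim_{s\to\infty}H(s)=\frac1q$ for some $q\in(0,\infty)$; (G2) there are $C,s_0>0$ such that $g\in C^5(s_0,\infty)$ and $|H^{(k)}(s)|<C\left(\frac{g'(s)}{g(s)}\right)^k$ for $k\in\{1,2,3\}$ and $s>s_0$; (A) $\frac{g^k(s)\,|H^{(k)}(s)|}{g'(s)^k}\to0$ as $s\to\infty$ for $k\in\{1,2\}$. (Then $g$ is strictly increasing near infinity with limit $\infty$; $g^{-1}$ is its inverse at large values, $F^{-1}$ is the inverse of the decreasing function $F$ on $[0,\infty)$, and $q\ge 1$.) Put $B=q$ and, for small $r>0$, $$\tilde u(r)=F^{-1}\!\left(\tfrac B4 r^2(-2\log r+1)\right).$$ (1) For every $\varepsilon>0$, as $r\to0^+$, $$g(\tilde u(r))=-2\log r-2\log(-2\log r)+\log\!\left[\tfrac{g}{g'}\big(g^{-1}(-2\log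 r)\big)\right]+\log4-\log q+o\big((-\log r)^{-1+\varepsilon}\big).$$ (2) For a positive nonlinearity $h$ with $F_h(s)=\int_s^\infty dt/h(t)$ put $$\frac1{B_1[h]}=(-\log F_h)\,(1-h'F_h),\qquad \frac1{B_2[h]}=h'F_h\,(-\log F_h)^2\left[\frac{h\,h''F_h}{h'}-1\right].$$ If $B>1$, let $\frac1B+\frac1{B'}=1$, $\phi(s)=\frac{4}{BB'}\frac{e^{s^{B'}}}{s^{2B'-1}}$ and $v(r)=(-2\log r)^{1/B'}$; if $B=1$, let $\phi(s)=4\frac{e^{e^s}}{e^{2s}}$ and $v(r)=\log(-2\log r)$. Put $$R_i(r)=\left|\frac1{B_i[f](\tilde u(r))}-\frac1{B_i[\phi](v(r))}\right|\ (i=1,2),\qquad R(r)=\sup_{0<s\le r}\big(R_1(s)+R_2(s)\big).$$ By a radial singular solution on $\{0<|x|<\rho\}\subset\mathbb R^2$ we mean a function $U\in C^2(0,\rho)$, $U\ge0$, such that $-\Delta U(|x|)=f(U(|x|))$ for $0<|x|<\rho$ and $U(r)\to\infty$ as $r\to0^+$. Suppose in addition (F3) $\lim_{r\to0^+}(-\log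 r)^{1/2}\,[R_1(r)+R_2(r)]=0$, and let $u$ be a radial singular solution on $\{0<|x|<\rho\}$ of the type constructed by Fujishima, Ioku, Ruf and Terraneo, that is, one with $$u(r)=\tilde u(r)+O\big(f(\tilde u(r))F(\tilde u(r))R(r)\big)\qquad(r\to0^+).$$ Then, as $r\to0^+$, $$g(u)=g(\tilde u)+O(R)\qquad\text{and}\qquad g(u)=g(\tilde u)+o\big((-\log r)^{-1/2}\big).$$ Moreover, $u$ is the singular solution $U_\infty$ characterized by $$g(U_\infty(r))=-2\log r-2\log(-2\log r)+\log\!\left[\tfrac{g}{g'}\big(g^{-1}(-2\log r)\big)\right]+\log4-\log q+\log\big(qH(g^{-1}(-2\log r))\big)+o\big((-\log r)^{-1+\varepsilon}\big)\quad(r\to0^+):$$ $u$ has this expansion for every $\varepsilon\in(0,\frac12]$, and every radial singular solution $U$ on some $\{0<|x|<\rho'\}$ that has this expansion for some $\varepsilon\in(0,\frac12]$ satisfies $u=U$ on $(0,\min\{\rho,\rho'\})$. -/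

import Mathlib

open Set Filter Topology MeasureTheory Asymptotics

noncomputable section

namespace SingularSolution

/-- `F[f](s) = ∫_s^∞ dt / f(t)`. -/
def tailF (f : ℝ → ℝ) (s : ℝ) : ℝ := ∫ t in Ioi s, 1 / f t

/-- The inverse function on `[0, ∞)`: for `y` in the image of `[0, ∞)` under `h` this is a point
`s ≥ 0` with `h s = y`. It is used for `F[f]`, which is injective on `[0, ∞)`, and for
`g = log f` at large `y`, for which `g s = y` has only one solution `s ≥ 0`. -/
def invOnNonneg (h : ℝ → ℝ) : ℝ → ℝ := Function.invFunOn h (Ici 0)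

/-- `g = log f`. -/
def logOf (f : ℝ → ℝ) (s : ℝ) : ℝ := Real.log (f s)

/-- `H[g] = g g'' / (g')²`. -/
def growthH (g : ℝ → ℝ) (s : ℝ) : ℝ := g s * deriv (deriv g) s / deriv g s ^ 2

/-- Standing assumption on the nonlinearity: `f ∈ C¹[0, ∞)` and `f > 0` on `[0, ∞)`. -/
def PositiveC1 (f : ℝ → ℝ) : Prop :=
  ContDiffOn ℝ 1 f (Ici 0) ∧ ∀ s, 0 ≤ s → 0 < f s

/-- (G1): `g > 0` and `∫_s^∞ du / g(u) < ∞` for all large `s`, and `H[g](s) → 1 / q` as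
`s → ∞`, for a finite `q > 0`. -/
def CondG1 (g : ℝ → ℝ) (q : ℝ) : Prop :=
  0 < q ∧ (∀ᶠ s in atTop, 0 < g s) ∧
    (∀ᶠ s in atTop, IntegrableOn (fun u => 1 / g u) (Ioi s)) ∧
    Tendsto (growthH g) atTop (𝓝 (1 / q))

/-- (G2): `g ∈ C⁵(s₀, ∞)` and `|H^{(k)}| < C (g' / g)^k` on `(s₀, ∞)` for `k = 1, 2, 3`. -/
def CondG2 (g : ℝ → ℝ) : Prop :=
  ∃ C > 0, ∃ s₀ > 0, ContDiffOn ℝ 5 g (Ioi s₀) ∧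
    ∀ k ∈ ({1, 2, 3} : Set ℕ), ∀ s > s₀,
      |iteratedDeriv k (growthH g) s| < C * (deriv g s / g s) ^ k

/-- The additional condition `g^k |H^{(k)}| / (g')^k = o(1)` as `s → ∞` for `k = 1, 2`. -/
def CondAdd (g : ℝ → ℝ) : Prop :=
  ∀ k ∈ ({1, 2} : Set ℕ),
    Tendsto (fun s => g s ^ k * |iteratedDeriv k (growthH g) s| / deriv g s ^ k) atTop (𝓝 0)

/-- `1 / B₁[f](s) = (-log F(s)) (1 - f'(s) F(s))`. -/
def invB1 (f : ℝ → ℝ) (s : ℝ) : ℝ :=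
  (-Real.log (tailF f s)) * (1 - deriv f s * tailF f s)

/-- `1 / B₂[f](s) = f'(s) F(s) (-log F(s))² [f(s) f''(s) F(s) / f'(s) - 1]`. -/
def invB2 (f : ℝ → ℝ) (s : ℝ) : ℝ :=
  deriv f s * tailF f s * (-Real.log (tailF f s)) ^ 2 *
    (f s * deriv (deriv f) s * tailF f s / deriv f s - 1)

/-- The model nonlinearity `φ`, with `B'` the Hölder conjugate of `B`:
`φ(s) = (4 / (B B')) e^{s^{B'}} / s^{2 B' - 1}` if `B > 1`, and `φ(s) = 4 e^{e^s} / e^{2 s}`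
if `B = 1`. -/
def modelPhi (B : ℝ) (s : ℝ) : ℝ :=
  if B = 1 then 4 * Real.exp (Real.exp s) / Real.exp (2 * s)
  else 4 / (B * B.conjExponent) * Real.exp (s ^ B.conjExponent) / s ^ (2 * B.conjExponent - 1)

/-- The explicit singular solution `v` of `-Δ v = φ(v)`:
`v(r) = (-2 log r)^{1 / B'}` if `B > 1`, and `v(r) = log (-2 log r)` if `B = 1`. -/
def modelV (B : ℝ) (r : ℝ) : ℝ :=
  if B = 1 then Real.log (-2 * Real.log r)
  else (-2 * Real.log r) ^ (1 / B.conjExponent)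

/-- `ũ(r) = F⁻¹((B / 4) r² (-2 log r + 1))`. -/
def modelU (f : ℝ → ℝ) (B : ℝ) (r : ℝ) : ℝ :=
  invOnNonneg (tailF f) (B / 4 * r ^ 2 * (-2 * Real.log r + 1))

/-- `R₁ + R₂`, where `Rᵢ(r) = |1 / Bᵢ[f](ũ(r)) - 1 / Bᵢ[φ](v(r))|`. -/
def remainderSum (f : ℝ → ℝ) (B : ℝ) (r : ℝ) : ℝ :=
  |invB1 f (modelU f B r) - invB1 (modelPhi B) (modelV B r)| +
    |invB2 f (modelU f B r) - invB2 (modelPhi B) (modelV B r)|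

/-- `R(r) = sup_{0 < s ≤ r} (R₁(s) + R₂(s))`. -/
def remainderSup (f : ℝ → ℝ) (B : ℝ) (r : ℝ) : ℝ :=
  sSup (remainderSum f B '' Ioc 0 r)

/-- (F3): `(-log r)^{1/2} (R₁(r) + R₂(r)) → 0` as `r → 0`. -/
def CondF3 (f : ℝ → ℝ) (B : ℝ) : Prop :=
  Tendsto (fun r => (-Real.log r) ^ (1 / 2 : ℝ) * remainderSum f B r) (𝓝[>] 0) (𝓝 0)

/-- `U` is a radial singular solution of `-Δ u = f(u)` in the punctured disc `0 < |x| < ρ` of `ℝ²`.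
As `f` is a function on `[0, ∞)`, the values of `U` have to be nonnegative. -/
structure IsRadialSingularSolution (f : ℝ → ℝ) (ρ : ℝ) (U : ℝ → ℝ) : Prop where
  radius_pos : 0 < ρ
  contDiffOn : ContDiffOn ℝ 2 U (Ioo 0 ρ)
  nonneg : ∀ r ∈ Ioo 0 ρ, 0 ≤ U r
  equation : ∀ x : EuclideanSpace ℝ (Fin 2), x ≠ 0 → ‖x‖ < ρ →
    -Laplacian.laplacian (fun y : EuclideanSpace ℝ (Fin 2) => U ‖y‖) x = f (U ‖x‖)
  singular : Tendsto U (𝓝[>] 0) atTop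

/-- `-2 log r - 2 log (-2 log r) + log [(g / g')(g⁻¹(-2 log r))] + log 4 - log q`. -/
def baseExpansion (g : ℝ → ℝ) (q : ℝ) (r : ℝ) : ℝ :=
  -2 * Real.log r - 2 * Real.log (-2 * Real.log r) +
    Real.log (g (invOnNonneg g (-2 * Real.log r)) / deriv g (invOnNonneg g (-2 * Real.log r))) +
    Real.log 4 - Real.log q

/-- The asymptotics that singles out the solution `U_∞`: as `r → 0`, `g(U(r))` is the sum of
`baseExpansion`, `log (q H(g⁻¹(-2 log r)))` and `o((-log r)^{-1 + ε})`. -/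
def HasSingularAsymptotics (g : ℝ → ℝ) (q ε : ℝ) (U : ℝ → ℝ) : Prop :=
  (fun r => g (U r) -
      (baseExpansion g q r + Real.log (q * growthH g (invOnNonneg g (-2 * Real.log r)))))
    =o[𝓝[>] 0] fun r => (-Real.log r) ^ (-1 + ε)

end SingularSolution

end

open SingularSolution

/-!
In the variable `t = -2 log r` the radial equation becomes `u'' = -e^{-t} f(u) / 4`, and `r → 0`
becomes `t → ∞`. Everything is measured against `g = log f` with the derivation `D = (g / g') d/ds`:
the growth hypotheses say that `H`, `D H`, `D² H` are bounded "symbols", that `H → 1 / q` and that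
`D H → 0` (`regularGrowth`).

*The profile `ũ`.* Comparing `F` with `(e^{-g} / g') (1 - H / g)` gives `f' F = 1 - H / g + O(1 /
g²)` and `-log F = g + log g' + O(1 / g)` (`exists_abs_deriv_mul_tailF_le`,
`exists_abs_log_tailF_le`). As `F(ũ) = (q / 4) (t + 1) e^{-t}`, the second expansion determines
`g(ũ)` up to `O(log t / t)` (`logOf_modelUt_sub_base_isBigO`).

*The condition on the remainders.* The model nonlinearity has `F[φ](v) = F[f](ũ)` exactly, so `R₁`
is essentially `t` times the difference of `f' F` at `ũ` and its model value. Hence the condition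
forces `H(ũ) = 1 / q + o(t^{-1/2})` (`CondF3.growthH_modelUt`), and the term `log (q H(g⁻¹(t)))` by
which the two expansions differ is `o(t^{-1/2})`. So the given solution has the expansion with the
remainder `o(t^{-1/2})`.

*Improvement of the remainder.* Put `Ψ = g + log g + log g' - log H - log 4` and `η = Ψ(u) - t`.
Then `η'' = (P / g) ((1 + η')² - e^{η - γ})` with `P → 1 / q` and `γ = O(1 / t)`
(`IsLogSolution.hasDerivAt_deviation'`). This equation is repelling: its energy `(g / P) (η')² / 2 +
e^N - 1 - N`, with `N = η - γ`, does not decrease but for an `O(t⁻²)` forcing, so it can vanish at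
infinity only if `η = O(1 / t)`. That it does vanish follows from `η = o(t^{-1/2})` and from `η'' ≥
-C / t`, by a one-sided Landau inequality (`landau_one_sided`, `energy_decay`). Because `η` agrees
with the remainder of the expansion up to `O(log t / t)`, the remainder is `o(t^{-1 + ε})` for every
`ε > 0`.

*Uniqueness.* Two solutions with this expansion both have `η = O(1 / t)`, so their difference `w`
solves `A w'' + (1 + O(1 / t)) w = 0`, where `1 / A = e^{-t} f'(u) / 4` and `A` is increasing and
comparable to `t`. Up to an integrable rate the energy `A (w')² + w²` does not decrease, and it
tends to zero, so `w = 0` near infinity (`eq_zero_of_energy`, `IsLogSolution.eventuallyEq`).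
Uniqueness for the initial value problem carries the equality to the common interval of existence.
-/

noncomputable section

namespace SingularSolution

/-! ### Monotonicity and comparison on half-lines -/

lemma monotoneOn_Ici_of_hasDerivAt {a : ℝ} {φ φ' : ℝ → ℝ}
    (h : ∀ s ≥ a, HasDerivAt φ (φ' s) s) (h0 : ∀ s ≥ a, 0 ≤ φ' s) : MonotoneOn φ (Ici a) := by
  refine monotoneOn_of_hasDerivWithinAt_nonneg (f' := φ') (convex_Ici a)
    (fun s hs => (h s hs).continuousAt.continuousWithinAt) (fun s hs => ?_) (fun s hs => ?_)
  · rw [interior_Ici] at hs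
    exact (h s (le_of_lt hs)).hasDerivWithinAt
  · rw [interior_Ici] at hs
    exact h0 s (le_of_lt hs)

lemma le_of_monotoneOn_of_tendsto {a l : ℝ} {φ : ℝ → ℝ} (h : MonotoneOn φ (Ici a))
    (hl : Tendsto φ atTop (𝓝 l)) {s : ℝ} (hs : a ≤ s) : φ s ≤ l :=
  ge_of_tendsto hl ((eventually_ge_atTop s).mono fun _ hx => h hs (hs.trans hx) hx)

/-- If `|Φ'| ≤ Θ'` on a half-line, then the increments of `Φ` are bounded by those of `Θ`. -/
lemma abs_sub_le_of_abs_deriv_le {a : ℝ} {Φ Θ Φ' Θ' : ℝ → ℝ}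
    (hΦ : ∀ s ≥ a, HasDerivAt Φ (Φ' s) s) (hΘ : ∀ s ≥ a, HasDerivAt Θ (Θ' s) s)
    (h : ∀ s ≥ a, |Φ' s| ≤ Θ' s) {s₁ s₂ : ℝ} (h₁ : a ≤ s₁) (h₂ : a ≤ s₂) :
    |Φ s₁ - Φ s₂| ≤ |Θ s₁ - Θ s₂| := by
  have m1 : MonotoneOn (fun s => Θ s - Φ s) (Ici a) :=
    monotoneOn_Ici_of_hasDerivAt (fun s hs => (hΘ s hs).sub (hΦ s hs)) fun s hs => by
      have := (abs_le.1 (h s hs)).2; linarith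
  have m2 : MonotoneOn (fun s => Θ s + Φ s) (Ici a) :=
    monotoneOn_Ici_of_hasDerivAt (fun s hs => (hΘ s hs).add (hΦ s hs)) fun s hs => by
      have := (abs_le.1 (h s hs)).1; linarith
  rcases le_total s₁ s₂ with h12 | h12
  · have e1 := m1 h₁ h₂ h12
    have e2 := m2 h₁ h₂ h12
    simp only at e1 e2
    rw [abs_sub_comm (Θ s₁)]
    refine le_trans (abs_le.2 ⟨?_, ?_⟩) (le_abs_self _) <;> linarith
  · have e1 := m1 h₂ h₁ h12
    have e2 := m2 h₂ h₁ h12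
    simp only at e1 e2
    refine le_trans (abs_le.2 ⟨?_, ?_⟩) (le_abs_self _) <;> linarith

/-- A function whose derivative is eventually bounded below by a positive constant tends to
infinity. -/
lemma tendsto_atTop_of_deriv_ge {φ φ' : ℝ → ℝ} {c : ℝ} (hc : 0 < c)
    (h : ∀ᶠ s in atTop, HasDerivAt φ (φ' s) s) (h0 : ∀ᶠ s in atTop, c ≤ φ' s) :
    Tendsto φ atTop atTop := by
  obtain ⟨a, ha⟩ := eventually_atTop.1 (h.and h0)
  have m : MonotoneOn (fun s => φ s - c * s) (Ici a) := by
    refine monotoneOn_Ici_of_hasDerivAt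
      (fun s hs => (ha s hs).1.sub ((hasDerivAt_id s).const_mul c)) fun s hs => ?_
    have := (ha s hs).2
    simp only [mul_one]; linarith
  refine tendsto_atTop_mono' _ ?_
    (tendsto_atTop_add_const_right _ (φ a - c * a) (tendsto_id.const_mul_atTop hc))
  filter_upwards [eventually_ge_atTop a] with s hs
  have := m (mem_Ici.2 le_rfl) hs hs
  simp only [id] at this ⊢; linarith

/-! ### Symbols relative to a growth function -/

/-- The logarithmic derivation `D Φ = (g / g') Φ'`, that is, `y d/dy` in the variable `y = g`. -/
def scaledDeriv (g Φ : ℝ → ℝ) (s : ℝ) : ℝ := g s / deriv g s * deriv Φ s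

/-- Symbols of order zero: near infinity `Φ` is differentiable, `Φ = O(1)` and
`Φ' = O(g' / g)`. -/
def IsSymbol (g Φ : ℝ → ℝ) : Prop :=
  ∃ K L, ∀ᶠ s in atTop,
    DifferentiableAt ℝ Φ s ∧ |Φ s| ≤ K ∧ |deriv Φ s| ≤ L * (deriv g s / g s)

namespace IsSymbol

variable {g Φ Θ : ℝ → ℝ}

lemma congr (h : IsSymbol g Φ) (e : Φ =ᶠ[atTop] Θ) : IsSymbol g Θ := by
  obtain ⟨K, L, h⟩ := h
  refine ⟨K, L, ?_⟩
  obtain ⟨a, ha⟩ := eventually_atTop.1 e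
  filter_upwards [h, eventually_gt_atTop a] with s hs hsa
  have e' : Φ =ᶠ[𝓝 s] Θ := by
    filter_upwards [Ioi_mem_nhds hsa] with x hx using ha x (le_of_lt hx)
  exact ⟨hs.1.congr_of_eventuallyEq e'.symm, e'.eq_of_nhds ▸ hs.2.1, e'.deriv_eq ▸ hs.2.2⟩

lemma const (c : ℝ) : IsSymbol g fun _ => c :=
  ⟨|c|, 0, Eventually.of_forall fun s => ⟨differentiableAt_const c, le_rfl, by simp⟩⟩

lemma add (hΦ : IsSymbol g Φ) (hΘ : IsSymbol g Θ) : IsSymbol g fun s => Φ s + Θ s := by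
  obtain ⟨K, L, h⟩ := hΦ
  obtain ⟨K', L', h'⟩ := hΘ
  refine ⟨K + K', L + L', ?_⟩
  filter_upwards [h, h'] with s ⟨d, b, e⟩ ⟨d', b', e'⟩
  refine ⟨d.add d', (abs_add_le _ _).trans (add_le_add b b'), ?_⟩
  rw [deriv_fun_add d d', add_mul]
  exact (abs_add_le _ _).trans (add_le_add e e')

lemma mul (hΦ : IsSymbol g Φ) (hΘ : IsSymbol g Θ) : IsSymbol g fun s => Φ s * Θ s := by
  obtain ⟨K, L, h⟩ := hΦ
  obtain ⟨K', L', h'⟩ := hΘ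
  refine ⟨K * K', L * K' + K * L', ?_⟩
  filter_upwards [h, h'] with s ⟨d, b, e⟩ ⟨d', b', e'⟩
  have hK := (abs_nonneg _).trans b
  have hL := (abs_nonneg _).trans e
  refine ⟨d.mul d', ?_, ?_⟩
  · rw [abs_mul]; exact mul_le_mul b b' (abs_nonneg _) hK
  · rw [deriv_fun_mul d d']
    calc |deriv Φ s * Θ s + Φ s * deriv Θ s|
        ≤ |deriv Φ s| * |Θ s| + |Φ s| * |deriv Θ s| := by
          rw [← abs_mul, ← abs_mul]; exact abs_add_le _ _
      _ ≤ L * (deriv g s / g s) * K' + K * (L' * (deriv g s / g s)) :=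
          add_le_add (mul_le_mul e b' (abs_nonneg _) hL) (mul_le_mul b e' (abs_nonneg _) hK)
      _ = _ := by ring

lemma neg (hΦ : IsSymbol g Φ) : IsSymbol g fun s => -Φ s :=
  ((const (-1)).mul hΦ).congr (Eventually.of_forall fun s => by simp)

lemma sub (hΦ : IsSymbol g Φ) (hΘ : IsSymbol g Θ) : IsSymbol g fun s => Φ s - Θ s :=
  (hΦ.add hΘ.neg).congr (Eventually.of_forall fun s => by simp [sub_eq_add_neg])

lemma inv (hΦ : IsSymbol g Φ) {c : ℝ} (hc : 0 < c) (h : ∀ᶠ s in atTop, c ≤ Φ s) :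
    IsSymbol g fun s => (Φ s)⁻¹ := by
  obtain ⟨K, L, hΦ⟩ := hΦ
  refine ⟨c⁻¹, L / c ^ 2, ?_⟩
  filter_upwards [hΦ, h] with s ⟨d, b, e⟩ hs
  have hp : 0 < Φ s := hc.trans_le hs
  refine ⟨d.inv hp.ne', ?_, ?_⟩
  · rw [abs_of_pos (inv_pos.2 hp)]; exact inv_anti₀ hc hs
  · rw [deriv_fun_inv'' d hp.ne', abs_div, abs_neg, abs_of_pos (pow_pos hp 2), div_mul_eq_mul_div]
    exact div_le_div₀ ((abs_nonneg _).trans e) e (by positivity) (by gcongr)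

lemma div (hΦ : IsSymbol g Φ) (hΘ : IsSymbol g Θ) {c : ℝ} (hc : 0 < c)
    (h : ∀ᶠ s in atTop, c ≤ Θ s) : IsSymbol g fun s => Φ s / Θ s :=
  (hΦ.mul (hΘ.inv hc h)).congr (Eventually.of_forall fun s => by simp [div_eq_mul_inv])

end IsSymbol

/-! ### Regular growth -/

/-- The consequences of the growth hypotheses on `g = log f` on which the argument rests: `g'` is
bounded below, `g'' = H (g')² / g`, `H → 1 / q` with `q ≥ 1`, the functions `H`, `D H`, `D² H` are
symbols, and `D H → 0`. -/
structure RegularGrowth (g : ℝ → ℝ) (q : ℝ) : Prop where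
  one_le : 1 ≤ q
  differentiable : ∀ᶠ s in atTop, DifferentiableAt ℝ g s
  deriv_ge : ∃ c > 0, ∀ᶠ s in atTop, c ≤ deriv g s
  second : ∀ᶠ s in atTop,
    HasDerivAt (deriv g) (growthH g s * deriv g s ^ 2 / g s) s
  tendsto_growthH : Tendsto (growthH g) atTop (𝓝 (1 / q))
  symbol_zero : IsSymbol g (growthH g)
  symbol_one : IsSymbol g (scaledDeriv g (growthH g))
  symbol_two : IsSymbol g (scaledDeriv g (scaledDeriv g (growthH g)))
  tendsto_scaledDeriv : Tendsto (scaledDeriv g (growthH g)) atTop (𝓝 0)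

namespace RegularGrowth

variable {g : ℝ → ℝ} {q : ℝ}

lemma q_pos (R : RegularGrowth g q) : 0 < q := zero_lt_one.trans_le R.one_le

lemma tendsto (R : RegularGrowth g q) : Tendsto g atTop atTop := by
  obtain ⟨c, hc, h⟩ := R.deriv_ge
  exact tendsto_atTop_of_deriv_ge hc (R.differentiable.mono fun s hs => hs.hasDerivAt) h

lemma deriv_pos (R : RegularGrowth g q) : ∀ᶠ s in atTop, 0 < deriv g s := by
  obtain ⟨c, hc, h⟩ := R.deriv_ge
  exact h.mono fun s hs => hc.trans_le hs

lemma growthH_pos (R : RegularGrowth g q) : ∃ c > 0, ∀ᶠ s in atTop, c ≤ growthH g s := by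
  have := R.q_pos
  exact ⟨1 / q / 2, by positivity,
    (R.tendsto_growthH.eventually (lt_mem_nhds (half_lt_self (by positivity)))).mono
      fun s hs => hs.le⟩

lemma symbol_inv (R : RegularGrowth g q) : IsSymbol g fun s => 1 / g s := by
  refine ⟨1, 1, ?_⟩
  filter_upwards [R.differentiable, R.tendsto.eventually_ge_atTop 1, R.deriv_pos] with s hd h1 hp
  have h0 : 0 < g s := by linarith
  refine ⟨(differentiableAt_const _).div hd h0.ne', ?_, ?_⟩
  · rw [abs_of_pos (by positivity)]; exact div_le_one_of_le₀ h1 h0.le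
  · have : HasDerivAt (fun s => 1 / g s) (-(deriv g s) / g s ^ 2) s := by
      simpa only [one_div] using hd.hasDerivAt.fun_inv h0.ne'
    rw [this.deriv, abs_div, abs_neg, abs_of_pos hp, abs_of_pos (by positivity), one_mul]
    gcongr
    nlinarith

end RegularGrowth

lemma eventually_contDiffOn_growthH {g : ℝ → ℝ} {a : ℝ} (hg : ContDiffOn ℝ 5 g (Ioi a))
    (h : ∀ s > a, deriv g s ≠ 0) : ContDiffOn ℝ 3 (growthH g) (Ioi a) := by
  have h1 : ContDiffOn ℝ 4 (deriv g) (Ioi a) := hg.deriv_of_isOpen isOpen_Ioi (by norm_num)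
  have h2 : ContDiffOn ℝ 3 (deriv (deriv g)) (Ioi a) :=
    h1.deriv_of_isOpen isOpen_Ioi (by norm_num)
  exact ((hg.of_le (by norm_num)).mul h2).div ((h1.of_le (by norm_num)).pow 2)
    fun s hs => pow_ne_zero 2 (h s hs)

/-- A positive function whose derivative increases, with integrable reciprocal at infinity, cannot
be decreasing; so its derivative is bounded below by a positive constant. -/
lemma exists_deriv_ge_of_integrable {g : ℝ → ℝ} {a : ℝ} (hpos : ∀ s > a, 0 < g s)
    (hd : ∀ s > a, DifferentiableAt ℝ g s) (hm : MonotoneOn (deriv g) (Ioi a))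
    (hint : ∀ᶠ s in atTop, IntegrableOn (fun u => 1 / g u) (Ioi s)) :
    ∃ c > 0, ∀ᶠ s in atTop, c ≤ deriv g s := by
  by_cases hneg : ∃ s > a, 0 < deriv g s
  · obtain ⟨s, hs, hc⟩ := hneg
    refine ⟨deriv g s, hc, ?_⟩
    filter_upwards [eventually_ge_atTop s] with x hx using hm hs (hs.trans_le hx) hx
  · push Not at hneg
    exfalso
    obtain ⟨b, hb, hba⟩ := (hint.and (eventually_gt_atTop a)).exists
    have hanti : MonotoneOn (fun s => -g s) (Ici b) :=
      monotoneOn_Ici_of_hasDerivAt (fun s hs => (hd s (hba.trans_le hs)).hasDerivAt.neg)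
        fun s hs => by have := hneg s (hba.trans_le hs); linarith
    have hb0 := hpos b hba
    have : IntegrableOn (fun _ : ℝ => 1 / g b) (Ioi b) := by
      refine Integrable.mono' hb aestronglyMeasurable_const ?_
      refine (ae_restrict_mem measurableSet_Ioi).mono fun x hx => ?_
      have hx' : b < x := hx
      have h1 := hanti (mem_Ici.2 le_rfl) (le_of_lt hx') (le_of_lt hx')
      have h2 := hpos x (hba.trans hx')
      simp only at h1
      rw [Real.norm_of_nonneg (by positivity)]
      exact one_div_le_one_div_of_le h2 (by linarith)
    rw [integrableOn_const_iff] at this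
    simp [hb0.ne'] at this

/-- The growth hypotheses imply `RegularGrowth`. Here `q ≥ 1` because `(g / g')' = 1 - H` tends to
`1 - 1 / q`, while `g / g'` stays positive. -/
theorem regularGrowth {g : ℝ → ℝ} {q : ℝ} (hG1 : CondG1 g q) (hG2 : CondG2 g)
    (hadd : CondAdd g) : RegularGrowth g q := by
  obtain ⟨hq, hpos, hint, hlim⟩ := hG1
  obtain ⟨C, hC, s₀, hs₀, hcd, hbd⟩ := hG2
  have hHpos : ∀ᶠ s in atTop, 0 < growthH g s :=
    hlim.eventually (lt_mem_nhds (by positivity))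
  obtain ⟨a, ha⟩ := eventually_atTop.1 (hpos.and (hHpos.and (eventually_gt_atTop s₀)))
  have hcd' : ContDiffOn ℝ 5 g (Ioi a) :=
    hcd.mono fun s hs => (ha s (le_of_lt hs)).2.2
  have hg'0 : ∀ s > a, deriv g s ≠ 0 := fun s hs h => by
    have := (ha s hs.le).2.1
    simp [growthH, h] at this
  have hd : ∀ s > a, DifferentiableAt ℝ g s := fun s hs =>
    (hcd'.contDiffAt (Ioi_mem_nhds hs)).differentiableAt (by norm_num)
  have h1 : ContDiffOn ℝ 4 (deriv g) (Ioi a) := hcd'.deriv_of_isOpen isOpen_Ioi (by norm_num)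
  have hd1 : ∀ s > a, DifferentiableAt ℝ (deriv g) s := fun s hs =>
    (h1.contDiffAt (Ioi_mem_nhds hs)).differentiableAt (by norm_num)
  have hsec : ∀ s > a, deriv (deriv g) s = growthH g s * deriv g s ^ 2 / g s := fun s hs => by
    have := hg'0 s hs
    have := (ha s hs.le).1.ne'
    simp only [growthH]; field_simp
  have hmono : MonotoneOn (deriv g) (Ioi a) := by
    refine monotoneOn_of_deriv_nonneg (convex_Ioi a) h1.continuousOn
      (fun s hs => ?_) (fun s hs => ?_) <;> rw [interior_Ioi] at hs
    · exact (hd1 s hs).differentiableWithinAt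
    · rw [hsec s hs]
      have h3 := (ha s (le_of_lt hs)).1
      have h4 := (ha s (le_of_lt hs)).2.1
      positivity
  obtain ⟨c, hc, hge⟩ := exists_deriv_ge_of_integrable (fun s hs => (ha s hs.le).1) hd hmono hint
  have hCH := eventually_contDiffOn_growthH hcd' hg'0
  have hCH1 := hCH.deriv_of_isOpen (m := 2) isOpen_Ioi (by norm_num)
  have hCH2 := hCH1.deriv_of_isOpen (m := 1) isOpen_Ioi (by norm_num)
  have it2 : ∀ s, iteratedDeriv 2 (growthH g) s = deriv (deriv (growthH g)) s := fun s => by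
    rw [iteratedDeriv_succ, iteratedDeriv_one]
  have it3 : ∀ s, iteratedDeriv 3 (growthH g) s = deriv (deriv (deriv (growthH g))) s := fun s => by
    rw [iteratedDeriv_succ]; congr 1; funext x; exact it2 x
  have hb1 := hbd 1 (by simp)
  have hb2 := hbd 2 (by simp)
  have hb3 := hbd 3 (by simp)
  simp only [iteratedDeriv_one, it2, it3, pow_one] at hb1 hb2 hb3
  have hquot : ∀ᶠ s in atTop,
      HasDerivAt (fun s => g s / deriv g s) (1 - growthH g s) s := by
    filter_upwards [eventually_gt_atTop a] with s hs
    have h0 := hg'0 s hs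
    refine ((hd s hs).hasDerivAt.div (hd1 s hs).hasDerivAt h0).congr_deriv ?_
    simp only [growthH]; field_simp
  have hH0 : IsSymbol g (growthH g) := by
    refine ⟨|1 / q| + 1, C, ?_⟩
    filter_upwards [eventually_gt_atTop a, hlim.abs.eventually (gt_mem_nhds (lt_add_one _))]
      with s hs h2
    exact ⟨(hCH.contDiffAt (Ioi_mem_nhds hs)).differentiableAt (by norm_num), h2.le,
      (hb1 s (ha s hs.le).2.2).le⟩
  have hgpos : ∀ᶠ s in atTop, 0 < deriv g s := hge.mono fun s hs => hc.trans_le hs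
  -- `|(g / g')ᵏ H⁽ᵏ⁾| ≤ C`
  have hcancel : ∀ k : ℕ, ∀ᶠ s in atTop, ∀ y : ℝ, |y| < C * (deriv g s / g s) ^ k →
      |(g s / deriv g s) ^ k * y| ≤ C := fun k => by
    filter_upwards [hpos, hgpos] with s h1 h2 y hy
    rw [abs_mul, abs_of_pos (by positivity)]
    calc (g s / deriv g s) ^ k * |y| ≤ (g s / deriv g s) ^ k * (C * (deriv g s / g s) ^ k) := by
          gcongr
      _ = C * ((g s / deriv g s) * (deriv g s / g s)) ^ k := by rw [mul_pow]; ring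
      _ = C := by
          rw [show g s / deriv g s * (deriv g s / g s) = 1 by field_simp]; simp
  -- `Q = (g / g')² H''` is a symbol, and `D² H = (1 - H) D H + Q`.
  have hQ : IsSymbol g fun s => (g s / deriv g s) ^ 2 * deriv (deriv (growthH g)) s := by
    obtain ⟨K, L, hK⟩ := hH0
    refine ⟨C, 2 * (1 + K) * C + C, ?_⟩
    filter_upwards [eventually_gt_atTop a, hquot, hcancel 2, hcancel 3, hgpos, hpos, hK]
      with s hs h1 h2 h3 hg' hg0 ⟨_, hHK, _⟩
    have e := (h1.pow 2).mul
      ((hCH2.contDiffAt (Ioi_mem_nhds hs)).differentiableAt (by norm_num)).hasDerivAt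
    have e2 := h2 _ (hb2 s (ha s hs.le).2.2)
    have e3 := h3 _ (hb3 s (ha s hs.le).2.2)
    refine ⟨e.differentiableAt, e2, ?_⟩
    have hd : deriv (fun s => (g s / deriv g s) ^ 2 * deriv (deriv (growthH g)) s) s =
        (2 * (1 - growthH g s) * ((g s / deriv g s) ^ 2 * deriv (deriv (growthH g)) s) +
          (g s / deriv g s) ^ 3 * deriv (deriv (deriv (growthH g))) s) * (deriv g s / g s) := by
      refine e.deriv.trans ?_
      simp; field_simp
    have h1K : |1 - growthH g s| ≤ 1 + K :=
      abs_le.2 ⟨by linarith [(abs_le.1 hHK).2], by linarith [(abs_le.1 hHK).1]⟩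
    rw [hd, abs_mul, abs_of_pos (div_pos hg' hg0)]
    gcongr
    refine (abs_add_le _ _).trans (add_le_add ?_ e3)
    rw [abs_mul, abs_mul, abs_two]
    have h0K := (abs_nonneg _).trans h1K
    gcongr
  have hH1 : IsSymbol g (scaledDeriv g (growthH g)) := by
    obtain ⟨K, L, hK⟩ := hH0
    refine ⟨C, (1 + K) * C + C, ?_⟩
    filter_upwards [eventually_gt_atTop a, hquot, hcancel 1, hcancel 2, hgpos, hpos, hK]
      with s hs h1 h2 h3 hg' hg0 ⟨_, hHK, _⟩
    have e := h1.mul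
      ((hCH1.contDiffAt (Ioi_mem_nhds hs)).differentiableAt (by norm_num)).hasDerivAt
    have e2 := h2 _ (by simpa using hb1 s (ha s hs.le).2.2)
    have e3 := h3 _ (hb2 s (ha s hs.le).2.2)
    rw [pow_one] at e2
    refine ⟨e.differentiableAt, e2, ?_⟩
    have hd : deriv (scaledDeriv g (growthH g)) s =
        ((1 - growthH g s) * (g s / deriv g s * deriv (growthH g) s) +
          (g s / deriv g s) ^ 2 * deriv (deriv (growthH g)) s) * (deriv g s / g s) := by
      refine e.deriv.trans ?_
      field_simp
    have h1K : |1 - growthH g s| ≤ 1 + K :=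
      abs_le.2 ⟨by linarith [(abs_le.1 hHK).2], by linarith [(abs_le.1 hHK).1]⟩
    rw [hd, abs_mul, abs_of_pos (div_pos hg' hg0)]
    gcongr
    refine (abs_add_le _ _).trans (add_le_add ?_ e3)
    rw [abs_mul]
    have h0K := (abs_nonneg _).trans h1K
    gcongr
  have hH2 : IsSymbol g (scaledDeriv g (scaledDeriv g (growthH g))) := by
    refine ((((IsSymbol.const 1).sub hH0).mul hH1).add hQ).congr ?_
    filter_upwards [eventually_gt_atTop a, hquot, hgpos, hpos] with s hs h1 hg' hg0
    have e := h1.mul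
      ((hCH1.contDiffAt (Ioi_mem_nhds hs)).differentiableAt (by norm_num)).hasDerivAt
    have e' : deriv (scaledDeriv g (growthH g)) s = _ := e.deriv
    simp only [scaledDeriv] at e' ⊢
    rw [e']; field_simp
  refine ⟨?_, (eventually_gt_atTop a).mono hd, ⟨c, hc, hge⟩, ?_, hlim, hH0, hH1, hH2, ?_⟩
  · by_contra hq1
    push Not at hq1
    have hneg : 1 - 1 / q < 0 := by
      have : 1 < 1 / q := by rwa [lt_div_iff₀ hq, one_mul]
      linarith
    have := tendsto_atTop_of_deriv_ge (φ := fun s => -(g s / deriv g s))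
      (φ' := fun s => -(1 - growthH g s)) (c := -((1 - 1 / q) / 2)) (by linarith)
      (hquot.mono fun s hs => hs.neg) ?_
    · obtain ⟨s, h1, h2, h3⟩ := ((this.eventually_gt_atTop 0).and (hpos.and hgpos)).exists
      have : 0 < g s / deriv g s := by positivity
      linarith
    · have hl : Tendsto (fun s => -(1 - growthH g s)) atTop (𝓝 (-(1 - 1 / q))) :=
        (hlim.const_sub 1).neg
      filter_upwards [hl.eventually (lt_mem_nhds (show -((1 - 1 / q) / 2) < _ by linarith))]
        with s hs using hs.le
  · filter_upwards [eventually_gt_atTop a] with s hs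
    rw [← hsec s hs]
    exact (hd1 s hs).hasDerivAt
  · have h := hadd 1 (by simp)
    simp only [iteratedDeriv_one, pow_one] at h
    refine squeeze_zero_norm' ?_ h
    filter_upwards [hgpos, hpos] with s h1 h2
    simp only [scaledDeriv, Real.norm_eq_abs]
    rw [abs_mul, abs_of_pos (div_pos h2 h1), div_mul_eq_mul_div]

/-! ### The tail integral -/

section Tail

variable {f : ℝ → ℝ} {q : ℝ}

lemma exp_logOf (hf : PositiveC1 f) {s : ℝ} (hs : 0 ≤ s) : Real.exp (logOf f s) = f s :=
  Real.exp_log (hf.2 s hs)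

lemma continuousOn_one_div (hf : PositiveC1 f) : ContinuousOn (fun s => 1 / f s) (Ici 0) :=
  continuousOn_const.div hf.1.continuousOn fun s hs => (hf.2 s hs).ne'

lemma continuousOn_logOf (hf : PositiveC1 f) : ContinuousOn (logOf f) (Ici 0) :=
  hf.1.continuousOn.log fun s hs => (hf.2 s hs).ne'

lemma tendsto_exp_neg_logOf (R : RegularGrowth (logOf f) q) :
    Tendsto (fun s => Real.exp (-logOf f s)) atTop (𝓝 0) :=
  Real.tendsto_exp_atBot.comp (tendsto_neg_atTop_atBot.comp R.tendsto)

lemma integrableOn_one_div (hf : PositiveC1 f) (R : RegularGrowth (logOf f) q) :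
    IntegrableOn (fun s => 1 / f s) (Ioi 0) := by
  obtain ⟨c, hc, hge⟩ := R.deriv_ge
  obtain ⟨a, ha⟩ := eventually_atTop.1 (R.differentiable.and (hge.and (eventually_ge_atTop 0)))
  have ha0 : 0 ≤ a := (ha a le_rfl).2.2
  have h1 : IntegrableOn (fun s => Real.exp (-logOf f s) * deriv (logOf f) s) (Ioi a) := by
    refine integrableOn_Ioi_deriv_of_nonneg' (g := fun s => -Real.exp (-logOf f s)) (l := 0)
      (fun s hs => ?_) (fun s hs => ?_) (by simpa using (tendsto_exp_neg_logOf R).neg)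
    · exact ((ha s hs).1.hasDerivAt.fun_neg.exp.neg).congr_deriv (by ring)
    · exact mul_nonneg (Real.exp_pos _).le (hc.le.trans (ha s (le_of_lt hs)).2.1)
  have h2 : IntegrableOn (fun s => 1 / f s) (Ioi a) := by
    refine Integrable.mono' (h1.const_mul c⁻¹) ?_ ?_
    · exact ((continuousOn_one_div hf).mono fun s hs =>
        ha0.trans (le_of_lt hs)).aestronglyMeasurable measurableSet_Ioi
    · refine (ae_restrict_mem measurableSet_Ioi).mono fun s hs => ?_
      have hs' := ha s (le_of_lt hs)
      have hfs := hf.2 s hs'.2.2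
      rw [Real.norm_of_nonneg (by positivity), Real.exp_neg, exp_logOf hf hs'.2.2]
      field_simp
      exact hs'.2.1
  rw [← Ioc_union_Ioi_eq_Ioi ha0]
  refine IntegrableOn.union ?_ h2
  exact (((continuousOn_one_div hf).mono Icc_subset_Ici_self).integrableOn_Icc).mono_set
    Ioc_subset_Icc_self

lemma tailF_sub (hf : PositiveC1 f) (R : RegularGrowth (logOf f) q) {a b : ℝ} (ha : 0 ≤ a)
    (hab : a ≤ b) : tailF f a - tailF f b = ∫ t in a..b, 1 / f t :=
  intervalIntegral.integral_Ioi_sub_Ioi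
    ((integrableOn_one_div hf R).mono_set (Ioi_subset_Ioi ha)) hab

lemma tailF_strictAntiOn (hf : PositiveC1 f) (R : RegularGrowth (logOf f) q) :
    StrictAntiOn (tailF f) (Ici 0) := fun a ha b _ hab => by
  rw [← sub_pos, tailF_sub hf R ha hab.le]
  refine intervalIntegral.intervalIntegral_pos_of_pos_on ?_ (fun x hx => ?_) hab
  · refine ContinuousOn.intervalIntegrable_of_Icc hab.le ((continuousOn_one_div hf).mono ?_)
    exact fun x hx => le_trans ha hx.1
  · exact one_div_pos.2 (hf.2 x (le_trans ha hx.1.le))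

lemma tailF_pos (hf : PositiveC1 f) (R : RegularGrowth (logOf f) q) {s : ℝ} (hs : 0 ≤ s) :
    0 < tailF f s := by
  refine lt_of_le_of_lt ?_ (tailF_strictAntiOn hf R hs (mem_Ici.2 (by linarith)) (lt_add_one s))
  exact setIntegral_nonneg measurableSet_Ioi fun x hx =>
    one_div_nonneg.2 (hf.2 x (by have : s + 1 < x := hx; linarith)).le

lemma hasDerivAt_tailF (hf : PositiveC1 f) (R : RegularGrowth (logOf f) q) {s : ℝ} (hs : 0 < s) :
    HasDerivAt (tailF f) (-(1 / f s)) s := by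
  have hc := (continuousOn_one_div hf)
  have h1 : HasDerivAt (fun x => ∫ t in (0 : ℝ)..x, 1 / f t) (1 / f s) s := by
    refine intervalIntegral.integral_hasDerivAt_right ?_ ?_ ?_
    · exact ContinuousOn.intervalIntegrable_of_Icc hs.le (hc.mono Icc_subset_Ici_self)
    · exact (hc.mono Ioi_subset_Ici_self).stronglyMeasurableAtFilter isOpen_Ioi s hs
    · exact hc.continuousAt (Ici_mem_nhds hs)
  refine ((hasDerivAt_const s (tailF f 0)).sub h1).congr_of_eventuallyEq ?_ |>.congr_deriv
    (by ring)
  filter_upwards [Ioi_mem_nhds hs] with x hx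
  have := tailF_sub hf R le_rfl (le_of_lt hx)
  simp only [Pi.sub_apply]; linarith

lemma tendsto_tailF (hf : PositiveC1 f) (R : RegularGrowth (logOf f) q) :
    Tendsto (tailF f) atTop (𝓝 0) := by
  have h := intervalIntegral_tendsto_integral_Ioi 0 (integrableOn_one_div hf R) tendsto_id
  have h2 := h.const_sub (tailF f 0)
  rw [show tailF f 0 - ∫ x in Ioi (0 : ℝ), 1 / f x = 0 by simp [tailF]] at h2
  refine h2.congr' ?_
  filter_upwards [eventually_ge_atTop 0] with x hx
  have := tailF_sub hf R le_rfl hx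
  simp only [id]; linarith

/-- If `J' = -(1 + ρ) / f` with `|ρ| ≤ C / g²` and `J` vanishes at infinity, then
`|J - F| ≤ C F / g²`, because `g` increases. -/
lemma abs_sub_tailF_le (hf : PositiveC1 f) (R : RegularGrowth (logOf f) q) {J ρ : ℝ → ℝ} {C : ℝ}
    (hJ : ∀ᶠ s in atTop, HasDerivAt J (-(1 + ρ s) * (1 / f s)) s)
    (hρ : ∀ᶠ s in atTop, |ρ s| ≤ C / logOf f s ^ 2) (h0 : Tendsto J atTop (𝓝 0)) :
    ∀ᶠ s in atTop, |J s - tailF f s| ≤ C / logOf f s ^ 2 * tailF f s := by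
  obtain ⟨a, ha⟩ := eventually_atTop.1 (hJ.and (hρ.and ((eventually_gt_atTop 0).and
    (R.differentiable.and (R.deriv_pos.and (R.tendsto.eventually_gt_atTop 0))))))
  have hmono : MonotoneOn (logOf f) (Ici a) :=
    monotoneOn_Ici_of_hasDerivAt (fun s hs => (ha s hs).2.2.2.1.hasDerivAt)
      fun s hs => (ha s hs).2.2.2.2.1.le
  filter_upwards [eventually_ge_atTop a] with s hs
  set B := C / logOf f s ^ 2 with hB
  have hgs := (ha s hs).2.2.2.2.2
  have hC : 0 ≤ C := by
    have h1 := (abs_nonneg _).trans (ha s hs).2.1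
    by_contra hneg
    push Not at hneg
    have : C / logOf f s ^ 2 < 0 := div_neg_of_neg_of_pos hneg (by positivity)
    linarith
  have hbound : ∀ x ≥ s, |ρ x| ≤ B := fun x hx => by
    refine (ha x (hs.trans hx)).2.1.trans ?_
    have := hmono hs (hs.trans hx) hx
    rw [hB]; gcongr
  have hF := tendsto_tailF hf R
  have hd : ∀ x ≥ s, HasDerivAt (tailF f) (-(1 / f x)) x := fun x hx =>
    hasDerivAt_tailF hf R (ha x (hs.trans hx)).2.2.1
  have hfp : ∀ x ≥ s, 0 ≤ 1 / f x := fun x hx =>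
    one_div_nonneg.2 (hf.2 x (ha x (hs.trans hx)).2.2.1.le).le
  have m1 : MonotoneOn (fun x => (1 - B) * tailF f x - J x) (Ici s) :=
    monotoneOn_Ici_of_hasDerivAt
      (fun x hx => ((hd x hx).const_mul (1 - B)).sub (ha x (hs.trans hx)).1) fun x hx => by
        have h1 := abs_le.1 (hbound x hx)
        have h2 := mul_nonneg (show 0 ≤ B + ρ x by linarith) (hfp x hx)
        linarith
  have m2 : MonotoneOn (fun x => J x - (1 + B) * tailF f x) (Ici s) :=
    monotoneOn_Ici_of_hasDerivAt
      (fun x hx => (ha x (hs.trans hx)).1.sub ((hd x hx).const_mul (1 + B))) fun x hx => by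
        have h1 := abs_le.1 (hbound x hx)
        have h2 := mul_nonneg (show 0 ≤ B - ρ x by linarith) (hfp x hx)
        linarith
  have l1 := le_of_monotoneOn_of_tendsto m1 (by simpa using (hF.const_mul (1 - B)).sub h0) le_rfl
  have l2 := le_of_monotoneOn_of_tendsto m2 (by simpa using h0.sub (hF.const_mul (1 + B))) le_rfl
  exact abs_le.2 ⟨by linarith, by linarith⟩

lemma eventually_deriv_eq (hf : PositiveC1 f) (R : RegularGrowth (logOf f) q) :
    ∀ᶠ s in atTop, HasDerivAt f (f s * deriv (logOf f) s) s := by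
  obtain ⟨a, ha⟩ := eventually_atTop.1 (R.differentiable.and (eventually_gt_atTop 0))
  filter_upwards [eventually_gt_atTop a] with s hs
  have h := (ha s hs.le).1.hasDerivAt.exp
  rw [exp_logOf hf (ha s hs.le).2.le] at h
  refine h.congr_of_eventuallyEq ?_
  filter_upwards [Ioi_mem_nhds hs] with x hx using (exp_logOf hf (ha x (le_of_lt hx)).2.le).symm

/-- The expansion `f' F = 1 - H / g + O(1 / g²)`, with `f'` written as `f g'`. -/
theorem exists_abs_deriv_mul_tailF_le (hf : PositiveC1 f) (R : RegularGrowth (logOf f) q) :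
    ∃ C, 0 ≤ C ∧ ∀ᶠ s in atTop,
      |f s * deriv (logOf f) s * tailF f s - (1 - growthH (logOf f) s / logOf f s)|
        ≤ C / logOf f s ^ 2 := by
  set g := logOf f with hg
  obtain ⟨K, L, hK⟩ := R.symbol_zero
  obtain ⟨K₁, L₁, hK₁⟩ := R.symbol_one
  obtain ⟨c, hc, hge⟩ := R.deriv_ge
  -- The comparison function is `J = e^{-g} / g' * (1 - H / g)`, for which
  -- `J' = -(1 + (D H - H - H²) / g²) / f`: the terms of order `1 / g` cancel.
  set J : ℝ → ℝ := fun s => Real.exp (-g s) * (deriv g s)⁻¹ * (1 - growthH g s / g s) with hJdef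
  set ρ : ℝ → ℝ := fun s =>
    (scaledDeriv g (growthH g) s - growthH g s - growthH g s ^ 2) / g s ^ 2 with hρdef
  set C₀ := K₁ + K + K ^ 2 with hC₀
  have hJ : ∀ᶠ s in atTop, HasDerivAt J (-(1 + ρ s) * (1 / f s)) s := by
    filter_upwards [R.differentiable, R.second, hK, R.tendsto.eventually_gt_atTop 0, R.deriv_pos,
      eventually_ge_atTop 0] with s h1 h2 h3 h4 h5 h6
    refine ((h1.hasDerivAt.neg.exp.mul (h2.inv h5.ne')).mul
      ((h3.1.hasDerivAt.div h1.hasDerivAt h4.ne').const_sub 1)).congr_deriv ?_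
    rw [← exp_logOf hf h6, ← hg, one_div, ← Real.exp_neg]
    simp only [hρdef, scaledDeriv, Pi.mul_apply, Pi.neg_apply, Pi.inv_apply, Pi.div_apply]
    field_simp
    ring
  have hρ : ∀ᶠ s in atTop, |ρ s| ≤ C₀ / g s ^ 2 := by
    filter_upwards [hK, hK₁] with s h1 h2
    rw [hρdef, abs_div, abs_of_nonneg (sq_nonneg (g s))]
    gcongr
    have e1 := abs_le.1 h1.2.1
    have e2 := abs_le.1 h2.2.1
    have e3 : growthH g s ^ 2 ≤ K ^ 2 := sq_le_sq' e1.1 e1.2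
    have e4 := sq_nonneg (growthH g s)
    exact abs_le.2 ⟨by linarith, by linarith⟩
  have h0 : Tendsto J atTop (𝓝 0) := by
    have hb : Tendsto (fun s => 1 - growthH g s / g s) atTop (𝓝 1) := by
      simpa using (R.tendsto_growthH.div_atTop R.tendsto).const_sub 1
    have h1 : Tendsto (fun s => Real.exp (-g s) * (deriv g s)⁻¹) atTop (𝓝 0) := by
      refine squeeze_zero' (g := fun s => Real.exp (-g s) * c⁻¹) ?_ ?_
        (by simpa using (tendsto_exp_neg_logOf R).mul_const c⁻¹)
      · filter_upwards [R.deriv_pos] with s hs; positivity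
      · filter_upwards [hge] with s hs; gcongr
    simpa using h1.mul hb
  have hmain := abs_sub_tailF_le hf R hJ hρ h0
  have hC₀0 : 0 ≤ C₀ := by
    obtain ⟨s, h1, h2⟩ := (hK.and hK₁).exists
    have e1 := (abs_nonneg _).trans h1.2.1
    have e2 := (abs_nonneg _).trans h2.2.1
    positivity
  refine ⟨C₀ * (2 * (1 + K)), ?_, ?_⟩
  · obtain ⟨s, h1⟩ := hK.exists
    have e1 := (abs_nonneg _).trans h1.2.1
    positivity
  filter_upwards [hmain, hK, eventually_ge_atTop 0, R.deriv_pos, R.tendsto.eventually_ge_atTop 1,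
    R.tendsto.eventually_ge_atTop (2 * C₀)] with s h1 h2 h3 h4 h5 h6
  have hF := tailF_pos hf R h3
  have hfp := hf.2 s h3
  have hK0 := (abs_nonneg _).trans h2.2.1
  set X := f s * deriv g s * tailF f s with hX
  have hX0 : 0 < X := by positivity
  have hJs : f s * deriv g s * J s = 1 - growthH g s / g s := by
    have : Real.exp (-g s) = (f s)⁻¹ := by rw [Real.exp_neg, exp_logOf hf h3]
    simp only [hJdef, this]; field_simp
  have h7 : |X - (1 - growthH g s / g s)| ≤ C₀ / g s ^ 2 * X := by
    rw [← hJs, hX, ← mul_sub, abs_mul, abs_of_pos (by positivity : 0 < f s * deriv g s),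
      abs_sub_comm]
    calc _ ≤ f s * deriv g s * (C₀ / g s ^ 2 * tailF f s) := by gcongr
      _ = _ := by ring
  have hsmall : C₀ / g s ^ 2 ≤ 1 / 2 := by
    rw [div_le_div_iff₀ (by positivity) (by norm_num)]
    nlinarith
  have hHg : |growthH g s / g s| ≤ K := by
    rw [abs_div, abs_of_pos (by linarith : 0 < g s)]
    exact (div_le_self (abs_nonneg _) h5).trans h2.2.1
  have hX2 : X ≤ 2 * (1 + K) := by
    have e1 := (abs_le.1 h7).2
    have e2 := (abs_le.1 hHg).1
    have e3 : C₀ / g s ^ 2 * X ≤ 1 / 2 * X := by gcongr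
    linarith
  calc _ ≤ C₀ / g s ^ 2 * X := h7
    _ ≤ C₀ / g s ^ 2 * (2 * (1 + K)) := by gcongr
    _ = _ := by ring

lemma abs_log_le {x : ℝ} (hx : |x - 1| ≤ 1 / 2) : |Real.log x| ≤ 2 * |x - 1| := by
  have h1 := abs_le.1 hx
  have hx0 : 0 < x := by linarith
  have h2 := Real.log_le_sub_one_of_pos hx0
  have h3 := Real.one_sub_inv_le_log_of_pos hx0
  have h4 : 1 - x⁻¹ = (x - 1) / x := by field_simp
  have h5 : -(2 * |x - 1|) ≤ (x - 1) / x := by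
    rw [le_div_iff₀ hx0]
    rcases abs_cases (x - 1) with ⟨e, _⟩ | ⟨e, _⟩ <;> rw [e] <;> nlinarith
  refine abs_le.2 ⟨by linarith, ?_⟩
  have := le_abs_self (x - 1)
  have := abs_nonneg (x - 1)
  linarith

/-- `-log F = g + log g' + O(1 / g)`. -/
theorem exists_abs_log_tailF_le (hf : PositiveC1 f) (R : RegularGrowth (logOf f) q) :
    ∃ C, 0 ≤ C ∧ ∀ᶠ s in atTop,
      |Real.log (tailF f s) + logOf f s + Real.log (deriv (logOf f) s)| ≤ C / logOf f s := by
  obtain ⟨C, hC, h⟩ := exists_abs_deriv_mul_tailF_le hf R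
  obtain ⟨K, L, hK⟩ := R.symbol_zero
  refine ⟨2 * (C + K), ?_, ?_⟩
  · obtain ⟨s, h1⟩ := hK.exists
    have e1 := (abs_nonneg _).trans h1.2.1
    positivity
  filter_upwards [h, hK, eventually_ge_atTop 0, R.deriv_pos, R.tendsto.eventually_ge_atTop 1,
    R.tendsto.eventually_ge_atTop (2 * (C + K))] with s h1 h2 h3 h4 h5 h6
  have hF := tailF_pos hf R h3
  have hfp := hf.2 s h3
  set X := f s * deriv (logOf f) s * tailF f s with hX
  have hg0 : 0 < logOf f s := by linarith
  have hK0 := (abs_nonneg _).trans h2.2.1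
  have e1 : C / logOf f s ^ 2 ≤ C / logOf f s := by gcongr; nlinarith
  have e2 : |growthH (logOf f) s / logOf f s| ≤ K / logOf f s := by
    rw [abs_div, abs_of_pos hg0]; gcongr; exact h2.2.1
  have e3 : |X - 1| ≤ (C + K) / logOf f s := by
    rw [add_div]
    have a1 := abs_le.1 h1
    have a2 := abs_le.1 e2
    exact abs_le.2 ⟨by linarith, by linarith⟩
  have e4 : (C + K) / logOf f s ≤ 1 / 2 := by
    rw [div_le_div_iff₀ hg0 (by norm_num)]; linarith
  have e5 := abs_log_le (e3.trans e4)
  have e6 : Real.log X = Real.log (tailF f s) + logOf f s + Real.log (deriv (logOf f) s) := by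
    rw [hX, Real.log_mul (by positivity) hF.ne', Real.log_mul hfp.ne' h4.ne', logOf]; ring
  rw [← e6]
  calc _ ≤ 2 * |X - 1| := e5
    _ ≤ 2 * ((C + K) / logOf f s) := by gcongr
    _ = _ := by ring

end Tail

/-! ### The logarithmic variable `t = -2 log r` -/

lemma map_exp_neg_half : map (fun t : ℝ => Real.exp (-t / 2)) atTop = 𝓝[>] 0 := by
  have h1 : Tendsto (fun t : ℝ => Real.exp (-t / 2)) atTop (𝓝[>] 0) := by
    refine tendsto_nhdsWithin_iff.2 ⟨?_, Eventually.of_forall fun t => Real.exp_pos _⟩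
    exact Real.tendsto_exp_atBot.comp (tendsto_neg_atTop_atBot.atBot_div_const (by norm_num))
  have h2 : Tendsto (fun r : ℝ => -2 * Real.log r) (𝓝[>] 0) atTop :=
    Real.tendsto_log_nhdsGT_zero.const_mul_atBot_of_neg (by norm_num)
  refine le_antisymm h1 ?_
  calc 𝓝[>] (0 : ℝ) = map (fun r => Real.exp (-(-2 * Real.log r) / 2)) (𝓝[>] 0) := by
        conv_lhs => rw [← map_id (f := 𝓝[>] (0 : ℝ))]
        refine Filter.map_congr ?_
        filter_upwards [self_mem_nhdsWithin] with r hr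
        rw [show -(-2 * Real.log r) / 2 = Real.log r by ring, Real.exp_log hr, id]
    _ = map (fun t : ℝ => Real.exp (-t / 2)) (map (fun r => -2 * Real.log r) (𝓝[>] 0)) := by
        rw [map_map]; rfl
    _ ≤ _ := map_mono h2

lemma neg_two_mul_log_exp (t : ℝ) : -2 * Real.log (Real.exp (-t / 2)) = t := by
  rw [Real.log_exp]; ring

lemma isLittleO_nhdsGT_iff {p k : ℝ → ℝ} :
    p =o[𝓝[>] 0] k ↔
      (fun t => p (Real.exp (-t / 2))) =o[atTop] fun t => k (Real.exp (-t / 2)) := by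
  rw [← map_exp_neg_half, isLittleO_map]; rfl

lemma tendsto_nhdsGT_iff {p : ℝ → ℝ} {l : Filter ℝ} :
    Tendsto p (𝓝[>] 0) l ↔ Tendsto (fun t => p (Real.exp (-t / 2))) atTop l := by
  rw [← map_exp_neg_half, tendsto_map'_iff]; rfl

/-- Powers of `-log r` are constant multiples of powers of `t`. -/
lemma neg_log_exp_rpow_isTheta (p : ℝ) :
    (fun t : ℝ => (-Real.log (Real.exp (-t / 2))) ^ p) =Θ[atTop] fun t => t ^ p := by
  have h : (fun t : ℝ => (-Real.log (Real.exp (-t / 2))) ^ p) =ᶠ[atTop]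
      fun t => (1 / 2 : ℝ) ^ p * t ^ p := by
    filter_upwards [eventually_ge_atTop 0] with t ht
    rw [Real.log_exp, ← Real.mul_rpow (by norm_num) ht]; congr 1; ring
  exact h.trans_isTheta ((isTheta_refl _ _).const_mul_left (by positivity))

lemma log_div_isLittleO_rpow {ε : ℝ} (hε : 0 < ε) :
    (fun t : ℝ => Real.log t / t) =o[atTop] fun t => t ^ (-1 + ε) := by
  have h := (isLittleO_log_rpow_atTop hε).mul_isBigO (isBigO_refl (fun t : ℝ => t⁻¹) atTop)
  refine h.congr' (Eventually.of_forall fun t => by simp [div_eq_mul_inv]) ?_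
  filter_upwards [eventually_gt_atTop 0] with t ht
  rw [Real.rpow_add ht, Real.rpow_neg_one, mul_comm]

lemma one_div_isBigO_log_div :
    (fun t : ℝ => 1 / t) =O[atTop] fun t => Real.log t / t := by
  refine IsBigO.of_bound 1 ?_
  filter_upwards [eventually_ge_atTop (Real.exp 1)] with t ht
  have ht0 : 0 < t := (Real.exp_pos 1).trans_le ht
  have : 1 ≤ Real.log t := by rwa [Real.le_log_iff_exp_le ht0]
  rw [one_mul, Real.norm_of_nonneg (by positivity), Real.norm_of_nonneg (by positivity)]
  gcongr

/-- If `|w - t| ≤ C (log t + log w)`, then `w - t = O(log t)`. -/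
lemma isBigO_log_of_implicit {w : ℝ → ℝ} (hw : Tendsto w atTop atTop)
    (h : (fun t => w t - t) =O[atTop] fun t => Real.log t + Real.log (w t)) :
    (fun t => w t - t) =O[atTop] Real.log := by
  obtain ⟨C, hC, h⟩ := h.exists_pos
  have hlog : ∀ᶠ x : ℝ in atTop, C * Real.log x ≤ x / 4 := by
    have := Real.isLittleO_log_id_atTop.bound (show 0 < (4 * C)⁻¹ by positivity)
    filter_upwards [this, eventually_ge_atTop 1] with x hx hx1
    rw [Real.norm_of_nonneg (Real.log_nonneg hx1), id,
      Real.norm_of_nonneg (by linarith : (0 : ℝ) ≤ x)] at hx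
    calc C * Real.log x ≤ C * ((4 * C)⁻¹ * x) := by gcongr
      _ = x / 4 := by field_simp
  refine IsBigO.of_bound (3 * C) ?_
  filter_upwards [h.bound, hlog, hw.eventually hlog, hw.eventually_ge_atTop 1,
    eventually_ge_atTop 2] with t h1 h2 h3 h4 h5
  have l1 : 0 ≤ Real.log t := Real.log_nonneg (by linarith)
  have l2 : 0 ≤ Real.log (w t) := Real.log_nonneg h4
  rw [Real.norm_eq_abs, Real.norm_of_nonneg (by positivity)] at h1
  rw [Real.norm_eq_abs, Real.norm_of_nonneg l1]
  have h6 : w t ≤ 2 * t := by have := (abs_le.1 h1).2; nlinarith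
  have h7 : Real.log (w t) ≤ 2 * Real.log t := by
    have e1 := Real.log_le_log (by linarith) h6
    rw [Real.log_mul (by norm_num) (by linarith)] at e1
    have := Real.log_le_log (by norm_num) h5
    linarith
  nlinarith

lemma log_sub_log_isBigO {w : ℝ → ℝ} (h : (fun t => w t - t) =O[atTop] Real.log) :
    (fun t => Real.log (w t) - Real.log t) =O[atTop] fun t => Real.log t / t := by
  have h1 : (fun t => w t / t - 1) =O[atTop] fun t => Real.log t / t := by
    refine (h.mul (isBigO_refl (fun t : ℝ => t⁻¹) atTop)).congr' ?_
      (Eventually.of_forall fun t => by simp [div_eq_mul_inv])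
    filter_upwards [eventually_ne_atTop 0] with t ht
    field_simp
  have h0 : Tendsto (fun t : ℝ => Real.log t / t) atTop (𝓝 0) :=
    Real.isLittleO_log_id_atTop.tendsto_div_nhds_zero
  have h2 := (h1.trans_tendsto h0).abs
  rw [abs_zero] at h2
  refine IsBigO.trans (IsBigO.of_bound 2 ?_) h1
  filter_upwards [h2.eventually (ge_mem_nhds (show (0 : ℝ) < 1 / 2 by norm_num)),
    eventually_gt_atTop 0] with t ht ht0
  have := abs_log_le ht
  have hw : 0 < w t / t := by have := abs_le.1 ht; linarith
  have hw' : w t ≠ 0 := fun h => by simp [h] at hw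
  rwa [Real.log_div hw' ht0.ne'] at this

lemma tendsto_div_of_sub_isBigO_log {w : ℝ → ℝ} (h : (fun t => w t - t) =O[atTop] Real.log) :
    Tendsto (fun t => w t / t) atTop (𝓝 1) := by
  have h1 : (fun t => w t - t) =o[atTop] fun t : ℝ => t :=
    h.trans_isLittleO Real.isLittleO_log_id_atTop
  have h2 := h1.tendsto_div_nhds_zero.add_const 1
  rw [zero_add] at h2
  refine h2.congr' ?_
  filter_upwards [eventually_ne_atTop 0] with t ht
  field_simp; ring

/-! ### Increments near infinity -/

namespace RegularGrowth

variable {g : ℝ → ℝ} {q : ℝ}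

/-- If `Φ' = O(g' / g)`, then the increments of `Φ` are controlled by those of `log g`. -/
lemma comp_sub_isBigO (R : RegularGrowth g q) {Φ Φ' : ℝ → ℝ} {L : ℝ}
    (h : ∀ᶠ s in atTop, HasDerivAt Φ (Φ' s) s ∧ |Φ' s| ≤ L * (deriv g s / g s))
    {ι : Type*} {l : Filter ι} {a b : ι → ℝ} (ha : Tendsto a l atTop) (hb : Tendsto b l atTop) :
    (fun t => Φ (a t) - Φ (b t)) =O[l] fun t => Real.log (g (a t)) - Real.log (g (b t)) := by
  obtain ⟨A, hA⟩ := eventually_atTop.1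
    (h.and (R.differentiable.and (R.tendsto.eventually_gt_atTop 0)))
  refine IsBigO.of_bound |L| ?_
  filter_upwards [ha.eventually_ge_atTop A, hb.eventually_ge_atTop A] with t h1 h2
  have := abs_sub_le_of_abs_deriv_le (Θ := fun s => L * Real.log (g s))
    (fun s hs => (hA s hs).1.1)
    (fun s hs => ((hA s hs).2.1.hasDerivAt.log (hA s hs).2.2.ne').const_mul L)
    (fun s hs => (hA s hs).1.2) h1 h2
  rwa [← mul_sub, abs_mul] at this

lemma symbol_comp_sub_isBigO (R : RegularGrowth g q) {Φ : ℝ → ℝ} (hΦ : IsSymbol g Φ)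
    {ι : Type*} {l : Filter ι} {a b : ι → ℝ} (ha : Tendsto a l atTop) (hb : Tendsto b l atTop) :
    (fun t => Φ (a t) - Φ (b t)) =O[l] fun t => Real.log (g (a t)) - Real.log (g (b t)) := by
  obtain ⟨K, L, h⟩ := hΦ
  exact R.comp_sub_isBigO (h.mono fun s hs => ⟨hs.1.hasDerivAt, hs.2.2⟩) ha hb

lemma log_deriv_hasDerivAt (R : RegularGrowth g q) : ∃ L, ∀ᶠ s in atTop,
    HasDerivAt (fun s => Real.log (deriv g s)) (growthH g s * (deriv g s / g s)) s ∧
      |growthH g s * (deriv g s / g s)| ≤ L * (deriv g s / g s) := by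
  obtain ⟨K, L, h⟩ := R.symbol_zero
  refine ⟨K, ?_⟩
  filter_upwards [h, R.second, R.deriv_pos, R.tendsto.eventually_gt_atTop 0] with s h1 h2 h3 h4
  refine ⟨(h2.log h3.ne').congr_deriv (by field_simp), ?_⟩
  rw [abs_mul, abs_of_pos (div_pos h3 h4)]
  gcongr
  exact h1.2.1

lemma log_deriv_comp_sub_isBigO (R : RegularGrowth g q)
    {ι : Type*} {l : Filter ι} {a b : ι → ℝ} (ha : Tendsto a l atTop) (hb : Tendsto b l atTop) :
    (fun t => Real.log (deriv g (a t)) - Real.log (deriv g (b t))) =O[l]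
      fun t => Real.log (g (a t)) - Real.log (g (b t)) := by
  obtain ⟨L, h⟩ := R.log_deriv_hasDerivAt
  exact R.comp_sub_isBigO h ha hb

lemma log_deriv_isBigO (R : RegularGrowth g q) :
    (fun s => Real.log (deriv g s)) =O[atTop] fun s => Real.log (g s) := by
  obtain ⟨L, h⟩ := R.log_deriv_hasDerivAt
  obtain ⟨A, hA⟩ := eventually_atTop.1
    (h.and (R.differentiable.and (R.tendsto.eventually_gt_atTop 0)))
  have h1 : (fun s => Real.log (deriv g s) - Real.log (deriv g A)) =O[atTop]
      fun s => Real.log (g s) - Real.log (g A) := by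
    refine IsBigO.of_bound |L| ?_
    filter_upwards [eventually_ge_atTop A] with s hs
    have := abs_sub_le_of_abs_deriv_le (Θ := fun s => L * Real.log (g s))
      (fun s hs => (hA s hs).1.1)
      (fun s hs => ((hA s hs).2.1.hasDerivAt.log (hA s hs).2.2.ne').const_mul L)
      (fun s hs => (hA s hs).1.2) hs le_rfl
    rwa [← mul_sub, abs_mul] at this
  have hlog : Tendsto (fun s => Real.log (g s)) atTop atTop :=
    Real.tendsto_log_atTop.comp R.tendsto
  have hc : ∀ c : ℝ, (fun _ : ℝ => c) =O[atTop] fun s => Real.log (g s) := fun c =>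
    (isLittleO_const_left.2 (Or.inr (tendsto_norm_atTop_atTop.comp hlog))).isBigO
  simpa using (h1.trans ((isBigO_refl _ _).sub (hc _))).add (hc (Real.log (deriv g A)))

end RegularGrowth

/-! ### Inverse functions -/

lemma invOnNonneg_spec {h : ℝ → ℝ} (hc : ContinuousOn h (Ici 0)) (ht : Tendsto h atTop atTop) :
    ∀ᶠ y in atTop, 0 ≤ invOnNonneg h y ∧ h (invOnNonneg h y) = y := by
  filter_upwards [eventually_ge_atTop (h 0)] with y hy
  obtain ⟨b, hb, hb0⟩ := ((ht.eventually_ge_atTop y).and (eventually_ge_atTop 0)).exists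
  have hex : ∃ s ∈ Ici (0 : ℝ), h s = y := by
    obtain ⟨s, hs, e⟩ := intermediate_value_Icc hb0 (hc.mono Icc_subset_Ici_self) ⟨hy, hb⟩
    exact ⟨s, hs.1, e⟩
  exact ⟨Function.invFunOn_mem hex, Function.invFunOn_eq hex⟩

lemma tendsto_invOnNonneg {h : ℝ → ℝ} (hc : ContinuousOn h (Ici 0))
    (ht : Tendsto h atTop atTop) : Tendsto (invOnNonneg h) atTop atTop := by
  refine tendsto_atTop.2 fun M => ?_
  obtain ⟨B, hB⟩ := (isCompact_Icc (a := (0 : ℝ)) (b := M)).bddAbove_image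
    (hc.mono Icc_subset_Ici_self)
  filter_upwards [invOnNonneg_spec hc ht, eventually_gt_atTop B] with y ⟨h0, h1⟩ h2
  by_contra hlt
  push Not at hlt
  have := hB (mem_image_of_mem h ⟨h0, hlt.le⟩)
  linarith

section Model

variable {f : ℝ → ℝ} {q : ℝ}

/-- The comparison profile `ũ` in the variable `t = -2 log r`. -/
def modelUt (f : ℝ → ℝ) (q t : ℝ) : ℝ := modelU f q (Real.exp (-t / 2))

lemma modelUt_eq (f : ℝ → ℝ) (q t : ℝ) :
    modelUt f q t = invOnNonneg (tailF f) (q / 4 * Real.exp (-t) * (t + 1)) := by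
  rw [modelUt, modelU, neg_two_mul_log_exp, ← Real.exp_nat_mul]
  congr 4; push_cast; ring

/-- The argument of `F⁻¹` in the definition of `ũ` tends to zero as `t → ∞`. -/
lemma tendsto_model_mass (q : ℝ) :
    Tendsto (fun t : ℝ => q / 4 * Real.exp (-t) * (t + 1)) atTop (𝓝 0) := by
  have h1 : Tendsto (fun t : ℝ => t * Real.exp (-t)) atTop (𝓝 0) := by
    simpa using Real.tendsto_pow_mul_exp_neg_atTop_nhds_zero 1
  have h2 : Tendsto (fun t : ℝ => Real.exp (-t)) atTop (𝓝 0) := Real.tendsto_exp_neg_atTop_nhds_zero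
  have := (h1.add h2).const_mul (q / 4)
  simp only [add_zero, mul_zero] at this
  exact this.congr fun t => by ring

lemma modelUt_spec (hf : PositiveC1 f) (R : RegularGrowth (logOf f) q) :
    ∀ᶠ t in atTop, 0 ≤ modelUt f q t ∧
      tailF f (modelUt f q t) = q / 4 * Real.exp (-t) * (t + 1) := by
  have hq := R.q_pos
  have hF1 := tailF_pos hf R zero_le_one
  filter_upwards [(tendsto_model_mass q).eventually (gt_mem_nhds hF1), eventually_gt_atTop 0]
    with t h1 h2
  set y := q / 4 * Real.exp (-t) * (t + 1) with hy
  have hy0 : 0 < y := by positivity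
  obtain ⟨b, hb, hb1⟩ := (((tendsto_tailF hf R).eventually (gt_mem_nhds hy0)).and
    (eventually_ge_atTop 1)).exists
  have hex : ∃ s ∈ Ici (0 : ℝ), tailF f s = y := by
    obtain ⟨s, hs, e⟩ := intermediate_value_Icc' hb1 (f := tailF f) (fun s hs =>
      (hasDerivAt_tailF hf R (by linarith [hs.1])).continuousAt.continuousWithinAt)
      ⟨hb.le, h1.le⟩
    exact ⟨s, by have := hs.1; exact mem_Ici.2 (by linarith), e⟩
  rw [modelUt_eq]
  exact ⟨Function.invFunOn_mem hex, Function.invFunOn_eq hex⟩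

lemma tendsto_modelUt (hf : PositiveC1 f) (R : RegularGrowth (logOf f) q) :
    Tendsto (modelUt f q) atTop atTop := by
  refine tendsto_atTop.2 fun M => ?_
  have hM := tailF_pos hf R (le_max_right M 0)
  filter_upwards [modelUt_spec hf R, (tendsto_model_mass q).eventually (gt_mem_nhds hM)]
    with t ⟨h0, h1⟩ h2
  by_contra hlt
  push Not at hlt
  have := (tailF_strictAntiOn hf R).antitoneOn h0 (le_max_right M 0)
    (hlt.le.trans (le_max_left M 0))
  linarith

lemma logInv_spec (hf : PositiveC1 f) (R : RegularGrowth (logOf f) q) :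
    ∀ᶠ t in atTop, logOf f (invOnNonneg (logOf f) t) = t :=
  (invOnNonneg_spec (continuousOn_logOf hf) R.tendsto).mono fun _ h => h.2

lemma tendsto_logInv (hf : PositiveC1 f) (R : RegularGrowth (logOf f) q) :
    Tendsto (invOnNonneg (logOf f)) atTop atTop :=
  tendsto_invOnNonneg (continuousOn_logOf hf) R.tendsto

lemma baseExpansion_eq (hf : PositiveC1 f) (R : RegularGrowth (logOf f) q) :
    ∀ᶠ t in atTop, baseExpansion (logOf f) q (Real.exp (-t / 2)) =
      t - Real.log t - Real.log (deriv (logOf f) (invOnNonneg (logOf f) t)) +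
        Real.log 4 - Real.log q := by
  filter_upwards [logInv_spec hf R, (tendsto_logInv hf R).eventually R.deriv_pos,
    eventually_gt_atTop 0] with t h1 h2 h3
  rw [baseExpansion, neg_two_mul_log_exp, h1, Real.log_div h3.ne' h2.ne']
  ring

/-- The first approximation `g(ũ) = t + O(log t)`. -/
lemma logOf_modelUt_sub_isBigO_log (hf : PositiveC1 f) (R : RegularGrowth (logOf f) q) :
    (fun t => logOf f (modelUt f q t) - t) =O[atTop] Real.log := by
  obtain ⟨C, hC, h⟩ := exists_abs_log_tailF_le hf R
  have hU := tendsto_modelUt hf R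
  have hw : Tendsto (fun t => logOf f (modelUt f q t)) atTop atTop := R.tendsto.comp hU
  refine isBigO_log_of_implicit hw ?_
  obtain ⟨K, hK, hKb⟩ := (R.log_deriv_isBigO.comp_tendsto hU).exists_pos
  refine IsBigO.of_bound (C + |Real.log (q / 4)| + 2 + K) ?_
  filter_upwards [hU.eventually h, modelUt_spec hf R, hKb.bound,
    hw.eventually_ge_atTop (Real.exp 1), eventually_ge_atTop (Real.exp 1)] with t h1 h2 h3 h4 h5
  have e1 : 1 < Real.exp 1 := by simp
  have hq := R.q_pos
  have ht0 : 0 < t := by linarith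
  have hw0 : 0 < logOf f (modelUt f q t) := by linarith
  have l1 : 1 ≤ Real.log t := by rwa [Real.le_log_iff_exp_le ht0]
  have l2 : 1 ≤ Real.log (logOf f (modelUt f q t)) := by rwa [Real.le_log_iff_exp_le hw0]
  simp only [Function.comp, Real.norm_eq_abs] at h3
  rw [abs_of_pos (by linarith : 0 < Real.log (logOf f (modelUt f q t)))] at h3
  rw [h2.2, Real.log_mul (by positivity) (by positivity),
    Real.log_mul (by positivity) (by positivity), Real.log_exp] at h1
  have l3 : Real.log (t + 1) ≤ 2 * Real.log t := by
    rw [← Real.log_rpow ht0]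
    refine Real.log_le_log (by linarith) ?_
    rw [Real.rpow_two]
    have := Real.exp_one_gt_d9
    nlinarith
  have l4 : 0 ≤ Real.log (t + 1) := Real.log_nonneg (by linarith)
  have l5 : C / logOf f (modelUt f q t) ≤ C := div_le_self hC (by linarith)
  rw [Real.norm_eq_abs, Real.norm_of_nonneg (by linarith)]
  set w := logOf f (modelUt f q t)
  have a1 := abs_le.1 h1
  have a2 := abs_le.1 h3
  have a3 := neg_abs_le (Real.log (q / 4))
  have a4 := le_abs_self (Real.log (q / 4))
  have a5 := abs_nonneg (Real.log (q / 4))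
  have b1 : C ≤ C * (Real.log t + Real.log w) := le_mul_of_one_le_right hC (by linarith)
  have b2 : |Real.log (q / 4)| ≤ |Real.log (q / 4)| * (Real.log t + Real.log w) :=
    le_mul_of_one_le_right a5 (by linarith)
  have b3 : K * Real.log w ≤ K * (Real.log t + Real.log w) := by gcongr; linarith
  rw [add_mul, add_mul, add_mul]
  exact abs_le.2 ⟨by linarith, by linarith⟩

/-- The expansion of `g(ũ)`, with the remainder `O(log t / t)`: in `-log F(ũ) = g + log g' + O(1 /
g)` the term `log g'(ũ)` may be replaced by its value at `g⁻¹(t)`, because `g(ũ) - t = O(log t)`. -/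
theorem logOf_modelUt_sub_base_isBigO (hf : PositiveC1 f) (R : RegularGrowth (logOf f) q) :
    (fun t => logOf f (modelUt f q t) - baseExpansion (logOf f) q (Real.exp (-t / 2)))
      =O[atTop] fun t => Real.log t / t := by
  obtain ⟨C, hC, h⟩ := exists_abs_log_tailF_le hf R
  have hU := tendsto_modelUt hf R
  have hS := tendsto_logInv hf R
  have hO := logOf_modelUt_sub_isBigO_log hf R
  have hq := R.q_pos
  have h1 : (fun t => Real.log (deriv (logOf f) (modelUt f q t)) -
      Real.log (deriv (logOf f) (invOnNonneg (logOf f) t))) =O[atTop]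
      fun t => Real.log t / t := by
    refine ((R.log_deriv_comp_sub_isBigO hU hS).congr' EventuallyEq.rfl ?_).trans
      (log_sub_log_isBigO hO)
    filter_upwards [logInv_spec hf R] with t ht
    rw [ht]
  have h2 : (fun t => Real.log (tailF f (modelUt f q t)) + logOf f (modelUt f q t) +
      Real.log (deriv (logOf f) (modelUt f q t))) =O[atTop] fun t => Real.log t / t := by
    refine IsBigO.trans (IsBigO.of_bound (2 * C) ?_) one_div_isBigO_log_div
    filter_upwards [hU.eventually h, (tendsto_div_of_sub_isBigO_log hO).eventually
      (lt_mem_nhds (show (1 / 2 : ℝ) < 1 by norm_num)), eventually_gt_atTop 0] with t e1 e2 e3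
    rw [Real.norm_eq_abs, Real.norm_of_nonneg (by positivity)]
    refine e1.trans ?_
    rw [lt_div_iff₀ e3] at e2
    calc C / logOf f (modelUt f q t) ≤ C / (1 / 2 * t) := by gcongr
      _ = 2 * C * (1 / t) := by field_simp
  have h3 : (fun t : ℝ => Real.log (t + 1) - Real.log t) =O[atTop] fun t => Real.log t / t := by
    refine log_sub_log_isBigO (w := fun t => t + 1) ?_
    simp only [add_sub_cancel_left]
    exact (isLittleO_const_left.2
      (Or.inr (tendsto_norm_atTop_atTop.comp Real.tendsto_log_atTop))).isBigO
  refine ((h2.sub h1).sub h3).congr' ?_ EventuallyEq.rfl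
  filter_upwards [modelUt_spec hf R, baseExpansion_eq hf R, eventually_gt_atTop 0] with t e1 e2 e3
  rw [e2, e1.2, Real.log_mul (by positivity) (by positivity),
    Real.log_mul (by positivity) (by positivity), Real.log_exp, Real.log_div hq.ne' (by norm_num)]
  ring

theorem logOf_modelU_expansion (hf : PositiveC1 f) (R : RegularGrowth (logOf f) q) {ε : ℝ}
    (hε : 0 < ε) :
    (fun r => logOf f (modelU f q r) - baseExpansion (logOf f) q r)
      =o[𝓝[>] 0] fun r => (-Real.log r) ^ (-1 + ε) :=
  isLittleO_nhdsGT_iff.2 (((logOf_modelUt_sub_base_isBigO hf R).trans_isLittleO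
    (log_div_isLittleO_rpow hε)).trans_isTheta (neg_log_exp_rpow_isTheta _).symm)

end Model

/-! ### The model nonlinearity -/

/-- The computation behind both model nonlinearities: if `φ = 4 e^X / (B X X')` with
`X'' = (X')² / (B X)`, then `F[φ]` and `φ' F[φ]` are explicit functions of `X`. -/
lemma tailF_of_phase {φ X X₁ : ℝ → ℝ} {B : ℝ} (hB : 0 < B)
    (hφ : ∀ s > 0, φ s = 4 * Real.exp (X s) / (B * X s * X₁ s))
    (hX : ∀ s > 0, HasDerivAt X (X₁ s) s)
    (hX₁ : ∀ s > 0, HasDerivAt X₁ (X₁ s ^ 2 / (B * X s)) s)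
    (hpos : ∀ s > 0, 0 < X s) (hpos₁ : ∀ s > 0, 0 < X₁ s) (hlim : Tendsto X atTop atTop)
    {s : ℝ} (hs : 0 < s) :
    tailF φ s = B / 4 * Real.exp (-X s) * (X s + 1) ∧
      deriv φ s * tailF φ s = (1 + 1 / X s) * (1 - (1 + 1 / B) / X s) := by
  have hF : tailF φ s = B / 4 * Real.exp (-X s) * (X s + 1) := by
    have hlim0 : Tendsto (fun s => -(B / 4 * Real.exp (-X s) * (X s + 1))) atTop (𝓝 0) := by
      simpa using ((tendsto_model_mass B).comp hlim).neg
    have hd : ∀ x ∈ Ici s, HasDerivAt (fun s => -(B / 4 * Real.exp (-X s) * (X s + 1)))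
        (1 / φ x) x := fun x hx => by
      have hx0 : 0 < x := hs.trans_le hx
      have := hpos x hx0
      have := hpos₁ x hx0
      refine ((((hX x hx0).fun_neg.exp.const_mul (B / 4)).fun_mul
        ((hX x hx0).add_const 1)).fun_neg).congr_deriv ?_
      rw [hφ x hx0, Real.exp_neg]
      field_simp
      ring
    have := integral_Ioi_of_hasDerivAt_of_nonneg' hd (fun x hx => ?_) hlim0
    · rw [tailF, this]; ring
    · have hx0 : 0 < x := hs.trans hx
      have := hpos x hx0
      have := hpos₁ x hx0
      rw [hφ x hx0]; positivity
  refine ⟨hF, ?_⟩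
  have h1 := hpos s hs
  have h2 := hpos₁ s hs
  have hd : HasDerivAt φ (4 * Real.exp (X s) / (B * X s * X₁ s) *
      (X₁ s - X₁ s / X s - X₁ s / (B * X s))) s := by
    refine HasDerivAt.congr_of_eventuallyEq (f := fun s => 4 * Real.exp (X s) / (B * X s * X₁ s))
      ?_ ?_
    · refine (((hX s hs).exp.const_mul 4).fun_div
        (((hX s hs).const_mul B).fun_mul (hX₁ s hs)) (by positivity)).congr_deriv ?_
      field_simp
      ring
    · filter_upwards [Ioi_mem_nhds hs] with x hx using hφ x hx
  rw [hd.deriv, hF, Real.exp_neg]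
  field_simp
  ring

/-- The phases are `X(s) = s^{B'}` for `B > 1` and `X(s) = e^s` for `B = 1`, and `X(v) = t` in both
cases. In particular `F[φ](v) = F[f](ũ)`. -/
lemma modelPhi_at_modelV {B t : ℝ} (hB : 1 ≤ B) (ht : 1 < t) :
    tailF (modelPhi B) (modelV B (Real.exp (-t / 2))) = B / 4 * Real.exp (-t) * (t + 1) ∧
      deriv (modelPhi B) (modelV B (Real.exp (-t / 2))) *
        tailF (modelPhi B) (modelV B (Real.exp (-t / 2))) =
          (1 + 1 / t) * (1 - (1 + 1 / B) / t) := by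
  have ht0 : 0 < t := by linarith
  rw [modelV, neg_two_mul_log_exp]
  rcases eq_or_ne B 1 with rfl | hB1
  · rw [if_pos rfl]
    have := tailF_of_phase (φ := modelPhi 1) (X := Real.exp) (X₁ := Real.exp) zero_lt_one
      (fun s _ => ?_) (fun s _ => Real.hasDerivAt_exp s) (fun s _ => ?_)
      (fun s _ => Real.exp_pos s) (fun s _ => Real.exp_pos s) Real.tendsto_exp_atTop
      (Real.log_pos ht)
    · rwa [Real.exp_log ht0] at this
    · rw [modelPhi, if_pos rfl, two_mul, Real.exp_add, one_mul]
    · refine (Real.hasDerivAt_exp s).congr_deriv ?_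
      have := Real.exp_pos s
      field_simp
  · have hB1' : 1 < B := lt_of_le_of_ne hB (Ne.symm hB1)
    rw [if_neg hB1]
    set b := B.conjExponent with hb
    have hconj : B.HolderConjugate b := Real.HolderConjugate.conjExponent hB1'
    have hb1 : 1 < b := hconj.symm.lt
    have hb0 : 0 < b := by linarith
    have hinv : (b - 1) / b = 1 / B := by
      have := hconj.inv_add_inv_eq_one
      field_simp at this ⊢
      linarith
    have := tailF_of_phase (φ := modelPhi B) (X := fun s => s ^ b)
      (X₁ := fun s => b * s ^ (b - 1)) (by linarith : 0 < B)
      (fun s hs => ?_) (fun s hs => Real.hasDerivAt_rpow_const (Or.inl hs.ne')) (fun s hs => ?_)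
      (fun s hs => Real.rpow_pos_of_pos hs _)
      (fun s hs => mul_pos hb0 (Real.rpow_pos_of_pos hs _)) (tendsto_rpow_atTop hb0)
      (Real.rpow_pos_of_pos ht0 (1 / b))
    · simp only [← Real.rpow_mul ht0.le, one_div_mul_cancel hb0.ne', Real.rpow_one] at this
      exact this
    · rw [modelPhi, if_neg hB1, ← hb, show 2 * b - 1 = b + (b - 1) by ring, Real.rpow_add hs]
      have := Real.rpow_pos_of_pos hs b
      have := Real.rpow_pos_of_pos hs (b - 1)
      field_simp
    · refine ((Real.hasDerivAt_rpow_const (p := b - 1) (Or.inl hs.ne')).const_mul b).congr_deriv ?_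
      have e1 : s ^ b = s ^ (b - 1) * s := by
        rw [← Real.rpow_add_one hs.ne']; congr 1; ring
      have e2 : s ^ (b - 1) = s ^ (b - 1 - 1) * s := by
        rw [← Real.rpow_add_one hs.ne']; congr 1; ring
      have e3 := Real.rpow_pos_of_pos hs (b - 1 - 1)
      simp only [e1, e2]
      have hBb : b - 1 = b / B := by field_simp at hinv ⊢; linarith
      have hB0 : 0 < B := by linarith
      rw [hBb]
      rw [hBb] at e3
      field_simp

/-! ### Consequences of the smallness condition on the remainders -/

section Remainder

variable {f : ℝ → ℝ} {q : ℝ}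

lemma remainderSum_nonneg (f : ℝ → ℝ) (B r : ℝ) : 0 ≤ remainderSum f B r := by
  rw [remainderSum]; positivity

/-- In the variable `t`, the condition says `R₁ + R₂ = o(t^{-1/2})`. -/
lemma CondF3.remainderSum_isLittleO (h : CondF3 f q) :
    remainderSum f q =o[𝓝[>] 0] fun r => (-Real.log r) ^ (-(1 / 2) : ℝ) := by
  have hpos : ∀ᶠ r : ℝ in 𝓝[>] 0, 0 < -Real.log r := by
    filter_upwards [Ioo_mem_nhdsGT (zero_lt_one' ℝ)] with r hr
    linarith [Real.log_neg hr.1 hr.2]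
  have h1 := (isLittleO_one_iff ℝ).2 h
  have h2 := h1.mul_isBigO (isBigO_refl (fun r : ℝ => (-Real.log r) ^ (-(1 / 2) : ℝ)) (𝓝[>] 0))
  refine h2.congr' ?_ (Eventually.of_forall fun r => by simp)
  filter_upwards [hpos] with r hr
  rw [mul_right_comm, ← Real.rpow_add hr]
  norm_num

/-- The supremum defining `R` inherits the decay of `R₁ + R₂`. -/
lemma CondF3.remainderSup_isLittleO (h : CondF3 f q) :
    remainderSup f q =o[𝓝[>] 0] fun r => (-Real.log r) ^ (-(1 / 2) : ℝ) := by
  refine IsLittleO.of_bound fun c hc => ?_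
  have hlt1 : ∀ᶠ r : ℝ in 𝓝[>] 0, r < 1 :=
    mem_of_superset (Ioo_mem_nhdsGT (zero_lt_one' ℝ)) fun r hr => hr.2
  have h1 := (h.remainderSum_isLittleO.bound hc).and hlt1
  obtain ⟨δ, hδ, hb⟩ := mem_nhdsGT_iff_exists_Ioc_subset.1 h1
  have hδ0 : (0 : ℝ) < δ := hδ
  filter_upwards [Ioc_mem_nhdsGT hδ0] with r hr
  have hrb := hb hr
  have hlog : ∀ x ∈ Ioc 0 r, 0 < -Real.log x := fun x hx => by
    linarith [Real.log_neg hx.1 (hb ⟨hx.1, hx.2.trans hr.2⟩).2]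
  have hle : ∀ y ∈ remainderSum f q '' Ioc 0 r, y ≤ c * (-Real.log r) ^ (-(1 / 2) : ℝ) := by
    rintro y ⟨x, hx, rfl⟩
    have e1 := (hb ⟨hx.1, hx.2.trans hr.2⟩).1
    rw [Real.norm_of_nonneg (remainderSum_nonneg _ _ _),
      Real.norm_of_nonneg (Real.rpow_nonneg (hlog x hx).le _)] at e1
    refine e1.trans ?_
    gcongr ?_ * ?_
    refine Real.rpow_le_rpow_of_nonpos (hlog r ⟨hr.1, le_rfl⟩) ?_ (by norm_num)
    linarith [Real.log_le_log hx.1 hx.2]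
  have hne : (remainderSum f q '' Ioc 0 r).Nonempty := ⟨_, r, ⟨hr.1, le_rfl⟩, rfl⟩
  rw [remainderSup, Real.norm_of_nonneg, Real.norm_of_nonneg]
  · exact csSup_le hne hle
  · exact Real.rpow_nonneg (hlog r ⟨hr.1, le_rfl⟩).le _
  · exact Real.sSup_nonneg fun y ⟨x, _, hx⟩ => hx ▸ remainderSum_nonneg _ _ _

lemma tendsto_neg_log_rpow_neg_half :
    Tendsto (fun r : ℝ => (-Real.log r) ^ (-(1 / 2) : ℝ)) (𝓝[>] 0) (𝓝 0) :=
  (tendsto_rpow_neg_atTop (by norm_num)).comp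
    (tendsto_neg_atBot_atTop.comp Real.tendsto_log_nhdsGT_zero)

lemma log_div_isLittleO_rpow_neg_half :
    (fun t : ℝ => Real.log t / t) =o[atTop] fun t => t ^ (-(1 / 2) : ℝ) := by
  have := log_div_isLittleO_rpow (show (0 : ℝ) < 1 / 2 by norm_num)
  norm_num at this ⊢
  exact this

/-- `H(ũ) = 1 / q + o(t^{-1/2})`. As `F[f](ũ) = F[φ](v)`, the bound on `R₁` controls the difference
of `f' F` at `ũ` and its model counterpart, and `f' F = 1 - H / g + O(1 / g²)`. -/
lemma CondF3.growthH_modelUt (h : CondF3 f q) (hf : PositiveC1 f)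
    (R : RegularGrowth (logOf f) q) :
    (fun t => growthH (logOf f) (modelUt f q t) - 1 / q) =o[atTop]
      fun t => t ^ (-(1 / 2) : ℝ) := by
  obtain ⟨C, hC, hfF⟩ := exists_abs_deriv_mul_tailF_le hf R
  have hU := tendsto_modelUt hf R
  have hO := logOf_modelUt_sub_isBigO_log hf R
  have hq := R.q_pos
  set w : ℝ → ℝ := fun t => logOf f (modelUt f q t) with hw
  set X : ℝ → ℝ := fun t =>
    deriv f (modelUt f q t) * tailF f (modelUt f q t) with hX
  set Z : ℝ → ℝ := fun t => (1 + 1 / t) * (1 - (1 + 1 / q) / t) with hZ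
  -- `t (f' F - φ' F_φ)` is bounded by twice `R₁`, since `-log F ≥ t / 2`.
  have h1 : (fun t => t * (X t - Z t)) =o[atTop] fun t => t ^ (-(1 / 2) : ℝ) := by
    have hR := (isLittleO_nhdsGT_iff.1 h.remainderSum_isLittleO).trans_isTheta
      (neg_log_exp_rpow_isTheta _)
    refine IsBigO.trans_isLittleO (IsBigO.of_bound 2 ?_) hR
    have hbig : ∀ᶠ t : ℝ in atTop, |Real.log (q / 4)| + Real.log (t + 1) ≤ t / 2 := by
      have e1 : Tendsto (fun t : ℝ => Real.log (t + 1) / (t + 1)) atTop (𝓝 0) :=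
        Real.isLittleO_log_id_atTop.tendsto_div_nhds_zero.comp
          (tendsto_atTop_add_const_right _ 1 tendsto_id)
      filter_upwards [e1.eventually (gt_mem_nhds (show (0 : ℝ) < 1 / 8 by norm_num)),
        eventually_ge_atTop (4 * |Real.log (q / 4)| + 1)] with t e2 e3
      have := abs_nonneg (Real.log (q / 4))
      rw [div_lt_iff₀ (by linarith)] at e2
      linarith
    filter_upwards [modelUt_spec hf R, hbig, eventually_gt_atTop 1] with t e1 e2 e3
    obtain ⟨p1, p2⟩ := modelPhi_at_modelV R.one_le e3
    have hlogF : t / 2 ≤ -Real.log (q / 4 * Real.exp (-t) * (t + 1)) := by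
      rw [Real.log_mul (by positivity) (by positivity),
        Real.log_mul (by positivity) (by positivity), Real.log_exp]
      linarith [le_abs_self (Real.log (q / 4))]
    have key : |invB1 f (modelU f q (Real.exp (-t / 2))) -
        invB1 (modelPhi q) (modelV q (Real.exp (-t / 2)))| =
        -Real.log (q / 4 * Real.exp (-t) * (t + 1)) * |X t - Z t| := by
      rw [invB1, invB1, p2, p1, ← modelUt]
      have hXt : deriv f (modelUt f q t) * tailF f (modelUt f q t) = X t := rfl
      rw [hXt, e1.2, ← mul_sub, abs_mul, abs_of_nonneg (by linarith), abs_sub_comm]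
      simp only [hZ]
      congr 2; ring
    rw [Real.norm_eq_abs, Real.norm_of_nonneg (remainderSum_nonneg _ _ _), abs_mul,
      abs_of_pos (by linarith : 0 < t)]
    have hle : |invB1 f (modelU f q (Real.exp (-t / 2))) -
        invB1 (modelPhi q) (modelV q (Real.exp (-t / 2)))| ≤
        remainderSum f q (Real.exp (-t / 2)) := le_add_of_nonneg_right (abs_nonneg _)
    rw [key] at hle
    have : t / 2 * |X t - Z t| ≤ -Real.log (q / 4 * Real.exp (-t) * (t + 1)) * |X t - Z t| := by
      gcongr
    linarith
  have hdiv := tendsto_div_of_sub_isBigO_log hO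
  have hwpos : ∀ᶠ t in atTop, t / 2 < w t ∧ w t < 2 * t := by
    filter_upwards [hdiv.eventually (lt_mem_nhds (show (1 / 2 : ℝ) < 1 by norm_num)),
      hdiv.eventually (gt_mem_nhds (show (1 : ℝ) < 2 by norm_num)), eventually_gt_atTop 0]
      with t e1 e2 e3
    rw [lt_div_iff₀ e3] at e1
    rw [div_lt_iff₀ e3] at e2
    exact ⟨by linarith, e2⟩
  -- `t (f' F - 1) + t H / g = O(1 / t)`
  have h2 : (fun t => t * (X t - (1 - growthH (logOf f) (modelUt f q t) / w t))) =O[atTop]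
      fun t => Real.log t / t := by
    refine IsBigO.trans (IsBigO.of_bound (4 * C) ?_) one_div_isBigO_log_div
    filter_upwards [hU.eventually hfF, hU.eventually (eventually_deriv_eq hf R), hwpos,
      eventually_gt_atTop 0] with t e1 e2 e3 e4
    rw [Real.norm_eq_abs, abs_mul, abs_of_pos e4, Real.norm_of_nonneg (by positivity)]
    simp only [hX, e2.deriv]
    calc _ ≤ t * (C / w t ^ 2) := by gcongr
      _ ≤ t * (C / (t / 2) ^ 2) := by have := e3.1; gcongr
      _ = _ := by field_simp; norm_num
  have h3 : (fun t => t * (Z t - (1 - 1 / q / t))) =O[atTop] fun t => Real.log t / t := by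
    refine IsBigO.trans (IsBigO.of_bound (1 + 1 / q) ?_) one_div_isBigO_log_div
    filter_upwards [eventually_gt_atTop 0] with t e4
    refine le_of_eq ?_
    rw [show t * (Z t - (1 - 1 / q / t)) = -((1 + 1 / q) * (1 / t)) by
      simp only [hZ]; field_simp; ring, norm_neg, Real.norm_of_nonneg (by positivity),
      Real.norm_of_nonneg (by positivity)]
  have hL := log_div_isLittleO_rpow_neg_half
  have h4 : (fun t => t * (growthH (logOf f) (modelUt f q t) / w t - 1 / q / t)) =o[atTop]
      fun t => t ^ (-(1 / 2) : ℝ) := by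
    refine ((h2.trans_isLittleO hL).sub (h1.add (h3.trans_isLittleO hL))).congr_left fun t => ?_
    ring
  have hratio : (fun t => w t / t) =O[atTop] fun _ => (1 : ℝ) := hdiv.isBigO_one ℝ
  have h5 := h4.mul_isBigO hratio
  have h6 : (fun t => 1 / q * (w t / t - 1)) =O[atTop] fun t => Real.log t / t := by
    refine IsBigO.const_mul_left ?_ _
    refine (hO.mul (isBigO_refl (fun t : ℝ => t⁻¹) atTop)).congr' ?_
      (Eventually.of_forall fun t => by simp [div_eq_mul_inv])
    filter_upwards [eventually_ne_atTop 0] with t ht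
    simp only [hw]; field_simp
  refine (h5.congr_right (fun t => mul_one _) |>.add (h6.trans_isLittleO hL)).congr' ?_
    EventuallyEq.rfl
  filter_upwards [hwpos, eventually_gt_atTop 0] with t e1 e2
  have : w t ≠ 0 := by linarith [e1.1]
  field_simp
  ring

lemma log_mul_isLittleO {q : ℝ} (hq : 0 < q) {h k : ℝ → ℝ} {l : Filter ℝ}
    (hh : (fun t => h t - 1 / q) =o[l] k) (hk : Tendsto k l (𝓝 0)) :
    (fun t => Real.log (q * h t)) =o[l] k := by
  have h1 : (fun t => q * h t - 1) =o[l] k := by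
    refine (hh.const_mul_left q).congr_left fun t => ?_
    field_simp
  refine IsBigO.trans_isLittleO (IsBigO.of_bound 2 ?_) h1
  have h2 := (h1.isBigO.trans_tendsto hk).abs
  rw [abs_zero] at h2
  filter_upwards [h2.eventually (ge_mem_nhds (show (0 : ℝ) < 1 / 2 by norm_num))] with t ht
  exact abs_log_le ht

lemma tendsto_rpow_neg_half : Tendsto (fun t : ℝ => t ^ (-(1 / 2) : ℝ)) atTop (𝓝 0) :=
  tendsto_rpow_neg_atTop (by norm_num)

/-- The correction `log (q H(g⁻¹(t)))` is of lower order than `t^{-1/2}`. -/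
theorem CondF3.log_growthH_isLittleO (h : CondF3 f q) (hf : PositiveC1 f)
    (R : RegularGrowth (logOf f) q) :
    (fun t => Real.log (q * growthH (logOf f) (invOnNonneg (logOf f) t))) =o[atTop]
      fun t => t ^ (-(1 / 2) : ℝ) := by
  refine log_mul_isLittleO R.q_pos ?_ tendsto_rpow_neg_half
  have h1 := R.symbol_comp_sub_isBigO R.symbol_zero (tendsto_modelUt hf R) (tendsto_logInv hf R)
  have h2 : (fun t => growthH (logOf f) (modelUt f q t) -
      growthH (logOf f) (invOnNonneg (logOf f) t)) =O[atTop] fun t => Real.log t / t := by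
    refine (h1.congr' EventuallyEq.rfl ?_).trans
      (log_sub_log_isBigO (logOf_modelUt_sub_isBigO_log hf R))
    filter_upwards [logInv_spec hf R] with t ht
    rw [ht]
  refine ((h.growthH_modelUt hf R).sub
    (h2.trans_isLittleO log_div_isLittleO_rpow_neg_half)).congr_left fun t => ?_
  ring

/-- The mean value estimate for `g` over an interval of length `O(f F R)`, that is, `O(R / g')`:
there `1 / g'` varies by `o(1 / g')`, because `(1 / g')' = -H / g` tends to zero. -/
theorem logOf_sub_isBigO_of_sub (hf : PositiveC1 f) (R : RegularGrowth (logOf f) q)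
    {a b ρ : ℝ → ℝ} {l : Filter ℝ} (ha : Tendsto a l atTop) (hb : Tendsto b l atTop)
    (hρ : Tendsto ρ l (𝓝 0))
    (h : (fun r => b r - a r) =O[l] fun r => f (a r) * tailF f (a r) * ρ r) :
    (fun r => logOf f (b r) - logOf f (a r)) =O[l] ρ := by
  obtain ⟨C, hC, hfF⟩ := exists_abs_deriv_mul_tailF_le hf R
  obtain ⟨K, hK, hb0⟩ := h.exists_pos
  -- `f F ≤ 2 / g'`
  have hfF2 : ∀ᶠ s in atTop, f s * tailF f s ≤ 2 / deriv (logOf f) s := by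
    have e1 : Tendsto (fun s => growthH (logOf f) s / logOf f s) atTop (𝓝 0) :=
      R.tendsto_growthH.div_atTop R.tendsto
    have e2 : Tendsto (fun s => C / logOf f s ^ 2) atTop (𝓝 0) :=
      tendsto_const_nhds.div_atTop ((tendsto_pow_atTop two_ne_zero).comp R.tendsto)
    filter_upwards [hfF, R.deriv_pos,
      e1.eventually (lt_mem_nhds (show (-(1 / 2) : ℝ) < 0 by norm_num)),
      e2.eventually (gt_mem_nhds (show (0 : ℝ) < 1 / 2 by norm_num))] with s h1 h2 h3 h4
    rw [le_div_iff₀ h2]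
    have := (abs_le.1 h1).2
    linarith
  set η : ℝ := 1 / (8 * K) with hη
  have hη0 : 0 < η := by positivity
  have hinv : ∀ᶠ s in atTop, HasDerivAt (fun s => (deriv (logOf f) s)⁻¹)
      (-(growthH (logOf f) s / logOf f s)) s ∧ |-(growthH (logOf f) s / logOf f s)| ≤ η := by
    have e1 : Tendsto (fun s => growthH (logOf f) s / logOf f s) atTop (𝓝 0) :=
      R.tendsto_growthH.div_atTop R.tendsto
    have e2 := e1.abs
    rw [abs_zero] at e2
    filter_upwards [R.second, R.deriv_pos, e2.eventually (ge_mem_nhds hη0)] with s h1 h2 h3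
    refine ⟨(h1.fun_inv h2.ne').congr_deriv (by field_simp), ?_⟩
    rwa [abs_neg]
  obtain ⟨A, hA⟩ := eventually_atTop.1 (hinv.and (R.differentiable.and R.deriv_pos))
  have hρ1 : ∀ᶠ r in l, |ρ r| ≤ 1 := by
    have e2 := hρ.abs
    rw [abs_zero] at e2
    exact e2.eventually (ge_mem_nhds zero_lt_one)
  refine IsBigO.of_bound (4 * K) ?_
  filter_upwards [hb0.bound, ha.eventually_ge_atTop A, hb.eventually_ge_atTop A,
    ha.eventually hfF2, ha.eventually (eventually_ge_atTop 0), hρ1] with r h1 h2 h3 h4 h5 h6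
  have hp := (hA _ h2).2.2
  have hfpos : 0 < f (a r) * tailF f (a r) := mul_pos (hf.2 _ h5) (tailF_pos hf R h5)
  have h7 : |b r - a r| ≤ 2 * K / deriv (logOf f) (a r) * |ρ r| := by
    rw [Real.norm_eq_abs, norm_mul, Real.norm_of_nonneg hfpos.le, Real.norm_eq_abs] at h1
    calc _ ≤ K * (f (a r) * tailF f (a r) * |ρ r|) := h1
      _ ≤ K * (2 / deriv (logOf f) (a r) * |ρ r|) := by gcongr
      _ = _ := by ring
  -- On the interval between `a` and `b`, `g' ≤ 2 g'(a)`.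
  have hder : ∀ x ∈ uIcc (a r) (b r), deriv (logOf f) x ≤ 2 * deriv (logOf f) (a r) := by
    intro x hx
    have hxA : A ≤ x := le_trans (le_min h2 h3) hx.1
    have e1 := abs_sub_le_of_abs_deriv_le (Θ := fun s => η * s) (Θ' := fun _ => η)
      (fun s hs => (hA s hs).1.1) (fun s _ => by simpa using (hasDerivAt_id s).const_mul η)
      (fun s hs => (hA s hs).1.2) h2 hxA
    have e2 : |a r - x| ≤ |b r - a r| := by
      rw [abs_sub_comm]; exact abs_sub_left_of_mem_uIcc hx
    rw [← mul_sub, abs_mul, abs_of_pos hη0] at e1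
    have e3 : η * |a r - x| ≤ 1 / 4 * (deriv (logOf f) (a r))⁻¹ := by
      calc η * |a r - x| ≤ η * (2 * K / deriv (logOf f) (a r) * 1) := by
            gcongr; exact e2.trans (h7.trans (by gcongr))
        _ = _ := by rw [hη]; field_simp; norm_num
    have e4 := (abs_le.1 (e1.trans e3)).2
    have hpx := (hA x hxA).2.2
    have e5 : (deriv (logOf f) (a r))⁻¹ * (1 / 2) ≤ (deriv (logOf f) x)⁻¹ := by
      have : 0 < (deriv (logOf f) (a r))⁻¹ := by positivity
      linarith
    have e6 := inv_anti₀ (by positivity) e5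
    rw [inv_inv, mul_inv, inv_inv] at e6
    linarith
  have hmv := Convex.norm_image_sub_le_of_norm_deriv_le (f := logOf f)
    (C := 2 * deriv (logOf f) (a r)) (s := uIcc (a r) (b r))
    (fun x hx => (hA x (le_trans (le_min h2 h3) hx.1)).2.1)
    (fun x hx => by
      rw [Real.norm_of_nonneg (hA x (le_trans (le_min h2 h3) hx.1)).2.2.le]
      exact hder x hx)
    (convex_uIcc _ _) left_mem_uIcc right_mem_uIcc
  refine hmv.trans ?_
  rw [Real.norm_eq_abs, Real.norm_eq_abs]
  calc 2 * deriv (logOf f) (a r) * |b r - a r|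
      ≤ 2 * deriv (logOf f) (a r) * (2 * K / deriv (logOf f) (a r) * |ρ r|) := by gcongr
    _ = _ := by field_simp; ring

end Remainder

/-! ### The radial equation -/

section Radial

variable {E : Type*} [NormedAddCommGroup E] [InnerProductSpace ℝ E]

lemma hasFDerivAt_comp_norm {K : ℝ → ℝ} {K' : ℝ} {x : E} (hx : x ≠ 0)
    (h : HasDerivAt K K' ‖x‖) :
    HasFDerivAt (fun y : E => K ‖y‖) ((K' / ‖x‖) • innerSL ℝ x) x := by
  have hn : 0 < ‖x‖ := norm_pos_iff.2 hx
  have h1 : HasFDerivAt (fun y : E => ‖y‖) ((1 / ‖x‖) • innerSL ℝ x) x := by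
    have h2 := (hasStrictFDerivAt_norm_sq x).hasFDerivAt.sqrt (by positivity)
    simp only [Real.sqrt_sq (norm_nonneg _)] at h2
    refine h2.congr_fderiv ?_
    ext v
    simp
    field_simp
  refine (h.comp_hasFDerivAt x h1).congr_fderiv ?_
  ext v
  simp
  ring

/-- The Laplacian of a radial function of the plane at a point of the positive first axis. -/
lemma laplacian_radial {U : ℝ → ℝ} {ρ r : ℝ} (hU : ContDiffOn ℝ 2 U (Ioo 0 ρ))
    (hr : r ∈ Ioo 0 ρ) :
    Laplacian.laplacian (fun y : EuclideanSpace ℝ (Fin 2) => U ‖y‖)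
      (EuclideanSpace.single 0 r) = deriv (deriv U) r + deriv U r / r := by
  set x : EuclideanSpace ℝ (Fin 2) := EuclideanSpace.single 0 r with hx
  have hnx : ‖x‖ = r := by rw [hx, PiLp.norm_single, Real.norm_of_nonneg hr.1.le]
  have hx0 : x ≠ 0 := norm_pos_iff.1 (hnx ▸ hr.1)
  have hd : ∀ s ∈ Ioo 0 ρ, HasDerivAt U (deriv U s) s := fun s hs =>
    ((hU.contDiffAt (isOpen_Ioo.mem_nhds hs)).differentiableAt (by norm_num)).hasDerivAt
  have hU1 : ContDiffOn ℝ 1 (deriv U) (Ioo 0 ρ) :=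
    hU.deriv_of_isOpen isOpen_Ioo (by norm_num)
  have hd1 : HasDerivAt (deriv U) (deriv (deriv U) r) r :=
    ((hU1.contDiffAt (isOpen_Ioo.mem_nhds hr)).differentiableAt (by norm_num)).hasDerivAt
  have hfd : fderiv ℝ (fun y : EuclideanSpace ℝ (Fin 2) => U ‖y‖) =ᶠ[𝓝 x]
      fun y => (deriv U ‖y‖ / ‖y‖) • innerSL ℝ y := by
    have hopen : ∀ᶠ y in 𝓝 x, ‖y‖ ∈ Ioo 0 ρ :=
      continuous_norm.continuousAt.eventually (isOpen_Ioo.mem_nhds (by simpa only [hnx] using hr))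
    filter_upwards [hopen] with y hy
    exact (hasFDerivAt_comp_norm (norm_pos_iff.1 hy.1) (hd _ hy)).fderiv
  have hk : HasFDerivAt (fun y : EuclideanSpace ℝ (Fin 2) => deriv U ‖y‖ / ‖y‖)
      (((deriv (deriv U) r * r - deriv U r) / r ^ 2 / r) • innerSL ℝ x) x := by
    have h1 := hd1.fun_div (hasDerivAt_id r) hr.1.ne'
    simp only [id, mul_one] at h1
    rw [← hnx] at h1
    have h2 := hasFDerivAt_comp_norm hx0 h1
    rwa [hnx] at h2
  obtain ⟨L, hL⟩ : ∃ L : EuclideanSpace ℝ (Fin 2) →L[ℝ] (EuclideanSpace ℝ (Fin 2) →L[ℝ] ℝ),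
      ∀ y, L y = innerSL ℝ y := ⟨innerSL ℝ, fun _ => rfl⟩
  have h2 : HasFDerivAt (fun y : EuclideanSpace ℝ (Fin 2) =>
      (deriv U ‖y‖ / ‖y‖) • L y) _ x := hk.smul L.hasFDerivAt
  simp only [hL] at h2
  have hr0 : r ≠ 0 := hr.1.ne'
  rw [InnerProductSpace.laplacian_eq_iteratedFDeriv_orthonormalBasis _
    (EuclideanSpace.basisFun (Fin 2) ℝ)]
  simp only [iteratedFDeriv_two_apply, Matrix.cons_val_zero, Matrix.cons_val_one, hfd.fderiv_eq,
    h2.fderiv, Fin.sum_univ_two]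
  simp [hx, hL, EuclideanSpace.inner_single_left, abs_of_pos hr.1]
  field_simp
  ring

end Radial

/-- Solutions `u` on `(T, ∞)`, with derivative `u₁`, of the radial equation in the variable
`t = -2 log r`, which is `u'' = -e^{-t} f(u) / 4`. -/
structure IsLogSolution (f : ℝ → ℝ) (T : ℝ) (u u₁ : ℝ → ℝ) : Prop where
  hasDerivAt : ∀ t > T, HasDerivAt u (u₁ t) t
  hasDerivAt' : ∀ t > T, HasDerivAt u₁ (-(1 / 4 * Real.exp (-t) * f (u t))) t
  nonneg : ∀ t > T, 0 ≤ u t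
  tendsto : Tendsto u atTop atTop

lemma exp_neg_half_mem {ρ t : ℝ} (hρ : 0 < ρ) (ht : -2 * Real.log ρ < t) :
    Real.exp (-t / 2) ∈ Ioo 0 ρ := by
  refine ⟨Real.exp_pos _, ?_⟩
  rw [← Real.lt_log_iff_exp_lt hρ]
  linarith

theorem IsRadialSingularSolution.isLogSolution {f U : ℝ → ℝ} {ρ : ℝ}
    (h : IsRadialSingularSolution f ρ U) :
    IsLogSolution f (-2 * Real.log ρ) (fun t => U (Real.exp (-t / 2)))
      (fun t => -(1 / 2) * (deriv U (Real.exp (-t / 2)) * Real.exp (-t / 2))) := by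
  have he : ∀ t : ℝ, HasDerivAt (fun t : ℝ => Real.exp (-t / 2))
      (-(1 / 2) * Real.exp (-t / 2)) t := fun t =>
    (((hasDerivAt_id t).fun_neg.div_const 2).exp).congr_deriv (by simp; ring)
  have hU1 : ContDiffOn ℝ 1 (deriv U) (Ioo 0 ρ) :=
    h.contDiffOn.deriv_of_isOpen isOpen_Ioo (by norm_num)
  refine ⟨fun t ht => ?_, fun t ht => ?_, fun t ht => ?_, ?_⟩
  · have hr := exp_neg_half_mem h.radius_pos ht
    have hd := ((h.contDiffOn.contDiffAt (isOpen_Ioo.mem_nhds hr)).differentiableAt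
      (by norm_num)).hasDerivAt
    exact (hd.comp t (he t)).congr_deriv (by ring)
  · have hr := exp_neg_half_mem h.radius_pos ht
    have hd := ((hU1.contDiffAt (isOpen_Ioo.mem_nhds hr)).differentiableAt
      (by norm_num)).hasDerivAt
    refine (((hd.comp t (he t)).fun_mul (he t)).const_mul (-(1 / 2))).congr_deriv ?_
    have e1 := laplacian_radial h.contDiffOn hr
    have hx : ‖(EuclideanSpace.single 0 (Real.exp (-t / 2)) : EuclideanSpace ℝ (Fin 2))‖ =
        Real.exp (-t / 2) := by
      rw [PiLp.norm_single, Real.norm_of_nonneg hr.1.le]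
    have e2 := h.equation (EuclideanSpace.single 0 (Real.exp (-t / 2)))
      (norm_pos_iff.1 (by rw [hx]; exact hr.1)) (by rw [hx]; exact hr.2)
    rw [e1, hx] at e2
    rw [← e2]
    have e3 : Real.exp (-t) = Real.exp (-t / 2) * Real.exp (-t / 2) := by
      rw [← Real.exp_add]; congr 1; ring
    have := hr.1.ne'
    simp only [Function.comp]
    rw [e3]
    field_simp
    ring
  · exact h.nonneg _ (exp_neg_half_mem h.radius_pos ht)
  · exact tendsto_nhdsGT_iff.1 h.singular

/-- Two solutions that agree near infinity agree wherever both are defined: the equation is a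
first-order system with a locally Lipschitz right-hand side. -/
theorem IsLogSolution.eq_of_eventuallyEq {f u u₁ v v₁ : ℝ → ℝ} {T : ℝ} (hf : PositiveC1 f)
    (hu : IsLogSolution f T u u₁) (hv : IsLogSolution f T v v₁) (h : u =ᶠ[atTop] v)
    {t : ℝ} (ht : T < t) : u t = v t := by
  obtain ⟨b, hb⟩ := eventually_atTop.1 h
  obtain ⟨a, haT, hat⟩ := exists_between ht
  set b' := max b t + 1 with hb'
  have hbb : b < b' := by have := le_max_left b t; linarith
  have htb : t < b' := by have := le_max_right b t; linarith
  have hab : a < b' + 1 := by linarith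
  have hcu : ContinuousOn u (Icc a (b' + 1)) := fun x hx =>
    (hu.hasDerivAt x (haT.trans_le hx.1)).continuousAt.continuousWithinAt
  have hcv : ContinuousOn v (Icc a (b' + 1)) := fun x hx =>
    (hv.hasDerivAt x (haT.trans_le hx.1)).continuousAt.continuousWithinAt
  obtain ⟨M, hM⟩ := isCompact_Icc.bddAbove_image hcu
  obtain ⟨M', hM'⟩ := isCompact_Icc.bddAbove_image hcv
  obtain ⟨L, hL⟩ := ContDiffOn.exists_lipschitzOnWith
    (hf.1.mono (Icc_subset_Ici_self : Icc 0 (max M M') ⊆ Ici 0)) one_ne_zero (convex_Icc _ _)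
    isCompact_Icc
  set V : ℝ → ℝ × ℝ → ℝ × ℝ := fun t p => (p.2, -(1 / 4 * Real.exp (-t) * f p.1)) with hV
  set S : Set (ℝ × ℝ) := {p | p.1 ∈ Icc 0 (max M M')} with hS
  set C : ℝ := 1 + 1 / 4 * Real.exp (-a) * L with hC
  have hC0 : 0 ≤ C := by positivity
  have hlip : ∀ t ∈ Ioo a (b' + 1), LipschitzOnWith ⟨C, hC0⟩ (V t) S := fun t ht => by
    refine LipschitzOnWith.of_dist_le_mul fun p hp p' hp' => ?_
    have h1 := hL.dist_le_mul p.1 hp p'.1 hp'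
    have h2 : dist p.1 p'.1 ≤ dist p p' := le_max_left _ _
    have h3 : dist p.2 p'.2 ≤ dist p p' := le_max_right _ _
    have h4 : Real.exp (-t) ≤ Real.exp (-a) := Real.exp_le_exp.2 (by linarith [ht.1])
    have hpp : 0 ≤ dist p p' := dist_nonneg
    refine max_le ?_ ?_
    · refine h3.trans (le_mul_of_one_le_left hpp ?_)
      have : 0 ≤ 1 / 4 * Real.exp (-a) * (L : ℝ) := by positivity
      change 1 ≤ C
      linarith
    · simp only [hV]
      rw [dist_neg_neg, Real.dist_eq, ← mul_sub, abs_mul, abs_of_pos (by positivity),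
        ← Real.dist_eq]
      calc _ ≤ 1 / 4 * Real.exp (-a) * (L * dist p p') := by gcongr; exact h1.trans (by gcongr)
        _ ≤ C * dist p p' := by rw [hC]; nlinarith
  have hmem : ∀ x ∈ Ioo a (b' + 1), u x ∈ Icc 0 (max M M') ∧ v x ∈ Icc 0 (max M M') :=
    fun x hx => ⟨⟨hu.nonneg x (haT.trans hx.1),
      (hM (mem_image_of_mem u ⟨hx.1.le, hx.2.le⟩)).trans (le_max_left _ _)⟩,
      ⟨hv.nonneg x (haT.trans hx.1),
      (hM' (mem_image_of_mem v ⟨hx.1.le, hx.2.le⟩)).trans (le_max_right _ _)⟩⟩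
  have hderiv : u₁ b' = v₁ b' := by
    refine (hu.hasDerivAt b' (by linarith)).unique
      ((hv.hasDerivAt b' (by linarith)).congr_of_eventuallyEq ?_)
    filter_upwards [Ioi_mem_nhds hbb] with x hx using hb x (le_of_lt hx)
  have := ODE_solution_unique_of_mem_Ioo (v := V) (s := fun _ => S) hlip
    (t₀ := b') ⟨by linarith, by linarith⟩ (f := fun t => (u t, u₁ t)) (g := fun t => (v t, v₁ t))
    (fun x hx => ⟨(hu.hasDerivAt x (haT.trans hx.1)).prodMk (hu.hasDerivAt' x (haT.trans hx.1)),
      (hmem x hx).1⟩)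
    (fun x hx => ⟨(hv.hasDerivAt x (haT.trans hx.1)).prodMk (hv.hasDerivAt' x (haT.trans hx.1)),
      (hmem x hx).2⟩)
    (by rw [hderiv, hb b' hbb.le])
  exact congrArg Prod.fst (this (show t ∈ Ioo a (b' + 1) from ⟨hat, by linarith⟩))

lemma IsLogSolution.mono {f u u₁ : ℝ → ℝ} {T T' : ℝ} (h : IsLogSolution f T u u₁) (hT : T ≤ T') :
    IsLogSolution f T' u u₁ :=
  ⟨fun t ht => h.hasDerivAt t (hT.trans_lt ht), fun t ht => h.hasDerivAt' t (hT.trans_lt ht),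
    fun t ht => h.nonneg t (hT.trans_lt ht), h.tendsto⟩

/-! ### Energy estimates -/

lemma rpow_neg_half_shift_isBigO (c : ℝ) :
    (fun t : ℝ => (t + c) ^ (-(1 / 2) : ℝ)) =O[atTop] fun t => t ^ (-(1 / 2) : ℝ) := by
  refine IsBigO.of_bound ((1 / 2 : ℝ) ^ (-(1 / 2) : ℝ)) ?_
  filter_upwards [eventually_gt_atTop (2 * |c|), eventually_gt_atTop 0] with t ht ht0
  have h1 : 1 / 2 * t ≤ t + c := by linarith [neg_abs_le c]
  rw [Real.norm_of_nonneg (Real.rpow_nonneg (by linarith) _),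
    Real.norm_of_nonneg (Real.rpow_nonneg ht0.le _), ← Real.mul_rpow (by norm_num) ht0.le]
  exact Real.rpow_le_rpow_of_nonpos (by positivity) h1 (by norm_num)

lemma one_div_isLittleO_rpow_neg_half :
    (fun t : ℝ => 1 / t) =o[atTop] fun t => t ^ (-(1 / 2) : ℝ) :=
  one_div_isBigO_log_div.trans_isLittleO log_div_isLittleO_rpow_neg_half

/-- A one-sided Landau inequality: if `η'' ≥ -C / t` and `η = o(t^{-1/2})`, then `η' = o(t^{-1/2})`.
Indeed `η'(t)` is at most the mean of `η'` over `[t, t + 1]`, and at least that over `[t - 1, t]`,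
up to `O(1 / t)`. -/
lemma landau_one_sided {η Y Y' : ℝ → ℝ} {C : ℝ} (hC : 0 ≤ C)
    (hη : ∀ᶠ t in atTop, HasDerivAt η (Y t) t) (hY : ∀ᶠ t in atTop, HasDerivAt Y (Y' t) t)
    (hb : ∀ᶠ t in atTop, -(C / t) ≤ Y' t)
    (h0 : η =o[atTop] fun t => t ^ (-(1 / 2) : ℝ)) :
    Y =o[atTop] fun t => t ^ (-(1 / 2) : ℝ) := by
  obtain ⟨T, hT⟩ := eventually_atTop.1 (hη.and (hY.and (hb.and (eventually_gt_atTop 0))))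
  have key : ∀ t ≥ T, ∀ s, t ≤ s → s ≤ t + 1 → Y t - C / t ≤ Y s := fun t ht s hts hs => by
    have ht0 : 0 < t := (hT t ht).2.2.2
    have m : MonotoneOn (fun s => Y s + C / t * s) (Ici t) :=
      monotoneOn_Ici_of_hasDerivAt
        (fun x hx => (hT x (ht.le.trans hx)).2.1.add ((hasDerivAt_id x).const_mul (C / t)))
        fun x hx => by
          have e1 := (hT x (ht.le.trans hx)).2.2.1
          have e2 : C / x ≤ C / t := by gcongr
          simp only [mul_one]; linarith
    have := m (mem_Ici.2 le_rfl) (mem_Ici.2 hts) hts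
    simp only at this
    have e : C / t * (s - t) ≤ C / t * 1 := by gcongr; linarith
    linarith
  have hup : ∀ᶠ t in atTop, Y t ≤ (η (t + 1) - η t) + C * (1 / t) := by
    filter_upwards [eventually_ge_atTop T] with t ht
    obtain ⟨ξ, hξ, e⟩ := exists_hasDerivAt_eq_slope η Y (lt_add_one t)
      (fun x hx => (hT x (ht.trans hx.1)).1.continuousAt.continuousWithinAt)
      (fun x hx => (hT x (ht.trans hx.1.le)).1)
    have := key t ht ξ hξ.1.le hξ.2.le
    rw [e, add_sub_cancel_left, div_one] at this
    rw [mul_one_div]; linarith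
  have hlow : ∀ᶠ t in atTop, (η t - η (t + -1)) - 2 * C * (1 / t) ≤ Y t := by
    filter_upwards [eventually_ge_atTop (T + 1), eventually_ge_atTop 2] with t ht ht2
    have ht' : T ≤ t + -1 := by linarith
    obtain ⟨ξ, hξ, e⟩ := exists_hasDerivAt_eq_slope η Y (show t + -1 < t by linarith)
      (fun x hx => (hT x (ht'.trans hx.1)).1.continuousAt.continuousWithinAt)
      (fun x hx => (hT x (ht'.trans hx.1.le)).1)
    have h1 := key ξ (ht'.trans hξ.1.le) t hξ.2.le (by linarith [hξ.1])
    rw [e, show t - (t + -1) = 1 by ring, div_one] at h1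
    have h2 : C / ξ ≤ 2 * C * (1 / t) := by
      calc C / ξ ≤ C / (t / 2) := by gcongr; linarith [hξ.1]
        _ = _ := by field_simp
    linarith
  have hs1 : (fun t => η (t + 1)) =o[atTop] fun t => t ^ (-(1 / 2) : ℝ) :=
    (h0.comp_tendsto (tendsto_atTop_add_const_right _ 1 tendsto_id)).trans_isBigO
      (rpow_neg_half_shift_isBigO 1)
  have hs2 : (fun t => η (t + -1)) =o[atTop] fun t => t ^ (-(1 / 2) : ℝ) :=
    (h0.comp_tendsto (tendsto_atTop_add_const_right _ (-1) tendsto_id)).trans_isBigO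
      (rpow_neg_half_shift_isBigO (-1))
  have hU := (hs1.sub h0).add (one_div_isLittleO_rpow_neg_half.const_mul_left C)
  have hL := (h0.sub hs2).sub (one_div_isLittleO_rpow_neg_half.const_mul_left (2 * C))
  refine IsLittleO.of_bound fun c hc => ?_
  filter_upwards [hup, hlow, hU.bound hc, hL.bound hc] with t h1 h2 h3 h4
  rw [Real.norm_eq_abs] at h3 h4 ⊢
  exact abs_le.2 ⟨by linarith [(abs_le.1 h4).1], by linarith [(abs_le.1 h3).2]⟩

lemma sq_div_four_le_exp {x : ℝ} (hx : |x| ≤ 1) : x ^ 2 / 4 ≤ Real.exp x - 1 - x := by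
  have h1 := Real.add_one_le_exp (x / 2)
  have h2 : Real.exp x = Real.exp (x / 2) * Real.exp (x / 2) := by
    rw [← Real.exp_add]; congr 1; ring
  have h3 := (abs_le.1 hx).1
  nlinarith

lemma tendsto_mul_sq_of_isLittleO {Y : ℝ → ℝ} (h : Y =o[atTop] fun t => t ^ (-(1 / 2) : ℝ)) :
    Tendsto (fun t => t * Y t ^ 2) atTop (𝓝 0) := by
  have h1 := (h.pow two_pos).mul_isBigO (isBigO_refl (fun t : ℝ => t) atTop)
  have h2 : (fun t => Y t ^ 2 * t) =o[atTop] fun _ => (1 : ℝ) := by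
    refine h1.congr' EventuallyEq.rfl ?_
    filter_upwards [eventually_gt_atTop 0] with t ht
    rw [← Real.rpow_natCast, ← Real.rpow_mul ht.le]
    norm_num
    rw [Real.rpow_neg_one]
    field_simp
  exact ((isLittleO_one_iff ℝ).1 h2).congr fun t => mul_comm _ _

/-- Decay of the system `N' = Y - δ`, `A Y' = (1 + Y)² - e^N` with `A` comparable to `t`. The
energy `A Y² / 2 + (e^N - 1 - N)` can only decrease through the forcing `δ = O(t⁻²)`, so as it
vanishes at infinity it is `O(t⁻²)`. -/
theorem energy_decay {N Y A a δ : ℝ → ℝ} {C c₁ c₂ : ℝ} (hc₁ : 0 < c₁)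
    (hN : ∀ᶠ t in atTop, HasDerivAt N (Y t - δ t) t)
    (hY : ∀ᶠ t in atTop, HasDerivAt Y (1 / A t * ((1 + Y t) ^ 2 - Real.exp (N t))) t)
    (hA : ∀ᶠ t in atTop, HasDerivAt A (a t) t)
    (hδ : ∀ᶠ t in atTop, |δ t| ≤ C / t ^ 2)
    (hA₁ : ∀ᶠ t in atTop, c₁ * t ≤ A t) (hA₂ : ∀ᶠ t in atTop, A t ≤ c₂ * t)
    (ha : ∀ᶠ t in atTop, -1 ≤ a t)
    (hN0 : Tendsto N atTop (𝓝 0)) (hY0 : Y =o[atTop] fun t => t ^ (-(1 / 2) : ℝ)) :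
    N =O[atTop] (fun t => 1 / t) ∧ Y =O[atTop] fun t => t ^ (-(3 / 2) : ℝ) := by
  have hYlim : Tendsto Y atTop (𝓝 0) := hY0.trans_tendsto tendsto_rpow_neg_half
  have hYsq := tendsto_mul_sq_of_isLittleO hY0
  have hNabs : ∀ᶠ t in atTop, |N t| ≤ 1 := by
    have := hN0.abs
    rw [abs_zero] at this
    exact this.eventually (ge_mem_nhds zero_lt_one)
  have hC : 0 ≤ C := by
    obtain ⟨t, h1, h2⟩ := (hδ.and (eventually_gt_atTop 0)).exists
    by_contra hneg
    push Not at hneg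
    have h3 := (abs_nonneg _).trans h1
    have : C / t ^ 2 < 0 := div_neg_of_neg_of_pos hneg (by positivity)
    linarith
  set D := 2 * C + 1 with hD
  -- The summand `t⁻²` keeps the energy away from zero, so that its square root is differentiable.
  set G : ℝ → ℝ := fun t =>
    A t * Y t ^ 2 / 2 + (Real.exp (N t) - 1 - N t) + (t ^ 2)⁻¹ with hG
  obtain ⟨T, hT⟩ := eventually_atTop.1 (hN.and (hY.and (hA.and (hδ.and (hA₁.and (ha.and
    (hNabs.and ((eventually_gt_atTop 0).and
      (hYlim.eventually (lt_mem_nhds (show (-1 : ℝ) < 0 by norm_num)))))))))))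
  have hAY : ∀ t ≥ T, 0 ≤ A t * Y t ^ 2 / 2 := fun t ht => by
    obtain ⟨-, -, -, -, h5, -, -, h8, -⟩ := hT t ht
    have : 0 ≤ A t := le_trans (by positivity) h5
    positivity
  have hGN : ∀ t ≥ T, N t ^ 2 / 4 ≤ G t := fun t ht => by
    obtain ⟨-, -, -, -, -, -, h7, h8, -⟩ := hT t ht
    have e1 := hAY t ht
    have e2 := sq_div_four_le_exp h7
    have e3 : 0 ≤ (t ^ 2)⁻¹ := by positivity
    simp only [hG]; linarith
  have hGt : ∀ t ≥ T, (t ^ 2)⁻¹ ≤ G t := fun t ht => by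
    obtain ⟨-, -, -, -, -, -, h7, h8, -⟩ := hT t ht
    have e1 := hAY t ht
    have e2 := sq_div_four_le_exp h7
    have e3 := sq_nonneg (N t)
    simp only [hG]; linarith
  have hGpos : ∀ t ≥ T, 0 < G t := fun t ht => by
    have := (hT t ht).2.2.2.2.2.2.2.1
    exact lt_of_lt_of_le (by positivity) (hGt t ht)
  have hNle : ∀ t ≥ T, |N t| ≤ 2 * √(G t) := fun t ht => by
    have := Real.abs_le_sqrt (show N t ^ 2 ≤ 4 * G t by linarith [hGN t ht])
    rwa [Real.sqrt_mul (by norm_num), show (4 : ℝ) = 2 ^ 2 by norm_num,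
      Real.sqrt_sq (by norm_num)] at this
  have htle : ∀ t ≥ T, 1 / t ≤ √(G t) := fun t ht => by
    have := (hT t ht).2.2.2.2.2.2.2.1
    refine Real.le_sqrt_of_sq_le (le_trans (le_of_eq ?_) (hGt t ht))
    simp
  have hmono : MonotoneOn (fun t => √(G t) - D * t⁻¹) (Ici T) := by
    refine monotoneOn_Ici_of_hasDerivAt
      (φ' := fun t => (Y t ^ 2 * (2 + Y t + a t / 2) - (Real.exp (N t) - 1) * δ t - 2 / t ^ 3) /
        (2 * √(G t)) + D / t ^ 2) (fun t ht => ?_) fun t ht => ?_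
    · obtain ⟨h1, h2, h3, -, h5, -, -, h8, -⟩ := hT t ht
      have hA0 : A t ≠ 0 := (lt_of_lt_of_le (by positivity) h5).ne'
      have hd : HasDerivAt G
          (Y t ^ 2 * (2 + Y t + a t / 2) - (Real.exp (N t) - 1) * δ t - 2 / t ^ 3) t := by
        refine ((((h3.fun_mul (h2.fun_pow 2)).div_const 2).fun_add
          ((h1.exp.sub_const 1).fun_sub h1)).fun_add
          (((hasDerivAt_id t).fun_pow 2).fun_inv (pow_ne_zero 2 h8.ne'))).congr_deriv ?_
        simp only [id]
        field_simp
        ring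
      refine ((hd.sqrt (hGpos t ht).ne').fun_sub
        ((hasDerivAt_inv h8.ne').const_mul D)).congr_deriv ?_
      ring
    · obtain ⟨-, -, -, h4, -, h6, h7, h8, h9⟩ := hT t ht
      have hs : 0 < √(G t) := Real.sqrt_pos.2 (hGpos t ht)
      have e1 : 0 ≤ Y t ^ 2 * (2 + Y t + a t / 2) :=
        mul_nonneg (sq_nonneg _) (by linarith)
      have e2 : |(Real.exp (N t) - 1) * δ t| ≤ 4 * √(G t) * (C / t ^ 2) := by
        rw [abs_mul]
        refine mul_le_mul ?_ h4 (abs_nonneg _) (by positivity)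
        have := Real.abs_exp_sub_one_le h7
        linarith [hNle t ht]
      have e3 : 2 / t ^ 3 ≤ 2 * √(G t) / t ^ 2 := by
        calc 2 / t ^ 3 = 2 * (1 / t) / t ^ 2 := by field_simp
          _ ≤ _ := by gcongr; exact htle t ht
      have e4 := (abs_le.1 e2).2
      have e5 : -(D / t ^ 2 * (2 * √(G t))) ≤
          Y t ^ 2 * (2 + Y t + a t / 2) - (Real.exp (N t) - 1) * δ t - 2 / t ^ 3 := by
        have : D / t ^ 2 * (2 * √(G t)) = 4 * √(G t) * (C / t ^ 2) + 2 * √(G t) / t ^ 2 := by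
          rw [hD]; ring
        linarith
      have e6 : -(D / t ^ 2) ≤ (Y t ^ 2 * (2 + Y t + a t / 2) - (Real.exp (N t) - 1) * δ t -
          2 / t ^ 3) / (2 * √(G t)) := by
        rw [le_div_iff₀ (by positivity)]; linarith
      linarith
  have hGlim : Tendsto G atTop (𝓝 0) := by
    have l1 : Tendsto (fun t => A t * Y t ^ 2 / 2) atTop (𝓝 0) := by
      refine squeeze_zero' (g := fun t => c₂ / 2 * (t * Y t ^ 2)) ?_ ?_
        (by simpa using hYsq.const_mul (c₂ / 2))
      · filter_upwards [eventually_ge_atTop T] with t ht using hAY t ht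
      · filter_upwards [hA₂] with t ht
        calc A t * Y t ^ 2 / 2 ≤ c₂ * t * Y t ^ 2 / 2 := by gcongr
          _ = _ := by ring
    have l2 : Tendsto (fun t => Real.exp (N t) - 1 - N t) atTop (𝓝 0) := by
      have := (((Real.continuous_exp.tendsto 0).comp hN0).sub_const 1).sub hN0
      simpa using this
    have l3 : Tendsto (fun t : ℝ => (t ^ 2)⁻¹) atTop (𝓝 0) :=
      (tendsto_pow_atTop two_ne_zero).inv_tendsto_atTop
    simpa using (l1.add l2).add l3
  have hfin : ∀ t ≥ T, √(G t) ≤ D * t⁻¹ := fun t ht => by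
    have hl : Tendsto (fun t => √(G t) - D * t⁻¹) atTop (𝓝 0) := by
      have := (Real.continuous_sqrt.tendsto 0).comp hGlim
      rw [Real.sqrt_zero] at this
      simpa using this.sub (tendsto_inv_atTop_zero.const_mul D)
    have := le_of_monotoneOn_of_tendsto hmono hl ht
    linarith
  constructor
  · refine IsBigO.of_bound (2 * D) ?_
    filter_upwards [eventually_ge_atTop T, eventually_gt_atTop 0] with t ht ht0
    rw [Real.norm_eq_abs, Real.norm_of_nonneg (by positivity), one_div]
    linarith [hNle t ht, hfin t ht]
  · refine IsBigO.of_bound (√(2 * D ^ 2 / c₁)) ?_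
    filter_upwards [eventually_ge_atTop T] with t ht
    obtain ⟨-, -, -, -, h5, -, h7, h8, -⟩ := hT t ht
    rw [Real.norm_eq_abs, Real.norm_of_nonneg (Real.rpow_nonneg h8.le _)]
    have e1 : A t * Y t ^ 2 / 2 ≤ D ^ 2 * (t⁻¹) ^ 2 := by
      have e2 := sq_div_four_le_exp h7
      have e3 := sq_nonneg (N t)
      have e4 : 0 ≤ (t ^ 2)⁻¹ := by positivity
      have e5 : G t ≤ (D * t⁻¹) ^ 2 := (Real.sqrt_le_left (by positivity)).1 (hfin t ht)
      rw [mul_pow] at e5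
      simp only [hG] at e5; linarith
    have e6 : c₁ * t * Y t ^ 2 ≤ A t * Y t ^ 2 := by gcongr
    have e7 : Y t ^ 2 ≤ 2 * D ^ 2 / c₁ * (t ^ (-(3 / 2) : ℝ)) ^ 2 := by
      have : (t ^ (-(3 / 2) : ℝ)) ^ 2 = (t ^ 3)⁻¹ := by
        rw [← Real.rpow_natCast, ← Real.rpow_mul h8.le, ← Real.rpow_natCast, ← Real.rpow_neg h8.le]
        norm_num
      rw [this]
      have e8 : c₁ * t * Y t ^ 2 ≤ 2 * (D ^ 2 * (t⁻¹) ^ 2) := by linarith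
      calc Y t ^ 2 = c₁ * t * Y t ^ 2 / (c₁ * t) := by field_simp
        _ ≤ 2 * (D ^ 2 * (t⁻¹) ^ 2) / (c₁ * t) := by gcongr
        _ = _ := by field_simp
    have := Real.abs_le_sqrt e7
    rwa [Real.sqrt_mul (by positivity), Real.sqrt_sq (Real.rpow_nonneg h8.le _)] at this

/-- A solution of `A v'' + (1 + e) v = 0`, with `A` increasing and comparable to `t` and
`e = O(1 / t)`, vanishes if its energy `A v'² + v²` tends to zero: up to an integrable rate
`O(t^{-3/2})` the energy does not decrease. -/
theorem eq_zero_of_energy {v v₁ A a e : ℝ → ℝ} {C c₁ c₂ : ℝ} (hc₁ : 0 < c₁)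
    (hv : ∀ᶠ t in atTop, HasDerivAt v (v₁ t) t)
    (hv₁ : ∀ᶠ t in atTop, HasDerivAt v₁ (-((1 + e t) / A t * v t)) t)
    (hA : ∀ᶠ t in atTop, HasDerivAt A (a t) t) (ha : ∀ᶠ t in atTop, 0 ≤ a t)
    (he : ∀ᶠ t in atTop, |e t| ≤ C / t)
    (hA₁ : ∀ᶠ t in atTop, c₁ * t ≤ A t) (hA₂ : ∀ᶠ t in atTop, A t ≤ c₂ * t)
    (h0 : Tendsto v atTop (𝓝 0)) (h1 : Tendsto (fun t => t * v₁ t ^ 2) atTop (𝓝 0)) :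
    ∀ᶠ t in atTop, v t = 0 := by
  -- The bound `|2 e v v'| ≤ D t^{-3/2} G` for the energy `G` below, by `2 √A |v v'| ≤ G`.
  set D := C / √c₁ with hD
  obtain ⟨T, hT⟩ := eventually_atTop.1 (hv.and (hv₁.and (hA.and (ha.and (he.and (hA₁.and
    (eventually_gt_atTop 0)))))))
  set G : ℝ → ℝ := fun t => A t * v₁ t ^ 2 + v t ^ 2 with hG
  have hmono : MonotoneOn (fun t => G t * Real.exp (-(2 * D * t ^ (-(1 / 2) : ℝ)))) (Ici T) := by
    refine monotoneOn_Ici_of_hasDerivAt (φ' := fun t =>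
      (a t * v₁ t ^ 2 - 2 * e t * v t * v₁ t + D * t ^ (-(3 / 2) : ℝ) * G t) *
        Real.exp (-(2 * D * t ^ (-(1 / 2) : ℝ)))) (fun t ht => ?_) fun t ht => ?_
    · obtain ⟨k1, k2, k3, -, -, k6, k7⟩ := hT t ht
      have hA0 : A t ≠ 0 := (lt_of_lt_of_le (by positivity) k6).ne'
      have hd : HasDerivAt G (a t * v₁ t ^ 2 - 2 * e t * v t * v₁ t) t := by
        refine ((k3.fun_mul (k2.fun_pow 2)).fun_add (k1.fun_pow 2)).congr_deriv ?_
        field_simp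
        ring
      have hr : HasDerivAt (fun t : ℝ => t ^ (-(1 / 2) : ℝ)) (-(1 / 2) * t ^ (-(3 / 2) : ℝ)) t := by
        refine (Real.hasDerivAt_rpow_const (p := -(1 / 2)) (Or.inl k7.ne')).congr_deriv ?_
        norm_num
      refine (hd.fun_mul (hr.const_mul (2 * D)).fun_neg.exp).congr_deriv ?_
      ring
    · obtain ⟨-, -, -, k4, k5, k6, k7⟩ := hT t ht
      refine mul_nonneg ?_ (Real.exp_pos _).le
      have hApos : 0 < A t := lt_of_lt_of_le (by positivity) k6
      have hC0 : 0 ≤ C / t := (abs_nonneg _).trans k5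
      have s1 : √c₁ * √t ≤ √(A t) := by
        rw [← Real.sqrt_mul hc₁.le]; exact Real.sqrt_le_sqrt k6
      have hsc : 0 < √c₁ := Real.sqrt_pos.2 hc₁
      have hst : 0 < √t := Real.sqrt_pos.2 k7
      have e1 : 2 * (√c₁ * √t) * (|v t| * |v₁ t|) ≤ G t := by
        have e2 : 2 * √(A t) * (|v t| * |v₁ t|) ≤ G t := by
          have e3 := sq_nonneg (√(A t) * |v₁ t| - |v t|)
          have e4 : √(A t) ^ 2 = A t := Real.sq_sqrt hApos.le
          have e5 : (√(A t) * |v₁ t| - |v t|) ^ 2 =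
              A t * v₁ t ^ 2 + v t ^ 2 - 2 * √(A t) * (|v t| * |v₁ t|) := by
            rw [sub_sq, mul_pow, e4, sq_abs, sq_abs]; ring
          simp only [hG]; linarith
        refine le_trans ?_ e2
        gcongr
      have e6 : |2 * e t * v t * v₁ t| ≤ D * t ^ (-(3 / 2) : ℝ) * G t := by
        have e7 : t ^ (-(3 / 2) : ℝ) = 1 / (t * √t) := by
          rw [Real.sqrt_eq_rpow, ← Real.rpow_one_add' k7.le (by norm_num), one_div,
            ← Real.rpow_neg k7.le]
          norm_num
        rw [abs_mul, abs_mul, abs_mul, abs_two, e7, hD]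
        calc 2 * |e t| * |v t| * |v₁ t| ≤ 2 * (C / t) * |v t| * |v₁ t| := by gcongr
          _ = C / t / (√c₁ * √t) * (2 * (√c₁ * √t) * (|v t| * |v₁ t|)) := by field_simp
          _ ≤ C / t / (√c₁ * √t) * G t := by gcongr
          _ = _ := by field_simp
      have e8 := (abs_le.1 e6).2
      have e9 : 0 ≤ a t * v₁ t ^ 2 := mul_nonneg k4 (sq_nonneg _)
      linarith
  have hlim : Tendsto (fun t => G t * Real.exp (-(2 * D * t ^ (-(1 / 2) : ℝ)))) atTop (𝓝 0) := by
    have l1 : Tendsto (fun t => A t * v₁ t ^ 2) atTop (𝓝 0) := by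
      refine squeeze_zero' (g := fun t => c₂ * (t * v₁ t ^ 2)) ?_ ?_
        (by simpa using h1.const_mul c₂)
      · filter_upwards [eventually_ge_atTop T] with t ht
        obtain ⟨-, -, -, -, -, k6, k7⟩ := hT t ht
        have hApos : 0 < A t := lt_of_lt_of_le (by positivity) k6
        positivity
      · filter_upwards [hA₂] with t ht
        calc A t * v₁ t ^ 2 ≤ c₂ * t * v₁ t ^ 2 := by gcongr
          _ = _ := by ring
    have l2 : Tendsto G atTop (𝓝 0) := by simpa using l1.add (h0.pow 2)
    have l3 : Tendsto (fun t : ℝ => Real.exp (-(2 * D * t ^ (-(1 / 2) : ℝ)))) atTop (𝓝 1) := by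
      have := (tendsto_rpow_neg_half.const_mul (2 * D)).neg
      rw [mul_zero, neg_zero] at this
      simpa [Function.comp_def] using (Real.continuous_exp.tendsto 0).comp this
    simpa using l2.mul l3
  filter_upwards [eventually_ge_atTop T] with t ht
  obtain ⟨-, -, -, -, -, k6, k7⟩ := hT t ht
  have hApos : 0 < A t := lt_of_lt_of_le (by positivity) k6
  have e1 := le_of_monotoneOn_of_tendsto hmono hlim ht
  have e2 : G t ≤ 0 := nonpos_of_mul_nonpos_left e1 (Real.exp_pos _)
  have e3 : 0 ≤ A t * v₁ t ^ 2 := by positivity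
  have e4 : v t ^ 2 ≤ 0 := by simp only [hG] at e2; linarith
  exact pow_eq_zero_iff two_ne_zero |>.1 (le_antisymm e4 (sq_nonneg _))

/-! ### The normalised unknown -/

/-- `κ = 1 + H - D H / H`, so that `Ψ = g + log g + log g' - log H` has `Ψ' = g' (1 + κ / g)`. -/
def phaseKappa (g : ℝ → ℝ) (s : ℝ) : ℝ :=
  1 + growthH g s - scaledDeriv g (growthH g) s / growthH g s

/-- `m = 1 + κ / g`. -/
def phaseM (g : ℝ → ℝ) (s : ℝ) : ℝ := 1 + phaseKappa g s * (1 / g s)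

/-- The first-order part `M` of the coefficient `P = H + M / g`. -/
def coeffM (g : ℝ → ℝ) (s : ℝ) : ℝ :=
  -(growthH g s * phaseKappa g s) / phaseM g s +
    (scaledDeriv g (phaseKappa g) s - phaseKappa g s) / (phaseM g s * phaseM g s)

/-- The coefficient `P = g Ψ'' / (Ψ')²`, where `Ψ' = g' m`. -/
def coeffP (g : ℝ → ℝ) (s : ℝ) : ℝ := growthH g s + coeffM g s * (1 / g s)

/-- The symbol `Λ` with `1 + Λ / g = P / (H m)`. -/
def coeffLambda (g : ℝ → ℝ) (s : ℝ) : ℝ :=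
  (coeffM g s - growthH g s * phaseKappa g s) / (growthH g s * phaseM g s)

/-- The shift `γ = log (1 + Λ / g)` of the equilibrium of the normalised equation, so that
`e^γ = P / (H m)`. -/
def phaseGamma (g : ℝ → ℝ) (s : ℝ) : ℝ := Real.log (1 + coeffLambda g s * (1 / g s))

namespace RegularGrowth

variable {g : ℝ → ℝ} {q : ℝ}

lemma symbol_tendsto_zero (R : RegularGrowth g q) {Φ : ℝ → ℝ} (h : IsSymbol g Φ) :
    Tendsto (fun s => Φ s * (1 / g s)) atTop (𝓝 0) := by
  obtain ⟨K, L, h⟩ := h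
  have h0 : Tendsto (fun s => K * (1 / g s)) atTop (𝓝 0) := by
    simpa using (tendsto_const_nhds (x := (1 : ℝ)).div_atTop R.tendsto).const_mul K
  refine squeeze_zero_norm' ?_ h0
  filter_upwards [h, R.tendsto.eventually_gt_atTop 0] with s h1 h2
  rw [norm_mul, Real.norm_eq_abs, Real.norm_of_nonneg (by positivity)]
  gcongr
  exact h1.2.1

lemma symbol_kappa (R : RegularGrowth g q) : IsSymbol g (phaseKappa g) := by
  obtain ⟨c, hc, h⟩ := R.growthH_pos
  exact ((IsSymbol.const 1).add R.symbol_zero).sub (R.symbol_one.div R.symbol_zero hc h)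

/-- `D κ` is a symbol, because it involves `H` only through `H`, `D H` and `D² H`. -/
lemma symbol_scaledDeriv_kappa (R : RegularGrowth g q) :
    IsSymbol g (scaledDeriv g (phaseKappa g)) := by
  obtain ⟨c, hc, h⟩ := R.growthH_pos
  have h1 := R.symbol_one.div R.symbol_zero hc h
  refine ((R.symbol_one.sub (R.symbol_two.div R.symbol_zero hc h)).add (h1.mul h1)).congr ?_
  obtain ⟨K, L, hK⟩ := R.symbol_zero
  obtain ⟨K₁, L₁, hK₁⟩ := R.symbol_one
  filter_upwards [hK, hK₁, h, R.deriv_pos] with s e1 e2 e3 e4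
  have hH : growthH g s ≠ 0 := (hc.trans_le e3).ne'
  have hd : HasDerivAt (phaseKappa g) _ s :=
    (e1.1.hasDerivAt.const_add 1).sub (e2.1.hasDerivAt.div e1.1.hasDerivAt hH)
  rw [scaledDeriv.eq_1 g (phaseKappa g), hd.deriv,
    scaledDeriv.eq_1 g (scaledDeriv g (growthH g))]
  have : scaledDeriv g (growthH g) s = g s / deriv g s * deriv (growthH g) s := rfl
  rw [this]
  field_simp
  ring

lemma symbol_phaseM (R : RegularGrowth g q) : IsSymbol g (phaseM g) :=
  (IsSymbol.const 1).add (R.symbol_kappa.mul R.symbol_inv)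

lemma tendsto_phaseM (R : RegularGrowth g q) : Tendsto (phaseM g) atTop (𝓝 1) := by
  have := (R.symbol_tendsto_zero R.symbol_kappa).const_add 1
  rwa [add_zero] at this

lemma phaseM_ge (R : RegularGrowth g q) : ∀ᶠ s in atTop, 1 / 2 ≤ phaseM g s :=
  R.tendsto_phaseM.eventually (le_mem_nhds (by norm_num))

lemma symbol_coeffM (R : RegularGrowth g q) : IsSymbol g (coeffM g) := by
  refine ((R.symbol_zero.mul R.symbol_kappa).neg.div R.symbol_phaseM (by norm_num) R.phaseM_ge).add
    ((R.symbol_scaledDeriv_kappa.sub R.symbol_kappa).div (R.symbol_phaseM.mul R.symbol_phaseM)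
      (c := 1 / 4) (by norm_num) ?_)
  filter_upwards [R.phaseM_ge] with s hs
  nlinarith

lemma symbol_coeffP (R : RegularGrowth g q) : IsSymbol g (coeffP g) :=
  R.symbol_zero.add (R.symbol_coeffM.mul R.symbol_inv)

lemma tendsto_coeffP (R : RegularGrowth g q) : Tendsto (coeffP g) atTop (𝓝 (1 / q)) := by
  have := R.tendsto_growthH.add (R.symbol_tendsto_zero R.symbol_coeffM)
  rwa [add_zero] at this

lemma symbol_coeffLambda (R : RegularGrowth g q) : IsSymbol g (coeffLambda g) := by
  obtain ⟨c, hc, h⟩ := R.growthH_pos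
  refine (R.symbol_coeffM.sub (R.symbol_zero.mul R.symbol_kappa)).div
    (R.symbol_zero.mul R.symbol_phaseM) (c := c * (1 / 2)) (by positivity) ?_
  filter_upwards [h, R.phaseM_ge] with s h1 h2
  gcongr
  exact hc.le.trans h1

/-- `D P → 0`, as `D (M / g) = (D M - M) / g` tends to zero and `D H → 0`. -/
lemma tendsto_scaledDeriv_coeffP (R : RegularGrowth g q) :
    Tendsto (scaledDeriv g (coeffP g)) atTop (𝓝 0) := by
  obtain ⟨K, L, hK⟩ := R.symbol_zero
  obtain ⟨K', L', hM⟩ := R.symbol_coeffM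
  have h0 : Tendsto (fun s => (L' + K') * (1 / g s)) atTop (𝓝 0) := by
    simpa using (tendsto_const_nhds (x := (1 : ℝ)).div_atTop R.tendsto).const_mul (L' + K')
  have h1 : Tendsto (fun s => scaledDeriv g (coeffP g) s - scaledDeriv g (growthH g) s)
      atTop (𝓝 0) := by
    refine squeeze_zero_norm' ?_ h0
    filter_upwards [hK, hM, R.differentiable, R.tendsto.eventually_gt_atTop 0, R.deriv_pos]
      with s e1 e2 e3 e4 e5
    have hd : HasDerivAt (coeffP g) (deriv (growthH g) s +
        (deriv (coeffM g) s * (1 / g s) + coeffM g s * (-(deriv g s) / g s ^ 2))) s :=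
      e1.1.hasDerivAt.add (e2.1.hasDerivAt.mul
        (by simpa only [one_div] using e3.hasDerivAt.fun_inv e4.ne'))
    have e6 : scaledDeriv g (coeffP g) s - scaledDeriv g (growthH g) s =
        (g s / deriv g s * deriv (coeffM g) s - coeffM g s) * (1 / g s) := by
      simp only [scaledDeriv, hd.deriv]
      field_simp
      ring
    rw [e6, norm_mul, Real.norm_eq_abs, Real.norm_of_nonneg (by positivity)]
    gcongr
    refine (abs_sub _ _).trans (add_le_add ?_ e2.2.1)
    rw [abs_mul, abs_of_pos (by positivity)]
    calc g s / deriv g s * |deriv (coeffM g) s| ≤ g s / deriv g s * (L' * (deriv g s / g s)) := by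
          gcongr; exact e2.2.2
      _ = L' := by field_simp
  simpa using h1.add R.tendsto_scaledDeriv

lemma coeffP_eq (R : RegularGrowth g q) : ∀ᶠ s in atTop,
    coeffP g s = growthH g s / phaseM g s +
        (scaledDeriv g (phaseKappa g) s - phaseKappa g s) / (g s * phaseM g s ^ 2) ∧
      growthH g s * phaseM g s * Real.exp (phaseGamma g s) = coeffP g s := by
  obtain ⟨c, hc, h⟩ := R.growthH_pos
  have hL := (R.symbol_tendsto_zero R.symbol_coeffLambda).eventually
    (lt_mem_nhds (show (-1 : ℝ) < 0 by norm_num))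
  filter_upwards [R.phaseM_ge, R.tendsto.eventually_gt_atTop 0, h, hL] with s h1 h2 h3 h4
  have hm : phaseM g s ≠ 0 := by linarith
  have hH : growthH g s ≠ 0 := by linarith
  have e1 : phaseKappa g s = (phaseM g s - 1) * g s := by
    rw [phaseM]; field_simp; ring
  constructor
  · rw [coeffP, coeffM]
    generalize scaledDeriv g (phaseKappa g) s = d
    rw [e1]
    field_simp
    ring
  · rw [phaseGamma, Real.exp_log (by linarith), coeffLambda, coeffP]
    have e2 : growthH g s * phaseM g s * (1 + (coeffM g s - growthH g s * phaseKappa g s) /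
        (growthH g s * phaseM g s) * (1 / g s)) = growthH g s * phaseM g s +
        (coeffM g s - growthH g s * phaseKappa g s) * (1 / g s) := by
      field_simp
    rw [e2, e1]
    field_simp
    ring

/-- `γ = O(1 / g)` and `γ' = O(g' / g²)`. -/
lemma phaseGamma_bound (R : RegularGrowth g q) : ∃ C, 0 ≤ C ∧ ∀ᶠ s in atTop,
    |phaseGamma g s| ≤ C / g s ∧ DifferentiableAt ℝ (phaseGamma g) s ∧
      |deriv (phaseGamma g) s| ≤ C * (deriv g s / g s ^ 2) := by
  obtain ⟨K, L, hL⟩ := R.symbol_coeffLambda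
  have hsmall := (R.symbol_tendsto_zero R.symbol_coeffLambda).abs
  rw [abs_zero] at hsmall
  refine ⟨2 * |K| + 2 * (|L| + |K|), by positivity, ?_⟩
  filter_upwards [hL, hsmall.eventually (ge_mem_nhds (show (0 : ℝ) < 1 / 2 by norm_num)),
    R.differentiable, R.tendsto.eventually_gt_atTop 0, R.deriv_pos] with s h1 h2 h3 h4 h5
  have hK := h1.2.1.trans (le_abs_self K)
  have hLb : |deriv (coeffLambda g) s| ≤ |L| * (deriv g s / g s) :=
    h1.2.2.trans (by gcongr; exact le_abs_self L)
  have hpos : 1 / 2 ≤ 1 + coeffLambda g s * (1 / g s) := by linarith [(abs_le.1 h2).1]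
  have hd : HasDerivAt (phaseGamma g) ((deriv (coeffLambda g) s * (1 / g s) +
      coeffLambda g s * (-(deriv g s) / g s ^ 2)) / (1 + coeffLambda g s * (1 / g s))) s :=
    ((h1.1.hasDerivAt.mul
      (by simpa only [one_div] using h3.hasDerivAt.fun_inv h4.ne')).const_add 1).log
        (by simp only [Pi.mul_apply]; linarith)
  refine ⟨?_, hd.differentiableAt, ?_⟩
  · have e1 := abs_log_le (x := 1 + coeffLambda g s * (1 / g s)) (by simpa using h2)
    rw [add_sub_cancel_left, abs_mul, abs_of_pos (by positivity : 0 < 1 / g s)] at e1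
    calc |phaseGamma g s| ≤ 2 * (|coeffLambda g s| * (1 / g s)) := e1
      _ ≤ 2 * (|K| * (1 / g s)) := by gcongr
      _ = 2 * |K| / g s := by ring
      _ ≤ _ := by gcongr; linarith [abs_nonneg K, abs_nonneg L]
  · rw [hd.deriv, abs_div, abs_of_pos (by linarith : 0 < 1 + coeffLambda g s * (1 / g s)),
      div_le_iff₀ (by linarith)]
    have e1 : |deriv (coeffLambda g) s * (1 / g s) + coeffLambda g s * (-(deriv g s) / g s ^ 2)| ≤
        (|L| + |K|) * (deriv g s / g s ^ 2) := by
      refine (abs_add_le _ _).trans ?_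
      rw [abs_mul, abs_mul, neg_div, abs_neg, abs_of_pos (by positivity : 0 < deriv g s / g s ^ 2),
        abs_of_pos (by positivity : 0 < 1 / g s)]
      calc _ ≤ |L| * (deriv g s / g s) * (1 / g s) + |K| * (deriv g s / g s ^ 2) := by gcongr
        _ = _ := by field_simp
    have e2 : 0 ≤ deriv g s / g s ^ 2 := by positivity
    have e3 := abs_nonneg K
    have e4 := abs_nonneg L
    calc _ ≤ (|L| + |K|) * (deriv g s / g s ^ 2) := e1
      _ ≤ (2 * |K| + 2 * (|L| + |K|)) * (deriv g s / g s ^ 2) * (1 / 2) := by nlinarith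
      _ ≤ _ := by gcongr

end RegularGrowth

section Dynamics

variable {f : ℝ → ℝ} {q T : ℝ} {u u₁ : ℝ → ℝ}

/-- The phase `Ψ = g + log g + log g' - log H - log 4`. The singular solution satisfies
`Ψ(u) = t + o(1)`. -/
def phase (g : ℝ → ℝ) (s : ℝ) : ℝ :=
  g s + Real.log (g s) + Real.log (deriv g s) - Real.log (growthH g s) - Real.log 4

lemma RegularGrowth.hasDerivAt_phase {g : ℝ → ℝ} (R : RegularGrowth g q) : ∀ᶠ s in atTop,
    HasDerivAt (phase g) (deriv g s * phaseM g s) s := by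
  obtain ⟨c, hc, h⟩ := R.growthH_pos
  obtain ⟨K, L, hK⟩ := R.symbol_zero
  filter_upwards [R.differentiable, R.second, R.deriv_pos, h, hK,
    R.tendsto.eventually_gt_atTop 0] with s h1 h2 h3 h4 h5 h6
  have hH : growthH g s ≠ 0 := (hc.trans_le h4).ne'
  refine ((((h1.hasDerivAt.add (h1.hasDerivAt.log h6.ne')).add (h2.log h3.ne')).sub
    (h5.1.hasDerivAt.log hH)).sub_const (Real.log 4)).congr_deriv ?_
  rw [phaseM, phaseKappa, scaledDeriv]
  field_simp
  ring

/-- `η = Ψ(u) - t`, the deviation of a solution from the approximate profile `Ψ(u) = t`. -/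
def deviation (g u : ℝ → ℝ) (t : ℝ) : ℝ := phase g (u t) - t

/-- The derivative `Ψ'(u) u' - 1` of `η`, with `u₁` in the place of `u'`. -/
def deviation' (g u u₁ : ℝ → ℝ) (t : ℝ) : ℝ := deriv g (u t) * phaseM g (u t) * u₁ t - 1

lemma IsLogSolution.hasDerivAt_deviation (hu : IsLogSolution f T u u₁)
    (R : RegularGrowth (logOf f) q) : ∀ᶠ t in atTop,
    HasDerivAt (deviation (logOf f) u) (deviation' (logOf f) u u₁ t) t := by
  filter_upwards [hu.tendsto.eventually R.hasDerivAt_phase, eventually_gt_atTop T] with t h1 h2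
  exact ((h1.comp t (hu.hasDerivAt t h2)).sub (hasDerivAt_id t))

lemma IsLogSolution.exp_deviation (hf : PositiveC1 f) (hu : IsLogSolution f T u u₁)
    (R : RegularGrowth (logOf f) q) : ∀ᶠ t in atTop,
    Real.exp (deviation (logOf f) u t) = f (u t) * Real.exp (-t) *
      (logOf f (u t) * deriv (logOf f) (u t) / (4 * growthH (logOf f) (u t))) := by
  set g := logOf f with hg
  obtain ⟨c, hc, hH⟩ := R.growthH_pos
  filter_upwards [hu.tendsto.eventually hH, hu.tendsto.eventually R.deriv_pos,
    hu.tendsto.eventually (R.tendsto.eventually_gt_atTop 0), eventually_gt_atTop T]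
    with t h5 h7 h8 h9
  rw [deviation, phase, show g (u t) + Real.log (g (u t)) + Real.log (deriv g (u t)) -
    Real.log (growthH g (u t)) - Real.log 4 - t = g (u t) + -t + (Real.log (g (u t)) +
    Real.log (deriv g (u t)) - Real.log (growthH g (u t)) - Real.log 4) by ring,
    Real.exp_add, Real.exp_add, Real.exp_sub, Real.exp_sub, Real.exp_add, Real.exp_log h8,
    Real.exp_log h7, Real.exp_log (hc.trans_le h5), Real.exp_log (by norm_num), hg,
    exp_logOf hf (hu.nonneg t h9)]
  field_simp

/-- The normalised equation `η'' = (P / g) ((1 + η')² - e^{η - γ})`. -/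
lemma IsLogSolution.hasDerivAt_deviation' (hf : PositiveC1 f) (hu : IsLogSolution f T u u₁)
    (R : RegularGrowth (logOf f) q) : ∀ᶠ t in atTop,
    HasDerivAt (deviation' (logOf f) u u₁)
      (1 / (logOf f (u t) / coeffP (logOf f) (u t)) *
        ((1 + deviation' (logOf f) u u₁ t) ^ 2 -
          Real.exp (deviation (logOf f) u t - phaseGamma (logOf f) (u t)))) t := by
  set g := logOf f with hg
  obtain ⟨c, hc, hH⟩ := R.growthH_pos
  obtain ⟨K, L, hκ⟩ := R.symbol_kappa
  filter_upwards [hu.tendsto.eventually R.second, hu.tendsto.eventually R.differentiable,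
    hu.tendsto.eventually hκ, hu.tendsto.eventually R.coeffP_eq, hu.tendsto.eventually hH,
    hu.tendsto.eventually R.phaseM_ge, hu.tendsto.eventually R.deriv_pos,
    hu.tendsto.eventually (R.tendsto.eventually_gt_atTop 0), eventually_gt_atTop T,
    hu.exp_deviation hf R] with t h1 h2 h3 ⟨h4, h4'⟩ h5 h6 h7 h8 h9 hexp
  have hHpos : 0 < growthH g (u t) := hc.trans_le h5
  have hm : 0 < phaseM g (u t) := by linarith
  have hmd : HasDerivAt (phaseM g) (deriv (phaseKappa g) (u t) * (1 / g (u t)) +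
      phaseKappa g (u t) * (-(deriv g (u t)) / g (u t) ^ 2)) (u t) :=
    (h3.1.hasDerivAt.mul
      (by simpa only [one_div] using h2.hasDerivAt.fun_inv h8.ne')).const_add 1
  have hu0 := hu.hasDerivAt t h9
  refine ((((h1.comp t hu0).fun_mul (hmd.comp t hu0)).fun_mul
    (hu.hasDerivAt' t h9)).sub_const 1).congr_deriv ?_
  have hPpos : 0 < coeffP g (u t) := by rw [← h4']; positivity
  -- The nonlinear term, with `e^γ = P / (H m)`.
  have e1 : coeffP g (u t) * Real.exp (deviation g u t - phaseGamma g (u t)) =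
      growthH g (u t) * phaseM g (u t) * Real.exp (deviation g u t) := by
    rw [Real.exp_sub, ← h4']
    field_simp
  -- The quadratic term.
  have e2 : coeffP g (u t) * (1 + deviation' g u u₁ t) ^ 2 =
      (growthH g (u t) * phaseM g (u t) + (scaledDeriv g (phaseKappa g) (u t) -
        phaseKappa g (u t)) / g (u t)) * (deriv g (u t) * u₁ t) ^ 2 := by
    rw [h4, deviation', add_sub_cancel]
    field_simp
  have e3 : 1 / (g (u t) / coeffP g (u t)) * ((1 + deviation' g u u₁ t) ^ 2 -
      Real.exp (deviation g u t - phaseGamma g (u t))) =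
      1 / g (u t) * (coeffP g (u t) * (1 + deviation' g u u₁ t) ^ 2 -
        coeffP g (u t) * Real.exp (deviation g u t - phaseGamma g (u t))) := by
    field_simp
  have hexp' : Real.exp (deviation g u t) = f (u t) * Real.exp (-t) *
      (g (u t) * deriv g (u t) / (4 * growthH g (u t))) := hexp
  rw [e3, e1, e2, hexp', scaledDeriv]
  simp only [Function.comp]
  field_simp
  ring

/-- Decay of the deviation: once `η = o(t^{-1/2})`, in fact `η = O(1 / t)` and `η' = O(t^{-3/2})`.
This is `energy_decay` for `N = η - γ`, `Y = η'`, `A = g / P`, `δ = γ'(u) u'`. -/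
theorem IsLogSolution.deviation_decay (hf : PositiveC1 f) (hu : IsLogSolution f T u u₁)
    (R : RegularGrowth (logOf f) q)
    (hw : (fun t => logOf f (u t) - t) =O[atTop] Real.log)
    (hη : deviation (logOf f) u =o[atTop] fun t => t ^ (-(1 / 2) : ℝ)) :
    deviation (logOf f) u =O[atTop] (fun t => 1 / t) ∧
      deviation' (logOf f) u u₁ =O[atTop] fun t => t ^ (-(3 / 2) : ℝ) := by
  set g := logOf f with hg
  have hq := R.q_pos
  have hη1 := hu.hasDerivAt_deviation R
  have hη2 := hu.hasDerivAt_deviation' hf R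
  have hdiv := tendsto_div_of_sub_isBigO_log hw
  have hwb : ∀ᶠ t in atTop, 0 < t ∧ 1 / 2 * t ≤ g (u t) ∧ g (u t) ≤ 2 * t := by
    filter_upwards [hdiv.eventually (lt_mem_nhds (show (1 / 2 : ℝ) < 1 by norm_num)),
      hdiv.eventually (gt_mem_nhds (show (1 : ℝ) < 2 by norm_num)), eventually_gt_atTop 0]
      with t e1 e2 e3
    rw [lt_div_iff₀ e3] at e1
    rw [div_lt_iff₀ e3] at e2
    exact ⟨e3, e1.le, e2.le⟩
  obtain ⟨C, hC, hγ⟩ := R.phaseGamma_bound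
  have hγO : (fun t => phaseGamma g (u t)) =O[atTop] fun t => 1 / t := by
    refine IsBigO.of_bound (2 * C) ?_
    filter_upwards [hu.tendsto.eventually hγ, hwb] with t e1 ⟨e2, e3, e4⟩
    rw [Real.norm_eq_abs, Real.norm_of_nonneg (by positivity)]
    calc _ ≤ C / g (u t) := e1.1
      _ ≤ C / (1 / 2 * t) := by gcongr
      _ = _ := by field_simp
  have hγ0 : Tendsto (fun t => phaseGamma g (u t)) atTop (𝓝 0) :=
    (hγO.trans_isLittleO one_div_isLittleO_rpow_neg_half).trans_tendsto tendsto_rpow_neg_half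
  have hη0 : Tendsto (deviation g u) atTop (𝓝 0) := hη.trans_tendsto tendsto_rpow_neg_half
  have hN0 : Tendsto (fun t => deviation g u t - phaseGamma g (u t)) atTop (𝓝 0) := by
    simpa using hη0.sub hγ0
  have hP := R.tendsto_coeffP.comp hu.tendsto
  have hPb : ∀ᶠ t in atTop, 1 / (2 * q) ≤ coeffP g (u t) ∧ coeffP g (u t) ≤ 2 / q := by
    refine (hP.eventually (le_mem_nhds ?_)).and (hP.eventually (ge_mem_nhds ?_))
    · gcongr; linarith
    · gcongr; norm_num
  have hq2 : 0 < 1 / (2 * q) := by positivity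
  -- A priori decay of `η'` by the one-sided Landau inequality.
  have hY : deviation' g u u₁ =o[atTop] fun t => t ^ (-(1 / 2) : ℝ) := by
    refine landau_one_sided (C := 8 / q) (by positivity) hη1 hη2 ?_ hη
    filter_upwards [hwb, hPb, hN0.eventually (gt_mem_nhds (show (0 : ℝ) < Real.log 2 from
      Real.log_pos (by norm_num)))] with t ⟨e1, e2, e3⟩ ⟨e4, e5⟩ e6
    have hPpos : 0 < coeffP g (u t) := hq2.trans_le e4
    have hgpos : 0 < g (u t) := lt_of_lt_of_le (by positivity) e2
    have e7 : Real.exp (deviation g u t - phaseGamma g (u t)) ≤ 2 := by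
      rw [← Real.exp_log (show (0 : ℝ) < 2 by norm_num)]
      exact Real.exp_le_exp.2 e6.le
    have e8 : 1 / (g (u t) / coeffP g (u t)) ≤ 4 / q / t := by
      rw [one_div_div]
      calc coeffP g (u t) / g (u t) ≤ 2 / q / (1 / 2 * t) := by gcongr
        _ = _ := by field_simp; norm_num
    have e9 : 0 ≤ 1 / (g (u t) / coeffP g (u t)) := by positivity
    have e10 := sq_nonneg (1 + deviation' g u u₁ t)
    have e11 : 8 / q / t = 4 / q / t * 2 := by ring
    rw [e11]
    nlinarith
  have hY0 : Tendsto (deviation' g u u₁) atTop (𝓝 0) := hY.trans_tendsto tendsto_rpow_neg_half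
  obtain ⟨KP, LP, hsP⟩ := R.symbol_coeffP
  have hm := R.tendsto_phaseM.comp hu.tendsto
  have hmain := energy_decay (N := fun t => deviation g u t - phaseGamma g (u t))
    (Y := deviation' g u u₁) (A := fun t => g (u t) / coeffP g (u t))
    (a := fun t => 1 / coeffP g (u t) *
      (1 - scaledDeriv g (coeffP g) (u t) / coeffP g (u t)) *
        ((1 + deviation' g u u₁ t) / phaseM g (u t)))
    (δ := fun t => deriv (phaseGamma g) (u t) * u₁ t) (C := 16 * C) (c₁ := q / 4) (c₂ := 4 * q)
    (by positivity) ?_ hη2 ?_ ?_ ?_ ?_ ?_ hN0 hY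
  · refine ⟨?_, hmain.2⟩
    refine (hmain.1.add hγO).congr_left fun t => ?_
    ring
  · filter_upwards [hη1, hu.tendsto.eventually hγ, eventually_gt_atTop T] with t e1 e2 e3
    exact e1.sub (e2.2.1.hasDerivAt.comp t (hu.hasDerivAt t e3))
  · filter_upwards [hu.tendsto.eventually hsP, hu.tendsto.eventually R.differentiable,
      hu.tendsto.eventually R.phaseM_ge, hu.tendsto.eventually R.deriv_pos, hPb, hwb,
      eventually_gt_atTop T] with t e1 e2 e3 e4 ⟨e5, _⟩ ⟨_, e6, _⟩ e7
    have hPpos : 0 < coeffP g (u t) := hq2.trans_le e5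
    have hmpos : 0 < phaseM g (u t) := by linarith
    have hgpos : 0 < g (u t) := lt_of_lt_of_le (by positivity) e6
    have hd := (e2.hasDerivAt.div e1.1.hasDerivAt hPpos.ne').comp t (hu.hasDerivAt t e7)
    refine hd.congr_deriv ?_
    rw [deviation', scaledDeriv]
    field_simp
    ring
  · filter_upwards [hu.tendsto.eventually hγ, hu.tendsto.eventually R.phaseM_ge,
      hu.tendsto.eventually R.deriv_pos, hwb,
      hY0.eventually (gt_mem_nhds (show (0 : ℝ) < 1 by norm_num)),
      hY0.eventually (lt_mem_nhds (show (-1 : ℝ) < 0 by norm_num))]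
      with t e1 e2 e3 ⟨e4, e5, _⟩ e6 e7
    have hmpos : 0 < phaseM g (u t) := by linarith
    have hgpos : 0 < g (u t) := lt_of_lt_of_le (by positivity) e5
    have hu1 : u₁ t = (1 + deviation' g u u₁ t) / (deriv g (u t) * phaseM g (u t)) := by
      rw [deviation']; field_simp; ring
    have hu1' : |u₁ t| ≤ 4 / deriv g (u t) := by
      rw [hu1, abs_of_pos (div_pos (by linarith) (by positivity)),
        div_le_div_iff₀ (by positivity) e3]
      nlinarith
    rw [abs_mul]
    calc _ ≤ C * (deriv g (u t) / g (u t) ^ 2) * (4 / deriv g (u t)) := by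
          gcongr; exact e1.2.2
      _ = 4 * C / g (u t) ^ 2 := by field_simp
      _ ≤ 4 * C / (1 / 2 * t) ^ 2 := by gcongr
      _ = _ := by field_simp; ring
  · filter_upwards [hwb, hPb] with t ⟨e1, e2, e3⟩ ⟨e4, e5⟩
    have hPpos : 0 < coeffP g (u t) := hq2.trans_le e4
    rw [le_div_iff₀ hPpos]
    calc q / 4 * t * coeffP g (u t) ≤ q / 4 * t * (2 / q) := by gcongr
      _ = 1 / 2 * t := by field_simp; norm_num
      _ ≤ _ := e2
  · filter_upwards [hwb, hPb] with t ⟨e1, e2, e3⟩ ⟨e4, e5⟩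
    have hPpos : 0 < coeffP g (u t) := hq2.trans_le e4
    rw [div_le_iff₀ hPpos]
    calc g (u t) ≤ 2 * t := e3
      _ = 4 * q * t * (1 / (2 * q)) := by field_simp; norm_num
      _ ≤ _ := by gcongr
  · have hl : Tendsto (fun t => 1 / coeffP g (u t) *
        (1 - scaledDeriv g (coeffP g) (u t) / coeffP g (u t)) *
          ((1 + deviation' g u u₁ t) / phaseM g (u t))) atTop (𝓝 q) := by
      have hq0 : (1 / q : ℝ) ≠ 0 := by positivity
      have l1 := (tendsto_const_nhds (x := (1 : ℝ))).div hP hq0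
      have l2 := ((R.tendsto_scaledDeriv_coeffP.comp hu.tendsto).div hP hq0).const_sub 1
      have l3 := (hY0.const_add 1).div hm one_ne_zero
      have := (l1.mul l2).mul l3
      simpa using this
    exact hl.eventually (le_mem_nhds (by linarith))

end Dynamics

/-! ### The expansion in terms of the deviation -/

section Expansion

variable {f : ℝ → ℝ} {q : ℝ}

/-- The remainder of the expansion of `g(u)`, including the term `log (q H(g⁻¹(t)))`, in the
variable `t`. -/
def expansionError (g : ℝ → ℝ) (q : ℝ) (u : ℝ → ℝ) (t : ℝ) : ℝ :=
  g (u t) - (baseExpansion g q (Real.exp (-t / 2)) +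
    Real.log (q * growthH g (invOnNonneg g t)))

lemma hasSingularAsymptotics_iff {g U : ℝ → ℝ} {ε : ℝ} :
    HasSingularAsymptotics g q ε U ↔
      expansionError g q (fun t => U (Real.exp (-t / 2))) =o[atTop]
        fun t => t ^ (-1 + ε) := by
  rw [HasSingularAsymptotics, isLittleO_nhdsGT_iff]
  simp only [neg_two_mul_log_exp]
  exact ⟨fun h => h.trans_isTheta (neg_log_exp_rpow_isTheta _),
    fun h => h.trans_isTheta (neg_log_exp_rpow_isTheta _).symm⟩

lemma expansionError_eq (hf : PositiveC1 f) (R : RegularGrowth (logOf f) q) (u : ℝ → ℝ) :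
    ∀ᶠ t in atTop, expansionError (logOf f) q u t =
      logOf f (u t) - t + Real.log t + Real.log (deriv (logOf f) (invOnNonneg (logOf f) t)) -
        Real.log (growthH (logOf f) (invOnNonneg (logOf f) t)) - Real.log 4 := by
  obtain ⟨c, hc, hH⟩ := R.growthH_pos
  filter_upwards [baseExpansion_eq hf R, (tendsto_logInv hf R).eventually hH] with t h1 h2
  rw [expansionError, h1, Real.log_mul R.q_pos.ne' (hc.trans_le h2).ne']
  ring

lemma const_isBigO_log (c : ℝ) : (fun _ : ℝ => c) =O[atTop] Real.log :=
  (isLittleO_const_left.2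
    (Or.inr (tendsto_norm_atTop_atTop.comp Real.tendsto_log_atTop))).isBigO

lemma sub_isBigO_log_of_expansionError (hf : PositiveC1 f) (R : RegularGrowth (logOf f) q)
    {u : ℝ → ℝ} (h : Tendsto (expansionError (logOf f) q u) atTop (𝓝 0)) :
    (fun t => logOf f (u t) - t) =O[atTop] Real.log := by
  have hS := tendsto_logInv hf R
  have h1 : (fun t => Real.log (deriv (logOf f) (invOnNonneg (logOf f) t))) =O[atTop]
      Real.log := by
    refine (R.log_deriv_isBigO.comp_tendsto hS).congr' EventuallyEq.rfl ?_
    filter_upwards [logInv_spec hf R] with t ht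
    simp only [Function.comp, ht]
  have h2 : (fun t => Real.log (growthH (logOf f) (invOnNonneg (logOf f) t))) =O[atTop]
      Real.log := by
    have hq0 : (1 / q : ℝ) ≠ 0 := by have := R.q_pos; positivity
    have := ((R.tendsto_growthH.comp hS).log hq0).isBigO_one ℝ
    exact this.trans (const_isBigO_log 1)
  have h3 := (h.isBigO_one ℝ).trans (const_isBigO_log 1)
  refine ((((h3.sub (isBigO_refl _ _)).sub h1).add h2).add (const_isBigO_log (Real.log 4))).congr'
    ?_ EventuallyEq.rfl
  filter_upwards [expansionError_eq hf R u] with t ht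
  rw [ht]; ring

/-- The deviation and the remainder of the expansion agree up to `O(log t / t)`: they differ only by
increments of `log g`, `log g'` and `log H` between `u` and `g⁻¹(t)`. -/
lemma deviation_sub_expansionError (hf : PositiveC1 f) (R : RegularGrowth (logOf f) q)
    {u : ℝ → ℝ} (hu : Tendsto u atTop atTop)
    (hw : (fun t => logOf f (u t) - t) =O[atTop] Real.log) :
    (fun t => deviation (logOf f) u t - expansionError (logOf f) q u t) =O[atTop]
      fun t => Real.log t / t := by
  have hS := tendsto_logInv hf R
  obtain ⟨c, hc, hH⟩ := R.growthH_pos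
  have hconv : (fun t => Real.log (logOf f (u t)) -
      Real.log (logOf f (invOnNonneg (logOf f) t))) =O[atTop] fun t => Real.log t / t := by
    refine (log_sub_log_isBigO hw).congr' ?_ EventuallyEq.rfl
    filter_upwards [logInv_spec hf R] with t ht
    rw [ht]
  have h1 := (R.log_deriv_comp_sub_isBigO hu hS).trans hconv
  obtain ⟨K, L, hK⟩ := R.symbol_zero
  have h2 := (R.comp_sub_isBigO (Φ := fun s => Real.log (growthH (logOf f) s))
    (Φ' := fun s => deriv (growthH (logOf f)) s / growthH (logOf f) s) (L := L / c)
    (by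
      filter_upwards [hK, hH] with s e1 e2
      have hp : 0 < growthH (logOf f) s := hc.trans_le e2
      refine ⟨e1.1.hasDerivAt.log hp.ne', ?_⟩
      rw [abs_div, abs_of_pos hp, div_mul_eq_mul_div]
      exact div_le_div₀ ((abs_nonneg _).trans e1.2.2) e1.2.2 hc e2) hu hS).trans hconv
  refine ((hconv.add h1).sub h2).congr' ?_ EventuallyEq.rfl
  filter_upwards [expansionError_eq hf R u, logInv_spec hf R] with t e1 e2
  rw [e1, deviation, phase, e2]
  ring

lemma rpow_isBigO_rpow_neg_half {ε : ℝ} (hε : ε ≤ 1 / 2) :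
    (fun t : ℝ => t ^ (-1 + ε)) =O[atTop] fun t => t ^ (-(1 / 2) : ℝ) := by
  refine IsBigO.of_bound 1 ?_
  filter_upwards [eventually_ge_atTop 1] with t ht
  rw [one_mul, Real.norm_of_nonneg (Real.rpow_nonneg (by linarith) _),
    Real.norm_of_nonneg (Real.rpow_nonneg (by linarith) _)]
  exact Real.rpow_le_rpow_of_exponent_le ht (by linarith)

/-- A solution whose expansion has remainder `o(t^{-1/2})` has deviation `O(1 / t)`. -/
theorem IsLogSolution.decay_of_expansion {T : ℝ} {u u₁ : ℝ → ℝ} (hf : PositiveC1 f)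
    (R : RegularGrowth (logOf f) q) (hu : IsLogSolution f T u u₁)
    (h : expansionError (logOf f) q u =o[atTop] fun t => t ^ (-(1 / 2) : ℝ)) :
    (fun t => logOf f (u t) - t) =O[atTop] Real.log ∧
      deviation (logOf f) u =O[atTop] (fun t => 1 / t) ∧
      deviation' (logOf f) u u₁ =O[atTop] fun t => t ^ (-(3 / 2) : ℝ) := by
  have hw := sub_isBigO_log_of_expansionError hf R (h.trans_tendsto tendsto_rpow_neg_half)
  have h1 := (deviation_sub_expansionError hf R hu.tendsto hw).trans_isLittleO
    log_div_isLittleO_rpow_neg_half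
  exact ⟨hw, hu.deviation_decay hf R hw ((h1.add h).congr_left fun t => by ring)⟩

/-- The expansion with remainder `o(t^{-1/2})` improves itself to remainder
`o(t^{-1 + ε})` for every `ε > 0`. -/
theorem IsLogSolution.expansion_improves {T ε : ℝ} {u u₁ : ℝ → ℝ} (hf : PositiveC1 f)
    (R : RegularGrowth (logOf f) q) (hu : IsLogSolution f T u u₁)
    (h : expansionError (logOf f) q u =o[atTop] fun t => t ^ (-(1 / 2) : ℝ)) (hε : 0 < ε) :
    expansionError (logOf f) q u =o[atTop] fun t => t ^ (-1 + ε) := by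
  obtain ⟨hw, hη, -⟩ := hu.decay_of_expansion hf R h
  have h1 := (hη.trans one_div_isBigO_log_div).sub
    (deviation_sub_expansionError hf R hu.tendsto hw)
  exact (h1.congr_left fun t => by ring).trans_isLittleO (log_div_isLittleO_rpow hε)

end Expansion

/-! ### Uniqueness -/

section Uniqueness

variable {f : ℝ → ℝ} {q T : ℝ} {u u₁ v v₁ : ℝ → ℝ}

/-- The mean value theorem for `f` near infinity, with `f' = f g'`. -/
lemma exists_mean_value (hf : PositiveC1 f) (R : RegularGrowth (logOf f) q) :
    ∃ A, ∀ a ≥ A, ∀ b ≥ A, ∃ ξ ∈ uIcc a b,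
      f a - f b = f ξ * deriv (logOf f) ξ * (a - b) := by
  obtain ⟨A, hA⟩ := eventually_atTop.1 (eventually_deriv_eq hf R)
  have key : ∀ a ≥ A, ∀ b, a < b → ∃ ξ ∈ uIcc a b,
      f a - f b = f ξ * deriv (logOf f) ξ * (a - b) := fun a ha b hab => by
    obtain ⟨ξ, hξ, e⟩ := exists_hasDerivAt_eq_slope f _ hab
      (fun x hx => (hA x (ha.le.trans hx.1)).continuousAt.continuousWithinAt)
      (fun x hx => hA x (ha.le.trans hx.1.le))
    refine ⟨ξ, Icc_subset_uIcc ⟨hξ.1.le, hξ.2.le⟩, ?_⟩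
    rw [e]
    have : b - a ≠ 0 := by linarith
    field_simp
    ring
  refine ⟨A, fun a ha b hb => ?_⟩
  rcases lt_trichotomy a b with h | rfl | h
  · exact key a ha b h
  · exact ⟨a, left_mem_uIcc, by simp⟩
  · obtain ⟨ξ, hξ, e⟩ := key b hb a h
    exact ⟨ξ, uIcc_comm a b ▸ hξ, by linarith⟩

/-- Increments of a function whose derivative is `O(g')` are controlled by those of the phase. -/
lemma RegularGrowth.comp_sub_isBigO_phase {g : ℝ → ℝ} (R : RegularGrowth g q) {Φ Φ' : ℝ → ℝ}
    {L : ℝ} (h : ∀ᶠ s in atTop, HasDerivAt Φ (Φ' s) s ∧ |Φ' s| ≤ L * deriv g s) :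
    ∃ C, 0 ≤ C ∧ ∃ A, ∀ a ≥ A, ∀ b ≥ A, |Φ a - Φ b| ≤ C * |phase g a - phase g b| := by
  obtain ⟨A, hA⟩ := eventually_atTop.1
    (h.and (R.hasDerivAt_phase.and (R.phaseM_ge.and R.deriv_pos)))
  refine ⟨2 * |L|, by positivity, A, fun a ha b hb => ?_⟩
  have := abs_sub_le_of_abs_deriv_le (Θ := fun s => 2 * |L| * phase g s)
    (fun s hs => (hA s hs).1.1) (fun s hs => (hA s hs).2.1.const_mul (2 * |L|))
    (fun s hs => by
      obtain ⟨h1, -, h3, h4⟩ := hA s hs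
      calc |Φ' s| ≤ L * deriv g s := h1.2
        _ ≤ |L| * deriv g s := by gcongr; exact le_abs_self L
        _ = 2 * |L| * (deriv g s * (1 / 2)) := by ring
        _ ≤ _ := by gcongr) ha hb
  rwa [← mul_sub, abs_mul, abs_of_nonneg (by positivity : 0 ≤ 2 * |L|)] at this

/-- Two solutions whose deviations are `O(1 / t)` agree near infinity if one of them has `η' =
O(t^{-3/2})`. Their difference solves a linear equation to which `eq_zero_of_energy` applies; its
coefficient, `e^{-t} f'(u) / 4` up to a factor `1 + O(1 / t)`, has the monotonicity that the energy
argument needs because of the rate of `η'`. -/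
theorem IsLogSolution.eventuallyEq (hf : PositiveC1 f) (R : RegularGrowth (logOf f) q)
    (hu : IsLogSolution f T u u₁) (hv : IsLogSolution f T v v₁)
    (hw : (fun t => logOf f (u t) - t) =O[atTop] Real.log)
    (hηu : deviation (logOf f) u =O[atTop] fun t => 1 / t)
    (hηv : deviation (logOf f) v =O[atTop] fun t => 1 / t)
    (hYu : deviation' (logOf f) u u₁ =O[atTop] fun t => t ^ (-(3 / 2) : ℝ)) :
    u =ᶠ[atTop] v := by
  set g := logOf f with hg
  have hq := R.q_pos
  obtain ⟨c, hc, hge⟩ := R.deriv_ge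
  obtain ⟨cH, hcH, hHge⟩ := R.growthH_pos
  obtain ⟨K, L, hK⟩ := R.symbol_zero
  have hut := hu.tendsto
  have hvt := hv.tendsto
  have hone : Tendsto (fun t : ℝ => 1 / t) atTop (𝓝 0) :=
    tendsto_const_nhds.div_atTop tendsto_id
  have hη0 : Tendsto (deviation g u) atTop (𝓝 0) := hηu.trans_tendsto hone
  have htY : Tendsto (fun t => t * deviation' g u u₁ t) atTop (𝓝 0) := by
    have h1 := (isBigO_refl (fun t : ℝ => t) atTop).mul hYu
    refine h1.trans_tendsto (tendsto_rpow_neg_half.congr' ?_)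
    filter_upwards [eventually_gt_atTop 0] with t ht
    rw [← Real.rpow_one_add' ht.le (by norm_num)]
    norm_num
  have hY0 : Tendsto (deviation' g u u₁) atTop (𝓝 0) :=
    hYu.trans_tendsto (tendsto_rpow_neg_atTop (by norm_num))
  have hdiv := tendsto_div_of_sub_isBigO_log hw
  have hH := R.tendsto_growthH.comp hut
  have hm := R.tendsto_phaseM.comp hut
  have hq0 : (1 / q : ℝ) ≠ 0 := by positivity
  -- The phase difference is `O(1 / t)`.
  obtain ⟨Cp, hCp, hp⟩ : ∃ Cp, 0 < Cp ∧ ∀ᶠ t in atTop,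
      |phase g (u t) - phase g (v t)| ≤ Cp * (1 / t) := by
    obtain ⟨C, hC, h⟩ := (hηu.sub hηv).exists_pos
    refine ⟨C, hC, ?_⟩
    filter_upwards [h.bound, eventually_gt_atTop 0] with t h1 h2
    rw [Real.norm_eq_abs, Real.norm_of_nonneg (by positivity)] at h1
    convert h1 using 2
    simp only [deviation]; ring
  -- `v - u = O(1 / t)`
  obtain ⟨C₁, hC₁, A₁, hid⟩ := R.comp_sub_isBigO_phase (Φ := fun s => s) (Φ' := fun _ => 1)
    (L := 1 / c) (by
      filter_upwards [hge] with s hs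
      refine ⟨hasDerivAt_id s, ?_⟩
      rw [abs_one, div_mul_eq_mul_div, one_mul, one_le_div hc]
      exact hs)
  have hd : (fun t => u t - v t) =O[atTop] fun t => 1 / t := by
    refine IsBigO.of_bound (C₁ * Cp) ?_
    filter_upwards [hp, hut.eventually_ge_atTop A₁, hvt.eventually_ge_atTop A₁,
      eventually_gt_atTop 0] with t h1 h2 h3 h4
    rw [Real.norm_eq_abs, Real.norm_of_nonneg (by positivity)]
    calc _ ≤ C₁ * |phase g (u t) - phase g (v t)| := hid _ h2 _ h3
      _ ≤ C₁ * (Cp * (1 / t)) := by gcongr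
      _ = _ := by ring
  -- `g + log g'`, the logarithm of `f'`, varies by `O(1 / t)` between the two solutions.
  set k : ℝ → ℝ := fun s => g s + Real.log (deriv g s) with hk
  have hkd : ∀ᶠ s in atTop, HasDerivAt k (deriv g s + growthH g s * (deriv g s / g s)) s ∧
      0 ≤ deriv g s + growthH g s * (deriv g s / g s) ∧
      |deriv g s + growthH g s * (deriv g s / g s)| ≤ (1 + K) * deriv g s := by
    obtain ⟨L', hL'⟩ := R.log_deriv_hasDerivAt
    filter_upwards [hL', R.differentiable, R.deriv_pos, R.tendsto.eventually_ge_atTop 1, hHge, hK]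
      with s h1 h2 h3 h4 h5 h6
    have hHp : 0 < growthH g s := hcH.trans_le h5
    have hgp : 0 < g s := by linarith
    have h0 : 0 ≤ deriv g s + growthH g s * (deriv g s / g s) := by positivity
    refine ⟨h2.hasDerivAt.add h1.1, h0, ?_⟩
    rw [abs_of_nonneg h0, add_mul, one_mul]
    exact add_le_add le_rfl (mul_le_mul ((le_abs_self _).trans h6.2.1) (div_le_self h3.le h4)
      (by positivity) ((abs_nonneg _).trans h6.2.1))
  obtain ⟨C₂, hC₂, A₂, hkp⟩ := R.comp_sub_isBigO_phase (hkd.mono fun s h => ⟨h.1, h.2.2⟩)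
  obtain ⟨A₃, hA₃⟩ := eventually_atTop.1 (hkd.and (R.deriv_pos.and (eventually_ge_atTop 0)))
  have hkmono : MonotoneOn k (Ici A₃) :=
    monotoneOn_Ici_of_hasDerivAt (fun s hs => (hA₃ s hs).1.1) fun s hs => (hA₃ s hs).1.2.1
  obtain ⟨A₄, hmv⟩ := exists_mean_value hf R
  -- The coefficient `A` of the linear equation for `u - v` is the reciprocal of
  -- `e^{-t} f'(u) / 4`.
  set A : ℝ → ℝ := fun t => g (u t) * Real.exp (-deviation g u t) / growthH g (u t) with hA
  have hAinv : ∀ᶠ t in atTop, 0 < A t ∧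
      1 / A t = 1 / 4 * Real.exp (-t) * (f (u t) * deriv g (u t)) := by
    filter_upwards [hu.exp_deviation hf R, hut.eventually hHge,
      hut.eventually (R.tendsto.eventually_gt_atTop 0)] with t h1 h2 h3
    have hHp : 0 < growthH g (u t) := hcH.trans_le h2
    have h3' : 0 < logOf f (u t) := h3
    refine ⟨by simp only [hA]; positivity, ?_⟩
    simp only [hA]
    rw [Real.exp_neg, h1]
    simp only [← hg]
    field_simp
  set e : ℝ → ℝ := fun t => if u t = v t then 0 else
    (f (u t) - f (v t)) / (f (u t) * deriv g (u t) * (u t - v t)) - 1 with he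
  have hlin : ∀ᶠ t in atTop, (1 + e t) / A t * (u t - v t) =
      1 / 4 * Real.exp (-t) * (f (u t) - f (v t)) := by
    filter_upwards [hAinv, hut.eventually R.deriv_pos, eventually_gt_atTop T] with t h1 h2 h3
    have hfp := hf.2 _ (hu.nonneg t h3)
    rw [div_eq_mul_one_div, h1.2]
    by_cases huv : u t = v t
    · simp [huv]
    · have : u t - v t ≠ 0 := sub_ne_zero.2 huv
      simp only [he, if_neg huv, add_sub_cancel]
      field_simp
  have heb : ∀ᶠ t in atTop, |e t| ≤ 2 * (C₂ * Cp) / t := by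
    have hsm : Tendsto (fun t : ℝ => C₂ * Cp * (1 / t)) atTop (𝓝 0) := by
      simpa using hone.const_mul (C₂ * Cp)
    filter_upwards [hp, hut.eventually_ge_atTop A₂, hvt.eventually_ge_atTop A₂,
      hut.eventually_ge_atTop A₃, hvt.eventually_ge_atTop A₃, hut.eventually_ge_atTop A₄,
      hvt.eventually_ge_atTop A₄, hsm.eventually (ge_mem_nhds zero_lt_one),
      eventually_gt_atTop 0] with t h1 h2 h2' h3 h3' h4 h4' h5 h6
    by_cases huv : u t = v t
    · simp only [he, if_pos huv, abs_zero]; positivity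
    have hne : u t - v t ≠ 0 := sub_ne_zero.2 huv
    obtain ⟨ξ, hξ, hξe⟩ := hmv _ h4 _ h4'
    have hξA : A₃ ≤ ξ := le_trans (le_min h3 h3') hξ.1
    have hexpk : ∀ s ≥ A₃, f s * deriv g s = Real.exp (k s) := fun s hs => by
      rw [hk, Real.exp_add, Real.exp_log (hA₃ s hs).2.1, hg, exp_logOf hf (hA₃ s hs).2.2]
    have hk1 : |k (u t) - k (v t)| ≤ C₂ * Cp * (1 / t) := by
      calc _ ≤ C₂ * |phase g (u t) - phase g (v t)| := hkp _ h2 _ h2'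
        _ ≤ C₂ * (Cp * (1 / t)) := by gcongr
        _ = _ := by ring
    have hk2 : |k ξ - k (u t)| ≤ |k (u t) - k (v t)| := by
      have hmem : k ξ ∈ uIcc (k (u t)) (k (v t)) := by
        rcases le_total (u t) (v t) with hle | hle
        · rw [uIcc_of_le hle] at hξ
          rw [uIcc_of_le (hkmono h3 h3' hle)]
          exact ⟨hkmono h3 hξA hξ.1, hkmono hξA h3' hξ.2⟩
        · rw [uIcc_of_ge hle] at hξ
          rw [uIcc_of_ge (hkmono h3' h3 hle)]
          exact ⟨hkmono h3' hξA hξ.1, hkmono hξA h3 hξ.2⟩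
      rw [abs_sub_comm (k (u t)) (k (v t))]
      exact abs_sub_left_of_mem_uIcc hmem
    have he1 : e t = Real.exp (k ξ - k (u t)) - 1 := by
      simp only [he, if_neg huv]
      rw [hξe, mul_div_mul_right _ _ hne]
      rw [hexpk ξ hξA, hexpk (u t) h3, Real.exp_sub]
    rw [he1]
    have h7 := hk2.trans hk1
    refine (Real.abs_exp_sub_one_le (h7.trans h5)).trans ?_
    calc 2 * |k ξ - k (u t)| ≤ 2 * (C₂ * Cp * (1 / t)) := by gcongr
      _ = _ := by ring
  have hAdiv : Tendsto (fun t => A t / t) atTop (𝓝 q) := by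
    have h1 := ((Real.continuous_exp.tendsto 0).comp
      (show Tendsto (fun t => -deviation g u t) atTop (𝓝 0) by simpa using hη0.neg))
    have h2 := (hdiv.mul h1).div hH hq0
    rw [Real.exp_zero, mul_one, one_div_one_div] at h2
    refine h2.congr fun t => ?_
    simp only [hA, Function.comp, Pi.div_apply]
    ring
  have hAb : ∀ᶠ t in atTop, q / 2 * t ≤ A t ∧ A t ≤ 2 * q * t := by
    filter_upwards [hAdiv.eventually (le_mem_nhds (show q / 2 < q by linarith)),
      hAdiv.eventually (ge_mem_nhds (show q < 2 * q by linarith)), eventually_gt_atTop 0]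
      with t h1 h2 h3
    rw [le_div_iff₀ h3] at h1
    rw [div_le_iff₀ h3] at h2
    exact ⟨h1, h2⟩
  -- `A' = A ((1 - D H / H) g' u' / g - η')`, and the bracket is `(1 + o(1)) / t`.
  set b : ℝ → ℝ := fun t => (1 - scaledDeriv g (growthH g) (u t) / growthH g (u t)) *
    ((1 + deviation' g u u₁ t) / phaseM g (u t)) / g (u t) - deviation' g u u₁ t with hb
  have hbpos : ∀ᶠ t in atTop, 0 ≤ b t := by
    have l1 := ((R.tendsto_scaledDeriv.comp hut).div hH hq0).const_sub 1
    have l2 := (hY0.const_add 1).div hm one_ne_zero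
    have l3 := (((l1.mul l2).div hdiv one_ne_zero).sub htY)
    norm_num at l3
    filter_upwards [l3.eventually (le_mem_nhds (show (0 : ℝ) < 1 by norm_num)),
      eventually_gt_atTop 0, hut.eventually (R.tendsto.eventually_gt_atTop 0)] with t h1 h2 h3
    have h4 : 0 ≤ t * b t := by
      refine h1.trans (le_of_eq ?_)
      simp only [hb]
      field_simp
    exact nonneg_of_mul_nonneg_right h4 h2
  have hAd : ∀ᶠ t in atTop, HasDerivAt A (A t * b t) t := by
    filter_upwards [hut.eventually R.differentiable, hut.eventually hK, hut.eventually hHge,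
      hut.eventually (R.tendsto.eventually_gt_atTop 0), hut.eventually R.deriv_pos,
      hut.eventually R.phaseM_ge, hu.hasDerivAt_deviation R, eventually_gt_atTop T]
      with t h1 h2 h3 h4 h5 h6 h7 h8
    have hHp : 0 < growthH g (u t) := hcH.trans_le h3
    have hmp : 0 < phaseM g (u t) := by linarith
    have hu0 := hu.hasDerivAt t h8
    refine ((((h1.hasDerivAt.comp t hu0).fun_mul h7.fun_neg.exp).fun_div
      (h2.1.hasDerivAt.comp t hu0) hHp.ne')).congr_deriv ?_
    have hu1 : (1 + deviation' g u u₁ t) / phaseM g (u t) = deriv g (u t) * u₁ t := by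
      rw [deviation']; field_simp; ring
    simp only [hA, hb, hu1, Function.comp, scaledDeriv, ← hg]
    field_simp
    ring
  have hd0 : (fun t => u t - v t) =o[atTop] fun t => t ^ (-(1 / 2) : ℝ) :=
    hd.trans_isLittleO one_div_isLittleO_rpow_neg_half
  have hdd : ∀ᶠ t in atTop, HasDerivAt (fun t => u t - v t) (u₁ t - v₁ t) t := by
    filter_upwards [eventually_gt_atTop T] with t ht
      using (hu.hasDerivAt t ht).sub (hv.hasDerivAt t ht)
  have hdd' : ∀ᶠ t in atTop, HasDerivAt (fun t => u₁ t - v₁ t)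
      (-(1 / 4 * Real.exp (-t) * (f (u t) - f (v t)))) t := by
    filter_upwards [eventually_gt_atTop T] with t ht
      using ((hu.hasDerivAt' t ht).sub (hv.hasDerivAt' t ht)).congr_deriv (by ring)
  have hd1 : (fun t => u₁ t - v₁ t) =o[atTop] fun t => t ^ (-(1 / 2) : ℝ) := by
    refine landau_one_sided (C := 2 / (q * c)) (by positivity) hdd hdd' ?_ hd0
    filter_upwards [hAinv, hAb, hut.eventually hge, eventually_gt_atTop T, eventually_gt_atTop 0]
      with t ⟨h1, h2⟩ ⟨h3, _⟩ h4 h5 h6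
    have hgp : 0 < deriv g (u t) := hc.trans_le h4
    have hfv := hf.2 _ (hv.nonneg t h5)
    have h7 : 1 / 4 * Real.exp (-t) * f (u t) ≤ 2 / (q * c) / t := by
      calc 1 / 4 * Real.exp (-t) * f (u t) = 1 / A t / deriv g (u t) := by
            rw [h2]; field_simp
        _ ≤ 1 / (q / 2 * t) / c := by gcongr
        _ = _ := by field_simp
    have h8 : 0 ≤ 1 / 4 * Real.exp (-t) * f (v t) := by positivity
    linarith
  have := eq_zero_of_energy (v := fun t => u t - v t) (v₁ := fun t => u₁ t - v₁ t) (A := A)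
    (a := fun t => A t * b t) (e := e) (C := 2 * (C₂ * Cp)) (c₁ := q / 2) (c₂ := 2 * q)
    (by positivity) hdd ?_ hAd ?_ heb (hAb.mono fun t h => h.1) (hAb.mono fun t h => h.2)
    (hd0.trans_tendsto tendsto_rpow_neg_half) (tendsto_mul_sq_of_isLittleO hd1)
  · exact this.mono fun t ht => sub_eq_zero.1 ht
  · filter_upwards [hdd', hlin] with t h1 h2
    rw [h2]; exact h1
  · filter_upwards [hAinv, hbpos] with t h1 h2 using mul_nonneg h1.1.le h2

/-- Two singular solutions with the given expansion up to `o((-log r)^{-1/2})` agree wherever both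
are defined. -/
theorem IsRadialSingularSolution.eqOn {ρ ρ' : ℝ} {U V : ℝ → ℝ} (hf : PositiveC1 f)
    (R : RegularGrowth (logOf f) q) (hU : IsRadialSingularSolution f ρ U)
    (hV : IsRadialSingularSolution f ρ' V)
    (aU : expansionError (logOf f) q (fun t => U (Real.exp (-t / 2))) =o[atTop]
      fun t => t ^ (-(1 / 2) : ℝ))
    (aV : expansionError (logOf f) q (fun t => V (Real.exp (-t / 2))) =o[atTop]
      fun t => t ^ (-(1 / 2) : ℝ)) :
    EqOn U V (Ioo 0 (min ρ ρ')) := by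
  intro r hr
  have hρ : 0 < min ρ ρ' := hr.1.trans hr.2
  have hU' := hU.isLogSolution.mono (T' := -2 * Real.log (min ρ ρ')) (by
    have := Real.log_le_log hρ (min_le_left ρ ρ'); linarith)
  have hV' := hV.isLogSolution.mono (T' := -2 * Real.log (min ρ ρ')) (by
    have := Real.log_le_log hρ (min_le_right ρ ρ'); linarith)
  obtain ⟨w1, e1, y1⟩ := hU'.decay_of_expansion hf R aU
  obtain ⟨-, e2, -⟩ := hV'.decay_of_expansion hf R aV
  have h := hU'.eq_of_eventuallyEq hf hV' (hU'.eventuallyEq hf R hV' w1 e1 e2 y1)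
    (t := -2 * Real.log r) (by have := Real.log_lt_log hr.1 hr.2; linarith)
  have hlog : -(-2 * Real.log r) / 2 = Real.log r := by ring
  simpa only [hlog, Real.exp_log hr.1] using h

end Uniqueness

end SingularSolution

end

open SingularSolution
theorem lemmaB3 (f : ℝ → ℝ) (q : ℝ) (hf : PositiveC1 f)
    (hG1 : CondG1 (logOf f) q) (hG2 : CondG2 (logOf f)) (hadd : CondAdd (logOf f)) :
    (∀ ε : ℝ, 0 < ε →
      (fun r => logOf f (modelU f q r) - baseExpansion (logOf f) q r)
        =o[𝓝[>] 0] fun r => (-Real.log r) ^ (-1 + ε)) ∧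
    (CondF3 f q →
      ∀ (ρ : ℝ) (u : ℝ → ℝ), IsRadialSingularSolution f ρ u →
        ((fun r => u r - modelU f q r)
          =O[𝓝[>] 0] fun r => f (modelU f q r) * tailF f (modelU f q r) * remainderSup f q r) →
        ((fun r => logOf f (u r) - logOf f (modelU f q r)) =O[𝓝[>] 0] remainderSup f q) ∧
        ((fun r => logOf f (u r) - logOf f (modelU f q r))
          =o[𝓝[>] 0] fun r => (-Real.log r) ^ (-(1 / 2) : ℝ)) ∧
        (∀ ε ∈ Ioc (0 : ℝ) (1 / 2), HasSingularAsymptotics (logOf f) q ε u) ∧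
        (∀ (ρ' : ℝ) (U : ℝ → ℝ), IsRadialSingularSolution f ρ' U →
          (∃ ε ∈ Ioc (0 : ℝ) (1 / 2), HasSingularAsymptotics (logOf f) q ε U) →
          EqOn u U (Ioo 0 (min ρ ρ')))) := by
  have R := regularGrowth hG1 hG2 hadd
  refine ⟨fun ε hε => logOf_modelU_expansion hf R hε, fun hF3 ρ u hu huO => ?_⟩
  have hR := hF3.remainderSup_isLittleO
  have h1 : (fun r => logOf f (u r) - logOf f (modelU f q r)) =O[𝓝[>] 0] remainderSup f q :=
    logOf_sub_isBigO_of_sub hf R (tendsto_nhdsGT_iff.2 (tendsto_modelUt hf R)) hu.singular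
      (hR.trans_tendsto tendsto_neg_log_rpow_neg_half) huO
  have h2 := h1.trans_isLittleO hR
  have hu' := hu.isLogSolution
  -- The three contributions to the remainder of the expansion of `g(u)`.
  have h3 : expansionError (logOf f) q (fun t => u (Real.exp (-t / 2))) =o[atTop]
      fun t => t ^ (-(1 / 2) : ℝ) := by
    have a1 := (isLittleO_nhdsGT_iff.1 h2).trans_isTheta (neg_log_exp_rpow_isTheta _)
    have a2 := (logOf_modelUt_sub_base_isBigO hf R).trans_isLittleO
      log_div_isLittleO_rpow_neg_half
    refine ((a1.add a2).sub (hF3.log_growthH_isLittleO hf R)).congr_left fun t => ?_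
    simp only [expansionError, modelUt]
    ring
  refine ⟨h1, h2, fun ε hε => hasSingularAsymptotics_iff.2
    (hu'.expansion_improves hf R h3 hε.1), fun ρ' U hU ⟨ε, hε, hUε⟩ => ?_⟩
  exact hu.eqOn hf R hU h3
    ((hasSingularAsymptotics_iff.1 hUε).trans_isBigO (rpow_isBigO_rpow_neg_half hε.2))
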